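/- **Definitions.** Let $G$ be a finite graph on $n$ vertices. For $A\subseteq V(G)$ let $N_G(A)$ be the set of vertices outside $A$ with a neighbour in $A$, and $N_G(x)=N_G(\{x\})$. For $v\in V(G)$ and $k\ge 1$ let $B_G(v,k)$ and $\partial_G(v,k)$ be the sets of vertices at graph distance at most $k$, respectively exactly $k$, from $v$. The *strong 4-core* $S=S(G)$ is the largest $A\subseteq V(G)$ such that $|N_G(x)\cap A|\ge 4$ for every $x\in A\cup N_G(A)$. Put $P=P(G)=N_G(S)$ and $R=R(G)=V(G)\setminus(S\cup P)$. For a graph $H$ and a vertex set $W$, a *family of $W$-paths* in $H$ is a set of pairwise vertex-disjoint paths in $H$ (paths of length $0$ allowed), all of whose endpoints lie in $W\cap V(H)$. Let $\mathrm{uc}(H;W)$ be the minimum, over all families of $W$-paths in $H$, of the number of vertices of $V(H)\setminus W$ lying on no path of the family. Set $$\Phi(G)=\mathrm{uc}(G[P\cup R];P),\qquad \widetilde L(G)=n-\Phi(G).$$ For $v\in V(G)$ and $k\ge1$, let $A=A_k(G,v)$ be the largest set $A\subseteq B_G(v,k-1)$ such that $$|N_G(x)\cap(A\cup\partial_G(v,k))|\ge4\quad\text{for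 every }x\in(A\cup N_G(A))\setminus\partial_G(v,k),$$ and put $S_k(G,v)=A\cup\partial_G(v,k)$, $P_k(G,v)=N_G(S_k(G,v)\setminus\partial_G(v,k))\setminus\partial_G(v,k)$ and $R_k(G,v)=B_G(v,k)\setminus(S_k(G,v)\cup P_k(G,v))$. If $v\in S_k(G,v)$, let $\phi_{G,k}(v)=0$. Otherwise let $C_v^k$ be the component of $G[P_k(G,v)\cup R_k(G,v)]$ containing $v$ and let $\phi_{G,k}(v)=\mathrm{uc}(G[C_v^k];P_k(G,v))/|C_v^k|$. Set $$\widetilde L_k(G)=n-\sum_{v\in V(G)}\phi_{G,k}(v).$$ For a random graph $G$ on $n$ vertices let $$\widetilde X(G)=\frac{\widetilde L(G)-\mathbb E[\widetilde L(G)]}{\sqrt n},\qquad \widetilde X_k(G)=\frac{\widetilde L_k(G)-\mathbb E[\widetilde L_k(G)]}{\sqrt n}.$$ **Lemma.** Let the integer $k\ge100$ and the real number $c\ge20$ be fixed, and let $G\sim G(n,\tfrac cn)$ (for $n\ge c$). Then, as $n\to\infty$, $$\mathrm{Var}\big(\widetilde X(G)-\widetilde X_k(G)\big)\le 64\,c\,k^2\left(\tfrac34\right)^{k-2}+o(1),$$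 where the $o(1)$ term may depend on $c$ and $k$. -/

import Mathlib

open Filter Topology MeasureTheory ProbabilityTheory

namespace StrongCore

/-- The external neighbourhood `N_G(A)`: vertices outside `A` with a neighbour in `A`. -/
def extNbr {V : Type*} (G : SimpleGraph V) (A : Set V) : Set V :=
  {x | x ∉ A ∧ ∃ y ∈ A, G.Adj x y}

/-- The ball `B_G(x,k)`; `edist` is `⊤` between different components. -/
def gball {V : Type*} (G : SimpleGraph V) (x : V) (k : ℕ) : Set V :=
  {y | G.edist x y ≤ (k : ℕ∞)}

/-- The sphere `∂_G(x,k)`. -/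
def gsphere {V : Type*} (G : SimpleGraph V) (x : V) (k : ℕ) : Set V :=
  {y | G.edist x y = (k : ℕ∞)}

/-- `A` has the strong 4-core property for `G`. -/
def HasStrongCoreProp {V : Type*} (G : SimpleGraph V) (A : Set V) : Prop :=
  ∀ x ∈ A ∪ extNbr G A, 4 ≤ (G.neighborSet x ∩ A).encard

/-- The strong 4-core `S(G)`, the largest set with the strong 4-core property
(see `isGreatest_sapphire`). -/
def sapphire {V : Type*} (G : SimpleGraph V) : Set V :=
  ⋃₀ {A | HasStrongCoreProp G A}

/-- `P(G) = N_G(S(G))`. -/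
def purple {V : Type*} (G : SimpleGraph V) : Set V :=
  extNbr G (sapphire G)

/-- `R(G)`: all remaining vertices. -/
def red {V : Type*} (G : SimpleGraph V) : Set V :=
  (sapphire G ∪ purple G)ᶜ

/-- A family of `W`-paths in `H`: pairwise vertex-disjoint paths (length `0` allowed), all of
whose endpoints are in `W`. -/
structure IsPathFamily {U : Type*} (H : SimpleGraph U) (W : Set U)
    (F : Set (Σ a b : U, H.Path a b)) : Prop where
  endpoints : ∀ q ∈ F, q.1 ∈ W ∧ q.2.1 ∈ W
  disjoint : F.PairwiseDisjoint fun q => {x | x ∈ q.2.2.1.support}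

/-- The vertices covered by a family of paths. -/
def covered {U : Type*} {H : SimpleGraph U} (F : Set (Σ a b : U, H.Path a b)) : Set U :=
  {x | ∃ q ∈ F, x ∈ q.2.2.1.support}

/-- `uc(H;W)`: the minimal number of vertices outside `W` left uncovered by a family of `W`-paths
in the finite graph `H`. -/
noncomputable def uc {U : Type*} (H : SimpleGraph U) (W : Set U) : ℕ :=
  sInf {m | ∃ F : Set (Σ a b : U, H.Path a b), IsPathFamily H W F ∧ m = (Wᶜ \ covered F).ncard}

/-- `uc(G[U]; W ∩ U)` for vertex sets `U`, `W` of `G`. -/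
noncomputable def ucOn {V : Type*} (G : SimpleGraph V) (U W : Set V) : ℕ :=
  uc (G.induce U) ((↑) ⁻¹' W : Set U)

/-- `Φ(G) = uc(G[P ∪ R]; P)`. -/
noncomputable def Phi {V : Type*} (G : SimpleGraph V) : ℕ :=
  ucOn G (purple G ∪ red G) (purple G)

/-- The vertex set of the component of `G[U]` containing `v` (empty if `v ∉ U`). -/
def compIn {V : Type*} (G : SimpleGraph V) (U : Set V) (v : V) : Set V :=
  {x | ∃ (hv : v ∈ U) (hx : x ∈ U), (G.induce U).Reachable ⟨v, hv⟩ ⟨x, hx⟩}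

/-- The condition on `A ⊆ B_G(v,k-1)` in the definition of the `k`-local strong 4-core
(for `k ≥ 1`). -/
def HasLocalCoreProp {V : Type*} (G : SimpleGraph V) (v : V) (k : ℕ) (A : Set V) : Prop :=
  A ⊆ gball G v (k - 1) ∧
    ∀ x ∈ (A ∪ extNbr G A) \ gsphere G v k, 4 ≤ (G.neighborSet x ∩ (A ∪ gsphere G v k)).encard

/-- The largest set with the local property (see `isGreatest_localCore`). -/
def localCore {V : Type*} (G : SimpleGraph V) (v : V) (k : ℕ) : Set V :=
  ⋃₀ {A | HasLocalCoreProp G v k A}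

/-- The `k`-local strong 4-core `S_k(G,v)`. -/
def localSapphire {V : Type*} (G : SimpleGraph V) (v : V) (k : ℕ) : Set V :=
  localCore G v k ∪ gsphere G v k

/-- `P_k(G,v)`. -/
def localPurple {V : Type*} (G : SimpleGraph V) (v : V) (k : ℕ) : Set V :=
  extNbr G (localSapphire G v k \ gsphere G v k) \ gsphere G v k

/-- `R_k(G,v)`. -/
def localRed {V : Type*} (G : SimpleGraph V) (v : V) (k : ℕ) : Set V :=
  gball G v k \ (localSapphire G v k ∪ localPurple G v k)

/-- `C_v^k(G)`: the component of `G[P_k(G,v) ∪ R_k(G,v)]` containing `v`. -/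
def localComp {V : Type*} (G : SimpleGraph V) (v : V) (k : ℕ) : Set V :=
  compIn G (localPurple G v k ∪ localRed G v k) v

open Classical in
/-- `φ_{G,k}(v)`. -/
noncomputable def localPhi {V : Type*} (G : SimpleGraph V) (k : ℕ) (v : V) : ℝ :=
  if v ∈ localSapphire G v k then 0
  else (ucOn G (localComp G v k) (localPurple G v k) : ℝ) / ((localComp G v k).ncard : ℝ)

/-- `L̃(G) = n - Φ(G)`. -/
noncomputable def Ltilde {V : Type*} [Fintype V] (G : SimpleGraph V) : ℝ :=
  (Fintype.card V : ℝ) - (Phi G : ℝ)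

/-- `L̃_k(G) = n - ∑_v φ_{G,k}(v)`. -/
noncomputable def LtildeLocal {V : Type*} [Fintype V] (k : ℕ) (G : SimpleGraph V) : ℝ :=
  (Fintype.card V : ℝ) - ∑ v : V, localPhi G k v

/-- `X̃(G) = (L̃(G) - 𝔼 L̃) / √n`, the expectation being over the random graph `G(n,p)` on `V`. -/
noncomputable def Xtilde {V : Type*} [Fintype V] (p : unitInterval) (G : SimpleGraph V) : ℝ :=
  (Ltilde G - ∫ H, Ltilde H ∂(SimpleGraph.binomialRandom V p)) / √(Fintype.card V : ℝ)

/-- `X̃_k(G) = (L̃_k(G) - 𝔼 L̃_k) / √n`, the expectation being over `G(n,p)` on `V`. -/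
noncomputable def XtildeLocal {V : Type*} [Fintype V] (k : ℕ) (p : unitInterval)
    (G : SimpleGraph V) : ℝ :=
  (LtildeLocal k G - ∫ H, LtildeLocal k H ∂(SimpleGraph.binomialRandom V p)) /
    √(Fintype.card V : ℝ)

theorem isGreatest_sapphire {V : Type*} (G : SimpleGraph V) :
    IsGreatest {A | HasStrongCoreProp G A} (sapphire G) := by
  refine ⟨?_, fun A hA => Set.subset_sUnion_of_mem hA⟩
  intro x hx
  obtain ⟨A, hA, hxA⟩ : ∃ A, HasStrongCoreProp G A ∧ x ∈ A ∪ extNbr G A := by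
    rcases hx with ⟨A, hA, hxA⟩ | ⟨hx, y, ⟨A, hA, hyA⟩, hxy⟩
    · exact ⟨A, hA, Or.inl hxA⟩
    · exact ⟨A, hA, Or.inr ⟨fun h => hx ⟨A, hA, h⟩, y, hyA, hxy⟩⟩
  exact (hA x hxA).trans (Set.encard_le_encard
    (Set.inter_subset_inter_right _ (Set.subset_sUnion_of_mem hA)))

theorem isGreatest_localCore {V : Type*} (G : SimpleGraph V) (v : V) (k : ℕ) :
    IsGreatest {A | HasLocalCoreProp G v k A} (localCore G v k) := by
  refine ⟨⟨Set.sUnion_subset fun A hA => hA.1, ?_⟩, fun A hA => Set.subset_sUnion_of_mem hA⟩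
  rintro x ⟨hx, hxs⟩
  obtain ⟨A, hA, hxA⟩ : ∃ A, HasLocalCoreProp G v k A ∧ x ∈ A ∪ extNbr G A := by
    rcases hx with ⟨A, hA, hxA⟩ | ⟨hx, y, ⟨A, hA, hyA⟩, hxy⟩
    · exact ⟨A, hA, Or.inl hxA⟩
    · exact ⟨A, hA, Or.inr ⟨fun h => hx ⟨A, hA, h⟩, y, hyA, hxy⟩⟩
  exact (hA.2 x ⟨hxA, hxs⟩).trans (Set.encard_le_encard
    (Set.inter_subset_inter_right _
      (Set.union_subset_union_left _ (Set.subset_sUnion_of_mem hA))))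

end StrongCore

/-! ### Bernoulli random subsets of a finite set -/

namespace BernoulliSubset

open Finset

variable {α : Type*} [DecidableEq α]

/-! Up to centring and the factor 1/√n, the random variable is f(G) = ∑_v φ_{G,k}(v) − Φ(G). Here
Φ(G) is itself a sum over vertices: uncovered counts add up over the components of G outside the
strong 4-core S, and each component spreads its count evenly over its vertices (`ucOn_eq_sum`,
`Phi_eq_sum`). So Var(f)/n must be bounded. The Efron–Stein inequality (`efron_stein`) reduces this
to the mean square of f(G+ab) − f(G−ab): with about n²/2 pairs, p = c/n and the division by n, a
bound B per pair gives cB/2.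

Effect of one pair. By maximality of S, a component that avoids a and b in both graphs is the same
in both, so only vertices v in the at most four components containing a or b can change their φ(v).
The same holds for φ_{G,k}(v) if a and b are at distance more than 2k in G−ab. Moreover φ_{G,k}(v) =
φ(v) as soon as the component of v has at most k−1 vertices (`localPhi_eq_phi`). Hence for distant
a, b the change vanishes unless one of the four components has at least k−1 vertices, and it is at
most 8 times the largest size (`sq_discrepancy_sub_le_of_far`). Close pairs are too few to matter
when all degrees are at most log n, and larger degrees are superpolynomially unlikely.

Component sizes. S is what survives when a vertex with at most three surviving neighbours is
repeatedly removed together with these neighbours. Thus at least a quarter of any component C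
outside S consists of triggers with no neighbour outside C (`exists_isPeeled_outerComp`). A union
bound over C, a set of parent edges and the set of triggers gives size m for the component of a with
probability at most (4/c) ρ^m, where ρ is roughly e·c·(4/3)·(3e^{−c})^{1/4}
(`bexp_ncard_outerComp_eq_le`). For c ≥ 20 this is at most 0.69 if m ≤ n/100 and at most 0.83 if m ≤
n/20. Larger components are excluded by stopping the peeling near n/20 deletions
(`exists_isPeeled_or`). Summing m²·0.69^m over m ≥ k−1 yields the main term. -/

/-- The expectation of `f` at a random subset of `E` which contains each element independently
with probability `p`. -/
noncomputable def bexp (p : ℝ) (E : Finset α) (f : Finset α → ℝ) : ℝ :=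
  ∑ s ∈ E.powerset, p ^ #s * (1 - p) ^ #(E \ s) * f s

theorem bexp_empty (p : ℝ) (f : Finset α → ℝ) : bexp p ∅ f = f ∅ := by
  simp [bexp]

theorem bexp_insert {p : ℝ} {E : Finset α} {e : α} (he : e ∉ E) (f : Finset α → ℝ) :
    bexp p (insert e E) f = p * bexp p E (fun s => f (insert e s)) + (1 - p) * bexp p E f := by
  unfold bexp
  rw [sum_powerset_insert he, add_comm, mul_sum, mul_sum]
  congr 1
  · refine sum_congr rfl fun s hs => ?_
    have hes : e ∉ s := fun h => he (mem_powerset.1 hs h)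
    have : insert e E \ insert e s = E \ s := by
      ext x
      grind
    rw [this, card_insert_of_notMem hes]; ring
  · refine sum_congr rfl fun s hs => ?_
    have hes : e ∉ s := fun h => he (mem_powerset.1 hs h)
    rw [insert_sdiff_of_notMem _ hes, card_insert_of_notMem (fun h => he (mem_sdiff.1 h).1)]
    ring

theorem bexp_congr {p : ℝ} {E : Finset α} {f g : Finset α → ℝ} (h : ∀ s ⊆ E, f s = g s) :
    bexp p E f = bexp p E g :=
  sum_congr rfl fun s hs => by rw [h s (mem_powerset.1 hs)]

theorem bexp_mono {p : ℝ} (hp0 : 0 ≤ p) (hp1 : p ≤ 1) {E : Finset α} {f g : Finset α → ℝ}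
    (h : ∀ s ⊆ E, f s ≤ g s) : bexp p E f ≤ bexp p E g := by
  have : 0 ≤ 1 - p := by linarith
  exact sum_le_sum fun s hs =>
    mul_le_mul_of_nonneg_left (h s (mem_powerset.1 hs)) (by positivity)

theorem bexp_add (p : ℝ) (E : Finset α) (f g : Finset α → ℝ) :
    bexp p E (fun s => f s + g s) = bexp p E f + bexp p E g := by
  simp [bexp, mul_add, sum_add_distrib]

theorem bexp_sub (p : ℝ) (E : Finset α) (f g : Finset α → ℝ) :
    bexp p E (fun s => f s - g s) = bexp p E f - bexp p E g := by
  simp [bexp, mul_sub, sum_sub_distrib]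

theorem bexp_const_mul (p : ℝ) (E : Finset α) (a : ℝ) (f : Finset α → ℝ) :
    bexp p E (fun s => a * f s) = a * bexp p E f := by
  simp only [bexp, mul_sum]
  exact sum_congr rfl fun s _ => by ring

theorem bexp_sum {ι : Type*} (p : ℝ) (E : Finset α) (I : Finset ι) (f : ι → Finset α → ℝ) :
    bexp p E (fun s => ∑ i ∈ I, f i s) = ∑ i ∈ I, bexp p E (f i) := by
  simp only [bexp, mul_sum]
  exact sum_comm

theorem bexp_one (p : ℝ) (E : Finset α) : bexp p E (fun _ => 1) = 1 := by
  have := Finset.prod_add (fun _ : α => p) (fun _ => 1 - p) E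
  simp only [add_sub_cancel, prod_const, one_pow] at this
  simp [bexp, ← this]

theorem bexp_const (p : ℝ) (E : Finset α) (a : ℝ) : bexp p E (fun _ => a) = a := by
  have := bexp_const_mul p E a (fun _ => 1)
  simpa [bexp_one] using this

theorem bexp_nonneg {p : ℝ} (hp0 : 0 ≤ p) (hp1 : p ≤ 1) {E : Finset α} {f : Finset α → ℝ}
    (h : ∀ s ⊆ E, 0 ≤ f s) : 0 ≤ bexp p E f := by
  rw [← bexp_const p E 0]
  exact bexp_mono hp0 hp1 h

theorem sq_bexp_le {p : ℝ} (hp0 : 0 ≤ p) (hp1 : p ≤ 1) (E : Finset α) (f : Finset α → ℝ) :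
    bexp p E f ^ 2 ≤ bexp p E (fun s => f s ^ 2) := by
  have h := bexp_nonneg hp0 hp1 (E := E) (f := fun s => (f s - bexp p E f) ^ 2)
    fun s _ => sq_nonneg _
  have h2 : bexp p E (fun s => (f s - bexp p E f) ^ 2)
      = bexp p E (fun s => f s ^ 2) - bexp p E f ^ 2 := by
    have : (fun s => (f s - bexp p E f) ^ 2)
        = fun s => (f s ^ 2 - (2 * bexp p E f) * f s) + bexp p E f ^ 2 := by
      ext s; ring
    rw [this, bexp_add, bexp_sub, bexp_const_mul, bexp_const]; ring
  linarith

/-- The Efron–Stein inequality for Bernoulli random subsets. -/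
theorem efron_stein {p : ℝ} (hp0 : 0 ≤ p) (hp1 : p ≤ 1) (E : Finset α) (f : Finset α → ℝ) :
    bexp p E (fun s => f s ^ 2) - bexp p E f ^ 2 ≤
      p * (1 - p) * ∑ e ∈ E, bexp p E (fun s => (f (insert e s) - f (s.erase e)) ^ 2) := by
  induction E using Finset.induction_on generalizing f with
  | empty => simp [bexp_empty]
  | insert e E he ih =>
    have hq : 0 ≤ 1 - p := by linarith
    have hpq : 0 ≤ p * (1 - p) := mul_nonneg hp0 hq
    rw [sum_insert he]
    set g : Finset α → ℝ := fun s => f (insert e s) with hg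
    have h1 := ih g
    have h0 := ih f
    have hsplit : ∀ e' ∈ E, bexp p (insert e E) (fun s => (f (insert e' s) - f (s.erase e')) ^ 2)
        = p * bexp p E (fun s => (g (insert e' s) - g (s.erase e')) ^ 2)
          + (1 - p) * bexp p E (fun s => (f (insert e' s) - f (s.erase e')) ^ 2) := by
      intro e' he'
      have hne : e ≠ e' := fun h => he (h ▸ he')
      rw [bexp_insert he]
      congr 2
      refine bexp_congr fun s _ => ?_
      rw [hg]
      simp only
      rw [insert_comm e' e s, erase_insert_of_ne hne]
    rw [sum_congr rfl hsplit, sum_add_distrib, ← mul_sum, ← mul_sum]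
    have hee : bexp p (insert e E) (fun s => (f (insert e s) - f (s.erase e)) ^ 2)
        = bexp p E (fun s => (g s - f s) ^ 2) := by
      rw [bexp_insert he]
      have a1 : bexp p E (fun s => (f (insert e (insert e s)) - f ((insert e s).erase e)) ^ 2)
          = bexp p E (fun s => (g s - f s) ^ 2) := by
        refine bexp_congr fun s hs => ?_
        rw [insert_idem, erase_insert (fun h => he (hs h))]
      have a2 : bexp p E (fun s => (f (insert e s) - f (s.erase e)) ^ 2)
          = bexp p E (fun s => (g s - f s) ^ 2) := by
        refine bexp_congr fun s hs => ?_
        rw [erase_eq_of_notMem (fun h => he (hs h))]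
      rw [a1, a2]; ring
    rw [hee, bexp_insert he, bexp_insert he]
    -- Conditioning on whether e is chosen, the variance is p Var(g) + (1−p) Var(f) + p(1−p)(E g − E
    -- f)². Jensen's inequality turns the last term into the summand of e; induction handles the
    -- others.
    have h2 := sq_bexp_le hp0 hp1 E (fun s => g s - f s)
    rw [bexp_sub] at h2
    change p * bexp p E (fun s => g s ^ 2) + _ - (p * bexp p E g + _) ^ 2 ≤ _
    nlinarith [mul_le_mul_of_nonneg_left h2 hpq, mul_le_mul_of_nonneg_left h1 hp0,
      mul_le_mul_of_nonneg_left h0 hq]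

/-- The probability that all of `A` is chosen and nothing of `B` is. -/
theorem bexp_subset_disjoint (p : ℝ) {E A B : Finset α} (hA : A ⊆ E) (hB : B ⊆ E)
    (hAB : Disjoint A B) :
    bexp p E (fun s => if A ⊆ s ∧ Disjoint B s then 1 else 0) = p ^ #A * (1 - p) ^ #B := by
  -- Each element contributes p if it may be chosen (not in B), plus 1−p if it may be left out (not
  -- in A). Expanding the product over E gives the expectation.
  have key := Finset.prod_add (fun e : α => if e ∈ B then 0 else p)
    (fun e => if e ∈ A then 0 else 1 - p) E
  have hl : ∏ e ∈ E, ((if e ∈ B then 0 else p) + (if e ∈ A then 0 else 1 - p))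
      = p ^ #A * (1 - p) ^ #B := by
    have : ∀ e ∈ E, ((if e ∈ B then 0 else p) + (if e ∈ A then 0 else 1 - p))
        = (if e ∈ A then p else 1) * (if e ∈ B then 1 - p else 1) := by
      intro e _
      by_cases h1 : e ∈ A
      · have h2 : e ∉ B := Finset.disjoint_left.1 hAB h1
        simp [h1, h2]
      · by_cases h2 : e ∈ B <;> simp [h1, h2]
    rw [prod_congr rfl this, prod_mul_distrib, prod_ite_mem, prod_ite_mem,
      inter_eq_right.2 hA, inter_eq_right.2 hB, prod_const, prod_const]
  rw [← hl, key, bexp]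
  refine sum_congr rfl fun s hs => ?_
  have hsE := mem_powerset.1 hs
  by_cases h : A ⊆ s ∧ Disjoint B s
  · rw [if_pos h, mul_one]
    congr 1
    · rw [prod_congr rfl fun e he => if_neg (Finset.disjoint_right.1 h.2 he), prod_const]
    · rw [prod_congr rfl fun e he => if_neg (fun h' => (mem_sdiff.1 he).2 (h.1 h')), prod_const]
  · rw [if_neg h, mul_zero]
    rw [not_and_or] at h
    symm
    rcases h with h | h
    · obtain ⟨e, he, hes⟩ := Finset.not_subset.1 h
      exact mul_eq_zero_of_right _
        (prod_eq_zero (mem_sdiff.2 ⟨hA he, hes⟩) (by simp [he]))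
    · obtain ⟨e, he, hes⟩ := Finset.not_disjoint_iff.1 h
      exact mul_eq_zero_of_left (prod_eq_zero hes (by simp [he])) _

end BernoulliSubset

/-! ### The random graph G(n,p) as a Bernoulli set of edges -/

namespace StrongCore

open Finset BernoulliSubset

instance measurableSingletonClass_simpleGraph {V : Type*} [Finite V] :
    MeasurableSingletonClass (SimpleGraph V) where
  measurableSet_singleton G := by
    have : ({G} : Set (SimpleGraph V)) = SimpleGraph.edgeSet ⁻¹' {G.edgeSet} := by
      ext H; simp
    rw [this]
    exact SimpleGraph.measurableEmbedding_edgeSet.measurable (measurableSet_singleton _)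

/-- The difference between the two estimates of the uncovered number. -/
noncomputable def discrepancy {V : Type*} [Fintype V] (k : ℕ) (G : SimpleGraph V) : ℝ :=
  ∑ v : V, localPhi G k v - Phi G

/-- The two terms n cancel and the expectations are constants, so only the discrepancy carries
variance; the two factors 1/√n give 1/n. -/
theorem variance_Xtilde_sub {V : Type*} [Fintype V] (k : ℕ) (p : unitInterval) :
    variance (fun G : SimpleGraph V => Xtilde p G - XtildeLocal k p G)
      (SimpleGraph.binomialRandom V p) =
    (Fintype.card V : ℝ)⁻¹ * variance (discrepancy (V := V) k)
      (SimpleGraph.binomialRandom V p) := by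
  set μ := SimpleGraph.binomialRandom V p
  have : (fun G : SimpleGraph V => Xtilde p G - XtildeLocal k p G) = fun G =>
      (√(Fintype.card V : ℝ))⁻¹ * (discrepancy k G -
        (∫ H, Ltilde H ∂μ - ∫ H, LtildeLocal k H ∂μ)) := by
    ext G
    simp only [Xtilde, XtildeLocal, discrepancy, Ltilde, LtildeLocal]
    ring
  rw [this, variance_const_mul, variance_sub_const (Integrable.of_finite).1, inv_pow,
    Real.sq_sqrt (Nat.cast_nonneg _)]

/-- The edges of the complete graph. -/
def allEdges (V : Type*) [Fintype V] [DecidableEq V] : Finset (Sym2 V) :=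
  univ.filter fun e => ¬ e.IsDiag

/-- The graph with edge set `s` (loops are discarded). -/
def ofEdges {V : Type*} (s : Finset (Sym2 V)) : SimpleGraph V :=
  SimpleGraph.fromEdgeSet (s : Set (Sym2 V))

theorem ofEdges_adj {V : Type*} {s : Finset (Sym2 V)} {x y : V} :
    (ofEdges s).Adj x y ↔ s(x, y) ∈ s ∧ x ≠ y := by
  simp [ofEdges]

variable {V : Type*} [Fintype V] [DecidableEq V]

theorem mem_allEdges {e : Sym2 V} : e ∈ allEdges V ↔ ¬ e.IsDiag := by
  simp [allEdges]

theorem card_allEdges : #(allEdges V) = (Fintype.card V).choose 2 := by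
  rw [← Sym2.card_diagSet_compl, ← Set.toFinset_card]
  congr 1
  ext e
  simp [mem_allEdges]

theorem edgeSet_ofEdges {s : Finset (Sym2 V)} (hs : s ⊆ allEdges V) :
    (ofEdges s).edgeSet = s := by
  rw [ofEdges, SimpleGraph.edgeSet_fromEdgeSet]
  ext e
  simp only [Set.mem_sdiff, mem_coe, and_iff_left_iff_imp]
  exact fun he => mem_allEdges.1 (hs he)

theorem binomialRandom_real_singleton (p : unitInterval) {s : Finset (Sym2 V)}
    (hs : s ⊆ allEdges V) :
    (SimpleGraph.binomialRandom V p).real {ofEdges s}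
      = (p : ℝ) ^ #s * (1 - p : ℝ) ^ #(allEdges V \ s) := by
  rw [measureReal_def, SimpleGraph.binomialRandom_singleton, edgeSet_ofEdges hs,
    Set.ncard_coe_finset, card_sdiff_of_subset hs, card_allEdges, Nat.card_eq_fintype_card]
  simp

theorem integral_binomialRandom (p : unitInterval) (f : SimpleGraph V → ℝ) :
    ∫ G, f G ∂(SimpleGraph.binomialRandom V p) =
      bexp (p : ℝ) (allEdges V) (fun s => f (ofEdges s)) := by
  classical
  rw [integral_fintype Integrable.of_finite, bexp]
  symm
  refine sum_bij' (fun s _ => ofEdges s) (fun G _ => univ.filter fun e => e ∈ G.edgeSet)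
    ?_ ?_ ?_ ?_ ?_
  · intro s _; exact mem_univ _
  · intro G _
    rw [mem_powerset]
    intro e he
    exact mem_allEdges.2 (G.not_isDiag_of_mem_edgeSet (by simpa using he))
  · intro s hs
    ext e
    simp [edgeSet_ofEdges (mem_powerset.1 hs)]
  · intro G _
    ext x y
    simp only [ofEdges_adj, mem_filter, mem_univ, true_and, SimpleGraph.mem_edgeSet]
    exact ⟨fun h => h.1, fun h => ⟨h, h.ne⟩⟩
  · intro s hs
    rw [binomialRandom_real_singleton p (mem_powerset.1 hs), smul_eq_mul]

theorem variance_binomialRandom_le (p : unitInterval) (f : SimpleGraph V → ℝ) :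
    variance f (SimpleGraph.binomialRandom V p) ≤
      p * (1 - p) * ∑ e ∈ allEdges V, bexp (p : ℝ) (allEdges V)
        (fun s => (f (ofEdges (insert e s)) - f (ofEdges (s.erase e))) ^ 2) := by
  rw [variance_eq_sub (MemLp.of_discrete), integral_binomialRandom, integral_binomialRandom]
  exact efron_stein p.2.1 p.2.2 _ _

end StrongCore

/-! ### Components and the peeling process -/

namespace StrongCore

section Components

variable {V : Type*} {G G' : SimpleGraph V} {U U' T : Set V} {v x y : V}

theorem compIn_subset : compIn G U v ⊆ U := fun _ h => h.2.1

theorem mem_compIn_self (hv : v ∈ U) : v ∈ compIn G U v := ⟨hv, hv, .refl _⟩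

theorem mem_of_mem_compIn (h : x ∈ compIn G U v) : v ∈ U := h.1

theorem compIn_step (hx : x ∈ compIn G U v) (hy : y ∈ U) (hxy : G.Adj x y) :
    y ∈ compIn G U v := by
  obtain ⟨hv, hx, h⟩ := hx
  exact ⟨hv, hy, h.trans (SimpleGraph.Adj.reachable (G := G.induce U) (u := ⟨x, hx⟩)
    (v := ⟨y, hy⟩) hxy)⟩

/-- Induction along walks of the induced graph; closure of T need only be checked inside the
component. -/
theorem compIn_subset_of_closed (hv : v ∈ U → v ∈ T)
    (h : ∀ x ∈ compIn G U v, x ∈ T → ∀ y ∈ U, G.Adj x y → y ∈ T) : compIn G U v ⊆ T := by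
  rintro x ⟨hv', hx, ⟨p⟩⟩
  have key : ∀ (x' y' : U) (_ : (G.induce U).Walk x' y'), x'.1 ∈ compIn G U v → x'.1 ∈ T →
      y'.1 ∈ T := by
    intro x' y' p
    induction p with
    | nil => exact fun _ h => h
    | @cons a b _ hab _ ih =>
      exact fun h1 h2 => ih (compIn_step h1 b.2 hab) (h _ h1 h2 _ b.2 hab)
  exact key _ _ p (mem_compIn_self hv') (hv hv')

theorem compIn_comm : x ∈ compIn G U v ↔ v ∈ compIn G U x :=
  ⟨fun ⟨a, b, h⟩ => ⟨b, a, h.symm⟩, fun ⟨a, b, h⟩ => ⟨b, a, h.symm⟩⟩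

theorem compIn_eq_of_mem (h : x ∈ compIn G U v) : compIn G U x = compIn G U v := by
  obtain ⟨hv, hx, h⟩ := h
  ext y
  exact ⟨fun ⟨_, b, h'⟩ => ⟨hv, b, h.trans h'⟩, fun ⟨_, b, h'⟩ => ⟨hx, b, h.symm.trans h'⟩⟩

theorem compIn_eq_empty (hv : v ∉ U) : compIn G U v = ∅ :=
  Set.eq_empty_of_forall_notMem fun _ h => hv h.1

/-- A distance function on a component, with respect to which every vertex other than the root
has a lower neighbour. -/
theorem exists_depth (G : SimpleGraph V) (U : Set V) (v : V) :
    ∃ d : V → ℕ, ∀ x ∈ compIn G U v, x ≠ v → ∃ y ∈ compIn G U v, G.Adj x y ∧ d y < d x := by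
  classical
  by_cases hv : v ∈ U
  · refine ⟨fun x => if hx : x ∈ U then (G.induce U).dist ⟨v, hv⟩ ⟨x, hx⟩ else 0, ?_⟩
    rintro x ⟨_, hx, h⟩ hne
    obtain ⟨p, hp⟩ := h.symm.exists_walk_length_eq_dist
    cases p with
    | nil => exact absurd rfl hne
    | @cons _ y _ hxy q =>
      refine ⟨y.1, ⟨hv, y.2, ⟨q.reverse⟩⟩, hxy, ?_⟩
      have h1 := SimpleGraph.dist_le q.reverse
      rw [SimpleGraph.Walk.length_reverse] at h1
      rw [SimpleGraph.Walk.length_cons, SimpleGraph.dist_comm] at hp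
      simp only [hx, y.2, dif_pos]
      change (G.induce U).dist ⟨v, hv⟩ y < _
      omega
  · exact ⟨fun _ => 0, fun x hx => absurd hx.1 hv⟩

/-- A path inside the component visits each of its vertices at most once, so it has length at most
j. -/
theorem compIn_subset_gball [Finite V] {j : ℕ} (h : (compIn G U v).ncard ≤ j + 1) :
    compIn G U v ⊆ gball G v j := by
  classical
  have := Fintype.ofFinite V
  rintro x ⟨hv, hx, hr⟩
  obtain ⟨p, hp⟩ := hr.exists_isPath
  have hsub : ((p.support.toFinset.image (Subtype.val : U → V) : Finset V) : Set V)
      ⊆ compIn G U v := by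
    intro y hy
    simp only [Finset.coe_image, List.coe_toFinset, Set.mem_image, Set.mem_ofPred_eq] at hy
    obtain ⟨z, hz, rfl⟩ := hy
    exact ⟨hv, z.2, ⟨p.takeUntil z hz⟩⟩
  have h1 := Set.ncard_le_ncard hsub (Set.toFinite _)
  rw [Set.ncard_coe_finset, Finset.card_image_of_injective _ Subtype.val_injective,
    List.toFinset_card_of_nodup hp.support_nodup, SimpleGraph.Walk.length_support] at h1
  have h2 := SimpleGraph.edist_le (p.map (SimpleGraph.Embedding.induce (G := G) U).toHom)
  rw [SimpleGraph.Walk.length_map] at h2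
  exact le_trans h2 (by exact_mod_cast (by omega : p.length ≤ j))

end Components

/-! ### Stability of components outside the core when edges at two vertices change -/

section Core

variable {V : Type*} {G G' : SimpleGraph V} {a b v x y : V}

theorem four_le_of_mem_sapphire (hx : x ∈ sapphire G ∪ purple G) :
    4 ≤ (G.neighborSet x ∩ sapphire G).encard :=
  (isGreatest_sapphire G).1 x hx

theorem subset_sapphire {A : Set V} (hA : HasStrongCoreProp G A) : A ⊆ sapphire G :=
  (isGreatest_sapphire G).2 hA

/-- The component of `v` outside the strong 4-core. -/
def outerComp (G : SimpleGraph V) (v : V) : Set V := compIn G (sapphire G)ᶜ v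

theorem mem_sapphire_of_adj (hx : x ∈ outerComp G v) (hxy : G.Adj x y)
    (hy : y ∉ outerComp G v) : y ∈ sapphire G := by
  by_contra h
  exact hy (compIn_step hx h hxy)

/-- A neighbour outside the component must lie in the core. So the purple vertices of a component
can be read off from the component and its incident edges, without knowing the core. -/
theorem mem_purple_iff (hx : x ∈ outerComp G v) :
    x ∈ purple G ↔ ∃ y, y ∉ outerComp G v ∧ G.Adj x y := by
  constructor
  · rintro ⟨_, y, hy, hxy⟩
    exact ⟨y, fun h => compIn_subset h hy, hxy⟩
  · rintro ⟨y, hy, hxy⟩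
    exact ⟨compIn_subset hx, y, mem_sapphire_of_adj hx hxy hy, hxy⟩

/-- Two graphs have the same edges, except possibly at `a` and `b`. -/
def AgreeOff (G G' : SimpleGraph V) (a b : V) : Prop :=
  ∀ x y, x ≠ a → x ≠ b → (G.Adj x y ↔ G'.Adj x y)

theorem AgreeOff.symm (h : AgreeOff G G' a b) : AgreeOff G' G a b :=
  fun x y ha hb => (h x y ha hb).symm

/-- The vertices of the component C have the same neighbours in both graphs, and all neighbours
outside C lie in S(G). Hence S(G) ∪ (S(G') ∩ C) has the core property in G, and maximality of S(G)
makes the second part empty. -/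
theorem disjoint_outerComp_sapphire (h : AgreeOff G G' a b) (ha : a ∉ outerComp G v)
    (hb : b ∉ outerComp G v) : Disjoint (outerComp G v) (sapphire G') := by
  have hA : HasStrongCoreProp G (sapphire G ∪ (sapphire G' ∩ outerComp G v)) := by
    intro x hx
    by_cases hxS : x ∈ sapphire G ∪ purple G
    · exact (four_le_of_mem_sapphire hxS).trans (Set.encard_le_encard
        (Set.inter_subset_inter_right _ Set.subset_union_left))
    have hnS : x ∉ sapphire G := fun h' => hxS (Or.inl h')
    have hnP : ∀ y, G.Adj x y → y ∉ sapphire G := fun y hxy hy => hxS (Or.inr ⟨hnS, y, hy, hxy⟩)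
    have hxC : x ∈ outerComp G v ∧ x ∈ sapphire G' ∪ extNbr G' (sapphire G') := by
      rcases hx with (hx | hx) | ⟨hx, y, hy | hy, hxy⟩
      · exact absurd hx hnS
      · exact ⟨hx.2, Or.inl hx.1⟩
      · exact absurd hy (hnP y hxy)
      · have hxC : x ∈ outerComp G v := compIn_step hy.2 hnS hxy.symm
        refine ⟨hxC, ?_⟩
        by_cases hx' : x ∈ sapphire G'
        · exact Or.inl hx'
        · exact Or.inr ⟨hx', y, hy.1,
            (h x y (fun e => ha (e ▸ hxC)) (fun e => hb (e ▸ hxC))).1 hxy⟩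
    have hxa : x ≠ a := fun e => ha (e ▸ hxC.1)
    have hxb : x ≠ b := fun e => hb (e ▸ hxC.1)
    refine (four_le_of_mem_sapphire (G := G') hxC.2).trans (Set.encard_le_encard ?_)
    rintro y ⟨hxy, hy⟩
    have hxy' : G.Adj x y := (h x y hxa hxb).2 hxy
    exact ⟨hxy', Or.inr ⟨hy, compIn_step hxC.1 (hnP y hxy') hxy'⟩⟩
  rw [Set.disjoint_left]
  intro x hx hx'
  exact compIn_subset hx (subset_sapphire hA (Or.inr ⟨hx', hx⟩))

theorem outerComp_subset (h : AgreeOff G G' a b) (ha : a ∉ outerComp G v)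
    (hb : b ∉ outerComp G v) : outerComp G v ⊆ outerComp G' v := by
  have hd := Set.disjoint_left.1 (disjoint_outerComp_sapphire h ha hb)
  refine compIn_subset_of_closed (fun hv => mem_compIn_self (hd (mem_compIn_self hv))) ?_
  intro x hx hx' y hy hxy
  exact compIn_step hx' (hd (compIn_step hx hy hxy))
    ((h x y (fun e => ha (e ▸ hx)) (fun e => hb (e ▸ hx))).1 hxy)

theorem outerComp_eq (h : AgreeOff G G' a b) (ha : a ∉ outerComp G v)
    (hb : b ∉ outerComp G v) (ha' : a ∉ outerComp G' v) (hb' : b ∉ outerComp G' v) :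
    outerComp G v = outerComp G' v :=
  (outerComp_subset h ha hb).antisymm (outerComp_subset h.symm ha' hb')

theorem mem_sapphire_iff_outerComp : v ∈ sapphire G ↔ outerComp G v = ∅ := by
  constructor
  · exact fun h => compIn_eq_empty (not_not.2 h)
  · intro h
    by_contra hv
    exact (h ▸ mem_compIn_self hv : v ∈ (∅ : Set V))

theorem purple_inter_outerComp_eq (h : AgreeOff G G' a b) (ha : a ∉ outerComp G v)
    (hb : b ∉ outerComp G v) (heq : outerComp G v = outerComp G' v) :
    outerComp G v ∩ purple G = outerComp G v ∩ purple G' := by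
  ext x
  simp only [Set.mem_inter_iff, and_congr_right_iff]
  intro hx
  rw [mem_purple_iff hx, mem_purple_iff (heq ▸ hx), ← heq]
  have := fun y => h x y (fun e => ha (e ▸ hx)) (fun e => hb (e ▸ hx))
  simp only [this]

end Core

/-! ### The peeling process and its triggers -/

section Peeling

open Finset

variable {V : Type*} [Fintype V] [DecidableEq V] {G : SimpleGraph V} {T Q : Finset V} {v : V}

/-- `T` is obtained by a sequence of deletions of the peeling process which are triggered by the
vertices in `Q`. -/
structure IsPeeled (G : SimpleGraph V) (T Q : Finset V) : Prop where
  subset : Q ⊆ T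
  card_le : #T ≤ 4 * #Q
  closed : ∀ x ∈ Q, ∀ y, G.Adj x y → y ∈ T

theorem IsPeeled.empty {V : Type*} {G : SimpleGraph V} : IsPeeled G ∅ ∅ :=
  ⟨by simp, by simp, by simp⟩

/-- The trigger goes together with its at most three surviving neighbours, so each new element of Q
pays for at most four of T. It is new to Q because earlier triggers were deleted along with all
their neighbours. -/
theorem IsPeeled.step [DecidableRel G.Adj] (h : IsPeeled G T Q) {x : V}
    (hx : x ∉ T ∨ ∃ y ∉ T, G.Adj x y) (hN : #(univ.filter fun y => G.Adj x y ∧ y ∉ T) ≤ 3) :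
    IsPeeled G (insert x (T ∪ univ.filter fun y => G.Adj x y ∧ y ∉ T)) (insert x Q) ∧
      T ⊂ insert x (T ∪ univ.filter fun y => G.Adj x y ∧ y ∉ T) ∧
      #(insert x (T ∪ univ.filter fun y => G.Adj x y ∧ y ∉ T)) ≤ #T + 4 := by
  set N := univ.filter fun y => G.Adj x y ∧ y ∉ T
  have hxQ : x ∉ Q := by
    intro hxQ
    rcases hx with hx | ⟨y, hy, hxy⟩
    · exact hx (h.subset hxQ)
    · exact hy (h.closed x hxQ y hxy)
  have hc : #(insert x (T ∪ N)) ≤ #T + 4 :=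
    (card_insert_le _ _).trans (by have := card_union_le T N; omega)
  refine ⟨⟨?_, ?_, ?_⟩, ?_, hc⟩
  · exact insert_subset_insert _ (h.subset.trans subset_union_left)
  · rw [card_insert_of_notMem hxQ]
    have := h.card_le
    omega
  · intro z hz y hzy
    rcases mem_insert.1 hz with rfl | hz
    · by_cases hy : y ∈ T
      · exact mem_insert_of_mem (mem_union_left _ hy)
      · exact mem_insert_of_mem (mem_union_right _ (by simp [N, hzy, hy]))
    · exact mem_insert_of_mem (mem_union_left _ (h.closed z hz y hzy))
  · refine ⟨subset_union_left.trans (subset_insert _ _), fun hsub => ?_⟩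
    rcases hx with hx | ⟨y, hy, hxy⟩
    · exact hx (hsub (mem_insert_self _ _))
    · exact hy (hsub (mem_insert_of_mem (mem_union_right _ (by simp [N, hxy, hy]))))

theorem exists_violation {V : Type*} [Fintype V] {G : SimpleGraph V} {A : Set V}
    (h : ¬ HasStrongCoreProp G A) [DecidableRel G.Adj]
    [DecidablePred (· ∈ A)] :
    ∃ x, (x ∈ A ∨ ∃ y ∈ A, G.Adj x y) ∧ #(univ.filter fun y => G.Adj x y ∧ y ∈ A) ≤ 3 := by
  simp only [HasStrongCoreProp, not_forall, not_le] at h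
  obtain ⟨x, hx, hlt⟩ := h
  refine ⟨x, ?_, ?_⟩
  · rcases hx with hx | hx
    · exact Or.inl hx
    · exact Or.inr hx.2
  · have : G.neighborSet x ∩ A = ((univ.filter fun y => G.Adj x y ∧ y ∈ A : Finset V) : Set V) := by
      ext y; simp
    rw [this, Set.encard_coe_eq_coe_finsetCard] at hlt
    have : #(univ.filter fun y => G.Adj x y ∧ y ∈ A) < 4 := by exact_mod_cast hlt
    omega

/-- Either the complement of the strong 4-core has size less than `M - 3`, or the peeling
process produces a set of size between `M - 3` and `M`. -/
theorem exists_isPeeled_or (G : SimpleGraph V) (M : ℕ) :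
    (∃ T Q, IsPeeled G T Q ∧ M ≤ #T + 3 ∧ #T ≤ M) ∨ (sapphire G)ᶜ.ncard + 3 < M := by
  classical
  -- A step deletes at most four vertices. Hence a largest peeled set of size at most M either has
  -- size at least M − 3 or admits no further step, and then its complement has the core property.
  obtain ⟨T, hT, hmax⟩ :=
    (univ.filter fun T : Finset V => (∃ Q, IsPeeled G T Q) ∧ #T ≤ M).exists_max_image
    (fun T => #T) ⟨∅, by simpa using ⟨∅, IsPeeled.empty⟩⟩
  simp only [mem_filter, mem_univ, true_and] at hT hmax
  obtain ⟨⟨Q, hQ⟩, hTM⟩ := hT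
  by_cases hM : M ≤ #T + 3
  · exact Or.inl ⟨T, Q, hQ, hM, hTM⟩
  right
  have hcore : HasStrongCoreProp G ((T : Set V)ᶜ) := by
    by_contra hcon
    obtain ⟨x, hx, hN⟩ := exists_violation hcon
    simp only [Set.mem_compl_iff, mem_coe] at hx hN
    obtain ⟨h1, h2, h3⟩ := hQ.step hx hN
    exact absurd (hmax _ ⟨⟨_, h1⟩, by omega⟩) (not_le.2 (card_lt_card h2))
  have : (sapphire G)ᶜ ⊆ (T : Set V) := Set.compl_subset_comm.1 (subset_sapphire hcore)
  have := Set.ncard_le_ncard this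
  rw [Set.ncard_coe_finset] at this
  omega

/-- At least a quarter of the vertices of a component outside the strong 4-core have no
neighbours outside the component. -/
theorem exists_isPeeled_outerComp {C : Finset V} (hC : (C : Set V) = outerComp G v) :
    ∃ Q, IsPeeled G C Q := by
  classical
  obtain ⟨T, hT, hmax⟩ :=
    (univ.filter fun T : Finset V => (∃ Q, IsPeeled G T Q) ∧ T ⊆ C).exists_max_image
    (fun T => #T) ⟨∅, by simpa using ⟨∅, IsPeeled.empty⟩⟩
  simp only [mem_filter, mem_univ, true_and] at hT hmax
  obtain ⟨⟨Q, hQ⟩, hTC⟩ := hT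
  by_cases hTe : T = C
  · exact ⟨Q, hTe ▸ hQ⟩
  exfalso
  have hmem : ∀ x, x ∈ C ↔ x ∈ outerComp G v := fun x => by rw [← hC, mem_coe]
  obtain ⟨z, hzC, hzT⟩ := Finset.exists_of_ssubset (hTC.ssubset_of_ne hTe)
  -- If T ≠ C, then A is strictly larger than the core, so some x violates the condition for A.
  -- Having at most three neighbours in A, it is neither in the core nor next to it; so x and all
  -- its neighbours lie in C and the peeling of C can continue.
  set A : Set V := {x | x ∈ sapphire G ∨ (x ∈ C ∧ x ∉ T)} with hA
  have hcore : ¬ HasStrongCoreProp G A := fun hcon =>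
    compIn_subset ((hmem z).1 hzC) (subset_sapphire hcon (Or.inr ⟨hzC, hzT⟩))
  obtain ⟨x, hx, hN⟩ := exists_violation hcore
  have hxSP : x ∉ sapphire G ∪ purple G := by
    intro hxS
    have h4 := four_le_of_mem_sapphire hxS
    have hsub : G.neighborSet x ∩ sapphire G ⊆
        ((univ.filter fun y => G.Adj x y ∧ y ∈ A : Finset V) : Set V) := by
      rintro y ⟨hy1, hy2⟩
      simpa using ⟨hy1, Or.inl hy2⟩
    have h5 := h4.trans (Set.encard_le_encard hsub)
    rw [Set.encard_coe_eq_coe_finsetCard] at h5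
    have : 4 ≤ #(univ.filter fun y => G.Adj x y ∧ y ∈ A) := by exact_mod_cast h5
    omega
  have hxS : x ∉ sapphire G := fun h => hxSP (Or.inl h)
  have hxP : ∀ y, G.Adj x y → y ∉ sapphire G := fun y hxy hy => hxSP (Or.inr ⟨hxS, y, hy, hxy⟩)
  have hx' : x ∈ C ∧ (x ∉ T ∨ ∃ y ∉ T, G.Adj x y) := by
    rcases hx with (hx | hx) | ⟨y, hy | hy, hxy⟩
    · exact absurd hx hxS
    · exact ⟨hx.1, Or.inl hx.2⟩
    · exact absurd hy (hxP y hxy)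
    · exact ⟨(hmem x).2 (compIn_step ((hmem y).1 hy.1) hxS hxy.symm), Or.inr ⟨y, hy.2, hxy⟩⟩
  have hNC : ∀ y, G.Adj x y → y ∈ C := fun y hxy =>
    (hmem y).2 (compIn_step ((hmem x).1 hx'.1) (hxP y hxy) hxy)
  have hNeq : (univ.filter fun y => G.Adj x y ∧ y ∈ A) =
      univ.filter fun y => G.Adj x y ∧ y ∉ T := by
    ext y
    simp only [mem_filter, mem_univ, true_and, and_congr_right_iff]
    intro hxy
    constructor
    · rintro (h | h)
      · exact absurd h (hxP y hxy)
      · exact h.2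
    · exact fun h => Or.inr ⟨hNC y hxy, h⟩
  rw [hNeq] at hN
  obtain ⟨h1, h2, -⟩ := hQ.step hx'.2 hN
  refine absurd (hmax _ ⟨⟨_, h1⟩, ?_⟩) (not_le.2 (card_lt_card h2))
  refine insert_subset hx'.1 (union_subset hTC fun y hy => ?_)
  exact hNC y (mem_filter.1 hy).2.1

end Peeling

end StrongCore

/-! ### Uncovered vertices -/

namespace StrongCore

section PathSupport

variable {V : Type*} {G G' : SimpleGraph V} {U U' W W' s : Set V}

/-- `s` is the vertex set of a path of `G` with endpoints in `W`. -/
def IsPathSupport (G : SimpleGraph V) (W s : Set V) : Prop :=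
  ∃ a b, a ∈ W ∧ b ∈ W ∧ ∃ p : G.Walk a b, p.IsPath ∧ s = {x | x ∈ p.support}

theorem IsPathSupport.congr (hadj : ∀ x ∈ U, ∀ y ∈ U, G.Adj x y → G'.Adj x y)
    (hW : U ∩ W ⊆ W') (hs : s ⊆ U) (h : IsPathSupport G W s) : IsPathSupport G' W' s := by
  obtain ⟨a, b, ha, hb, p, hp, rfl⟩ := h
  have he : ∀ e ∈ p.edges, e ∈ G'.edgeSet := by
    intro e he
    induction e with
    | _ x y =>
      exact hadj x (hs (p.fst_mem_support_of_mem_edges he)) y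
        (hs (p.snd_mem_support_of_mem_edges he)) (p.adj_of_mem_edges he)
  refine ⟨a, b, hW ⟨hs p.start_mem_support, ha⟩, hW ⟨hs p.end_mem_support, hb⟩,
    p.transfer G' he, hp.transfer he, ?_⟩
  rw [SimpleGraph.Walk.support_transfer]

theorem IsPathSupport.subset_compIn {x : V} (h : IsPathSupport G W s) (hs : s ⊆ U) (hx : x ∈ s) :
    s ⊆ compIn G U x := by
  classical
  obtain ⟨a, b, ha, hb, p, hp, rfl⟩ := h
  intro y hy
  have hax : x ∈ compIn G U a :=
    ⟨hs p.start_mem_support, hs hx, ⟨((p.takeUntil x hx).induce U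
      fun z hz => hs (p.support_takeUntil_subset_support hx hz))⟩⟩
  rw [compIn_eq_of_mem hax]
  exact ⟨hs p.start_mem_support, hs hy, ⟨((p.takeUntil y hy).induce U
      fun z hz => hs (p.support_takeUntil_subset_support hy hz))⟩⟩

/-- `𝒮` is the collection of vertex sets of a family of `W`-paths in `G[U]`. -/
structure IsPathPacking (G : SimpleGraph V) (U W : Set V) (𝒮 : Set (Set V)) : Prop where
  subset : ∀ s ∈ 𝒮, s ⊆ U
  isPathSupport : ∀ s ∈ 𝒮, IsPathSupport G W s
  disjoint : ∀ s ∈ 𝒮, ∀ t ∈ 𝒮, ∀ x ∈ s, x ∈ t → s = t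

theorem IsPathPacking.congr (hadj : ∀ x ∈ U, ∀ y ∈ U, G.Adj x y → G'.Adj x y)
    (hW : U ∩ W ⊆ W') {𝒮 : Set (Set V)} (h : IsPathPacking G U W 𝒮) : IsPathPacking G' U W' 𝒮 :=
  ⟨h.subset, fun s hs => (h.isPathSupport s hs).congr hadj hW (h.subset s hs), h.disjoint⟩

/-- Coverage and disjointness depend only on the vertex sets of the paths. Passing to these sets in
V avoids paths in the varying types attached to induced subgraphs. -/
theorem ucOn_eq (G : SimpleGraph V) (U W : Set V) :
    ucOn G U W = sInf {m | ∃ 𝒮, IsPathPacking G U W 𝒮 ∧ m = ((U \ W) \ ⋃₀ 𝒮).ncard} := by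
  unfold ucOn uc
  congr 1
  ext m
  have hcard : ∀ (F : Set (Σ a b : U, (G.induce U).Path a b)) (𝒮 : Set (Set V)),
      (∀ x : U, x ∈ covered F ↔ x.1 ∈ ⋃₀ 𝒮) →
      (((Subtype.val ⁻¹' W : Set U)ᶜ \ covered F).ncard = ((U \ W) \ ⋃₀ 𝒮).ncard) := by
    intro F 𝒮 h
    rw [← Set.ncard_image_of_injective _ (Subtype.val_injective (p := (· ∈ U)))]
    congr 1
    ext x
    constructor
    · rintro ⟨y, ⟨h1, h2⟩, rfl⟩
      exact ⟨⟨y.2, h1⟩, fun h' => h2 ((h y).2 h')⟩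
    · rintro ⟨⟨h1, h2⟩, h3⟩
      exact ⟨⟨x, h1⟩, ⟨h2, fun h' => h3 ((h _).1 h')⟩, rfl⟩
  constructor
  · rintro ⟨F, hF, rfl⟩
    refine ⟨(fun q => Subtype.val '' {x | x ∈ q.2.2.1.support}) '' F, ⟨?_, ?_, ?_⟩, hcard _ _ ?_⟩
    · rintro _ ⟨q, hq, rfl⟩ _ ⟨x, _, rfl⟩
      exact x.2
    · rintro _ ⟨q, hq, rfl⟩
      refine ⟨_, _, (hF.endpoints q hq).1, (hF.endpoints q hq).2,
        q.2.2.1.map (SimpleGraph.Embedding.induce (G := G) U).toHom,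
        SimpleGraph.Walk.IsPath.map Subtype.val_injective q.2.2.2, ?_⟩
      refine Set.ext fun x => Iff.trans (b := x ∈ List.map Subtype.val q.2.2.1.support)
        List.mem_map.symm (iff_of_eq (congrArg (x ∈ ·) ?_))
      exact (SimpleGraph.Walk.support_map (SimpleGraph.Embedding.induce (G := G) U).toHom
        q.2.2.1).symm
    · rintro _ ⟨q, hq, rfl⟩ _ ⟨q', hq', rfl⟩ _ ⟨x, hx, rfl⟩ ⟨x', hx', hxx⟩
      obtain rfl : x' = x := Subtype.val_injective hxx
      by_cases hqq : q = q'
      · rw [hqq]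
      · exact absurd hx' (Set.disjoint_left.1 (hF.disjoint hq hq' hqq) hx)
    · intro x
      constructor
      · rintro ⟨q, hq, hx⟩
        exact ⟨_, ⟨q, hq, rfl⟩, x, hx, rfl⟩
      · rintro ⟨_, ⟨q, hq, rfl⟩, y, hy, hxy⟩
        obtain rfl : y = x := Subtype.val_injective hxy
        exact ⟨q, hq, hy⟩
  · rintro ⟨𝒮, h𝒮, rfl⟩
    have hex : ∀ s ∈ 𝒮, ∃ q : (Σ a b : U, (G.induce U).Path a b), q.1.1 ∈ W ∧ q.2.1.1 ∈ W ∧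
        ∀ x : U, x ∈ q.2.2.1.support ↔ x.1 ∈ s := by
      intro s hs
      have hsU := h𝒮.subset s hs
      obtain ⟨a, b, ha, hb, p, hp, rfl⟩ := h𝒮.isPathSupport s hs
      have hmap := SimpleGraph.Walk.map_induce p (s := U) fun z hz => hsU hz
      refine ⟨⟨⟨a, hsU p.start_mem_support⟩, ⟨b, hsU p.end_mem_support⟩,
        p.induce U fun z hz => hsU hz, ?_⟩, ha, hb, ?_⟩
      · apply SimpleGraph.Walk.IsPath.of_map (f := (SimpleGraph.Embedding.induce (G := G) U).toHom)
        rw [hmap]; exact hp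
      · intro x
        have h1 := congrArg SimpleGraph.Walk.support hmap
        rw [SimpleGraph.Walk.support_map] at h1
        simp only [Set.mem_ofPred_eq]
        have h2 : x.1 ∈ p.support ↔ _ := (congrArg (x.1 ∈ ·) h1).symm ▸ List.mem_map
        constructor
        · exact fun h => h2.2 ⟨x, h, rfl⟩
        · intro h
          obtain ⟨y, hy, hxy⟩ := h2.1 h
          obtain rfl : y = x := Subtype.val_injective hxy
          exact hy
    choose g hg1 hg2 hg3 using hex
    refine ⟨{q | ∃ s hs, q = g s hs}, ⟨?_, ?_⟩, (hcard _ _ ?_).symm⟩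
    · rintro _ ⟨s, hs, rfl⟩
      exact ⟨hg1 s hs, hg2 s hs⟩
    · rintro _ ⟨s, hs, rfl⟩ _ ⟨t, ht, rfl⟩ hne
      refine Set.disjoint_left.2 fun x hx hx' => hne ?_
      obtain rfl := h𝒮.disjoint s hs t ht x ((hg3 s hs x).1 hx) ((hg3 t ht x).1 hx')
      rfl
    · intro x
      constructor
      · rintro ⟨_, ⟨s, hs, rfl⟩, hx⟩
        exact ⟨s, hs, (hg3 s hs x).1 hx⟩
      · rintro ⟨s, hs, hx⟩
        exact ⟨g s hs, ⟨s, hs, rfl⟩, (hg3 s hs x).2 hx⟩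

theorem ucOn_le_of_packing {𝒮 : Set (Set V)} (h : IsPathPacking G U W 𝒮) :
    ucOn G U W ≤ ((U \ W) \ ⋃₀ 𝒮).ncard := by
  rw [ucOn_eq]
  exact Nat.sInf_le ⟨𝒮, h, rfl⟩

theorem exists_packing (G : SimpleGraph V) (U W : Set V) :
    ∃ 𝒮, IsPathPacking G U W 𝒮 ∧ ucOn G U W = ((U \ W) \ ⋃₀ 𝒮).ncard := by
  rw [ucOn_eq]
  exact Nat.sInf_mem (s := {m | ∃ 𝒮, IsPathPacking G U W 𝒮 ∧ m = ((U \ W) \ ⋃₀ 𝒮).ncard})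
    ⟨_, ∅, ⟨by simp, by simp, by simp⟩, rfl⟩

theorem ucOn_le_ncard [Finite V] : ucOn G U W ≤ U.ncard :=
  (ucOn_le_of_packing (𝒮 := ∅) ⟨by simp, by simp, by simp⟩).trans
    (Set.ncard_le_ncard (Set.sdiff_subset.trans Set.sdiff_subset))

theorem ucOn_congr (hadj : ∀ x ∈ U, ∀ y ∈ U, (G.Adj x y ↔ G'.Adj x y))
    (hW : U ∩ W = U ∩ W') : ucOn G U W = ucOn G' U W' := by
  have hd : U \ W = U \ W' := by
    rw [← Set.sdiff_self_inter, hW, Set.sdiff_self_inter]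
  have hiff : ∀ 𝒮, IsPathPacking G U W 𝒮 ↔ IsPathPacking G' U W' 𝒮 := fun 𝒮 =>
    ⟨fun h => h.congr (fun x hx y hy => (hadj x hx y hy).1) (hW ▸ Set.inter_subset_right),
      fun h => h.congr (fun x hx y hy => (hadj x hx y hy).2) (hW ▸ Set.inter_subset_right)⟩
  rw [ucOn_eq, ucOn_eq, hd]
  simp only [hiff]

end PathSupport

/-! ### Additivity over components and the contribution of a vertex -/

section Additivity

open Finset

-- Every path of a family stays in one component, so families restrict to components, and optimal
-- families of the components combine to a global one.
open Classical in
theorem ucOn_eq_sum {V : Type*} [Fintype V] (G : SimpleGraph V) (U W : Set V) :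
    ucOn G U W = ∑ C ∈ (univ.filter (· ∈ U)).image (compIn G U), ucOn G C W := by
  have hcard : ∀ 𝒮, IsPathPacking G U W 𝒮 → ((U \ W) \ ⋃₀ 𝒮).ncard =
      ∑ C ∈ (univ.filter (· ∈ U)).image (compIn G U),
        ((C \ W) \ ⋃₀ {s ∈ 𝒮 | s ⊆ C}).ncard := by
    intro 𝒮 h𝒮
    set X : Finset V := univ.filter (· ∈ (U \ W) \ ⋃₀ 𝒮) with hX
    have h1 : (U \ W) \ ⋃₀ 𝒮 = (X : Set V) := by
      ext x
      simp [hX]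
    rw [h1, Set.ncard_coe_finset, card_eq_sum_card_fiberwise (f := compIn G U)
      (t := (univ.filter (· ∈ U)).image (compIn G U))]
    · refine sum_congr rfl fun C hC => ?_
      obtain ⟨v, hv, rfl⟩ := mem_image.1 hC
      rw [← Set.ncard_coe_finset]
      congr 1
      ext x
      simp only [hX, coe_filter, mem_filter, mem_univ, true_and, Set.mem_sdiff, Set.mem_ofPred_eq,
        Set.mem_sUnion, not_exists, not_and]
      constructor
      · rintro ⟨⟨⟨hxU, hxW⟩, hx⟩, hxv⟩
        exact ⟨⟨hxv ▸ mem_compIn_self hxU, hxW⟩, fun s hs => hx s hs.1⟩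
      · rintro ⟨⟨hxv, hxW⟩, hx⟩
        refine ⟨⟨⟨compIn_subset hxv, hxW⟩, fun s hs hxs => hx s ⟨hs, ?_⟩ hxs⟩,
          compIn_eq_of_mem hxv⟩
        rw [← compIn_eq_of_mem hxv]
        exact (h𝒮.isPathSupport s hs).subset_compIn (h𝒮.subset s hs) hxs
    · intro x hx
      rw [mem_coe, hX, mem_filter] at hx
      exact mem_image_of_mem _ (by simpa using hx.2.1.1)
  apply le_antisymm
  · choose 𝒮 h𝒮 hcov using fun C => exists_packing G C W
    have hdisj : ∀ v w x, x ∈ compIn G U v → x ∈ compIn G U w → compIn G U v = compIn G U w :=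
      fun v w x h1 h2 => (compIn_eq_of_mem h1).symm.trans (compIn_eq_of_mem h2)
    have hP : IsPathPacking G U W {s | ∃ v ∈ U, s ∈ 𝒮 (compIn G U v)} := by
      refine ⟨?_, ?_, ?_⟩
      · rintro s ⟨v, _, hs⟩
        exact ((h𝒮 _).subset s hs).trans compIn_subset
      · rintro s ⟨v, _, hs⟩
        exact (h𝒮 _).isPathSupport s hs
      · rintro s ⟨v, _, hs⟩ t ⟨w, _, ht⟩ x hxs hxt
        have := hdisj v w x ((h𝒮 _).subset s hs hxs) ((h𝒮 _).subset t ht hxt)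
        rw [← this] at ht
        exact (h𝒮 _).disjoint s hs t ht x hxs hxt
    refine (ucOn_le_of_packing hP).trans ?_
    rw [hcard _ hP]
    refine sum_le_sum fun C hC => ?_
    obtain ⟨v, hv, rfl⟩ := mem_image.1 hC
    rw [hcov]
    refine Set.ncard_le_ncard (Set.sdiff_subset_sdiff_right (Set.sUnion_subset_sUnion ?_))
    exact fun s hs => ⟨⟨v, by simpa using hv, hs⟩, (h𝒮 _).subset s hs⟩
  · obtain ⟨𝒮, h𝒮, hcov⟩ := exists_packing G U W
    rw [hcov, hcard _ h𝒮]
    refine sum_le_sum fun C _ => ucOn_le_of_packing ⟨?_, ?_, ?_⟩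
    · exact fun s hs => hs.2
    · exact fun s hs => h𝒮.isPathSupport s hs.1
    · exact fun s hs t ht => h𝒮.disjoint s hs.1 t ht.1

open Classical in
/-- The contribution of `v` to `Φ(G)`. -/
noncomputable def phi {V : Type*} (G : SimpleGraph V) (v : V) : ℝ :=
  if v ∈ sapphire G then 0
  else (ucOn G (outerComp G v) (purple G) : ℝ) / ((outerComp G v).ncard : ℝ)

theorem purple_union_red {V : Type*} (G : SimpleGraph V) :
    purple G ∪ red G = (sapphire G)ᶜ := by
  ext x
  constructor
  · rintro (hx | hx)
    · exact hx.1
    · exact fun h => hx (Or.inl h)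
  · intro hx
    by_cases hp : x ∈ purple G
    · exact Or.inl hp
    · exact Or.inr fun h => h.elim hx hp

/-- Each component outside the core is counted once for each of its vertices, with weight one over
its size. -/
theorem Phi_eq_sum {V : Type*} [Fintype V] (G : SimpleGraph V) :
    (Phi G : ℝ) = ∑ v : V, phi G v := by
  classical
  rw [Phi, purple_union_red, ucOn_eq_sum, Nat.cast_sum]
  set U := (sapphire G)ᶜ with hU
  have h1 : ∑ v : V, phi G v = ∑ v ∈ univ.filter (· ∈ U), phi G v := by
    rw [sum_filter]
    refine sum_congr rfl fun v _ => ?_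
    by_cases hv : v ∈ sapphire G <;> simp [hU, hv, phi]
  rw [h1, ← sum_fiberwise_of_maps_to (t := (univ.filter (· ∈ U)).image (compIn G U))
    (g := compIn G U) (fun x hx => mem_image_of_mem _ hx)]
  refine sum_congr (by congr!) fun C hC => ?_
  obtain ⟨w, hw, rfl⟩ := mem_image.1 hC
  have hwU : w ∈ U := by simpa using hw
  have hval : ∀ v ∈ (univ.filter (· ∈ U)).filter (fun v => compIn G U v = compIn G U w),
      phi G v = (ucOn G (compIn G U w) (purple G) : ℝ) / ((compIn G U w).ncard : ℝ) := by
    intro v hv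
    simp only [mem_filter, mem_univ, true_and] at hv
    rw [phi, if_neg hv.1, outerComp, ← hU, hv.2]
  rw [sum_congr rfl hval, sum_const, nsmul_eq_mul]
  have hc : #((univ.filter (· ∈ U)).filter (fun v => compIn G U v = compIn G U w))
      = (compIn G U w).ncard := by
    rw [← Set.ncard_coe_finset]
    congr 1
    ext x
    simp only [coe_filter, mem_filter, mem_univ, true_and, Set.mem_ofPred_eq]
    constructor
    · rintro ⟨h, h'⟩
      exact h' ▸ mem_compIn_self h
    · exact fun h => ⟨compIn_subset h, compIn_eq_of_mem h⟩
  have hpos : 0 < (compIn G U w).ncard := (Set.ncard_pos).2 ⟨w, mem_compIn_self hwU⟩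
  rw [hc, mul_div_cancel₀ _ (by exact_mod_cast hpos.ne')]

theorem phi_nonneg {V : Type*} (G : SimpleGraph V) (v : V) : 0 ≤ phi G v := by
  unfold phi
  split_ifs <;> positivity

theorem phi_le_one {V : Type*} [Finite V] (G : SimpleGraph V) (v : V) : phi G v ≤ 1 := by
  unfold phi
  split_ifs
  · exact zero_le_one
  · exact div_le_one_of_le₀ (by exact_mod_cast ucOn_le_ncard) (by positivity)

theorem phi_congr {V : Type*} {G G' : SimpleGraph V} {a b v : V} (h : AgreeOff G G' a b)
    (ha : a ∉ outerComp G v) (hb : b ∉ outerComp G v) (ha' : a ∉ outerComp G' v)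
    (hb' : b ∉ outerComp G' v) : phi G v = phi G' v := by
  have heq := outerComp_eq h ha hb ha' hb'
  have hS : v ∈ sapphire G ↔ v ∈ sapphire G' := by
    rw [mem_sapphire_iff_outerComp, mem_sapphire_iff_outerComp, heq]
  unfold phi
  rw [← heq, ucOn_congr (G' := G') (W' := purple G')
    (fun x hx y _ => h x y (fun e => ha (e ▸ hx)) (fun e => hb (e ▸ hx)))
    (purple_inter_outerComp_eq h ha hb heq)]
  by_cases hv : v ∈ sapphire G
  · rw [if_pos hv, if_pos (hS.1 hv)]
  · rw [if_neg hv, if_neg fun h' => hv (hS.2 h')]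

end Additivity

end StrongCore

/-! ### The local strong 4-core -/

namespace StrongCore

/-! ### Balls and distances under the addition of an edge -/

section Balls

variable {V : Type*} {G G' : SimpleGraph V} {a b v x y : V} {j k : ℕ}

theorem mem_gball_self : v ∈ gball G v j := by simp [gball]

theorem gball_mono {i : ℕ} (h : i ≤ j) : gball G v i ⊆ gball G v j :=
  fun _ hx => le_trans (b := (i : ℕ∞)) hx (by exact_mod_cast h)

theorem mem_gball_succ_of_adj (hx : x ∈ gball G v j) (hxy : G.Adj x y) : y ∈ gball G v (j + 1) := by
  have h1 : G.edist v y ≤ G.edist v x + G.edist x y := SimpleGraph.edist_triangle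
  rw [SimpleGraph.edist_eq_one_iff_adj.2 hxy] at h1
  refine h1.trans ?_
  push_cast
  exact add_le_add_left hx 1

theorem mem_gball_of_adj (hk : 1 ≤ k) (hx : x ∈ gball G v (k - 1)) (hxy : G.Adj x y) :
    y ∈ gball G v k := by
  have := mem_gball_succ_of_adj hx hxy
  rwa [Nat.sub_add_cancel hk] at this

theorem mem_gball_pred (hx : x ∈ gball G v k) (hx' : x ∉ gsphere G v k) :
    x ∈ gball G v (k - 1) := by
  have h : G.edist v x < k := lt_of_le_of_ne hx hx'
  obtain ⟨m, hm⟩ := ENat.ne_top_iff_exists.1 (ne_top_of_lt h)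
  simp only [gball, Set.mem_ofPred_eq, ← hm] at h ⊢
  have h' : m < k := by exact_mod_cast h
  exact_mod_cast (by omega : m ≤ k - 1)

theorem notMem_gsphere (hk : 1 ≤ k) (hx : x ∈ gball G v (k - 1)) : x ∉ gsphere G v k := by
  intro h
  simp only [gball, gsphere, Set.mem_ofPred_eq] at hx h
  rw [h] at hx
  have : k ≤ k - 1 := by exact_mod_cast hx
  omega

/-- `G'` is obtained from `G` by adding the edge `ab`. -/
structure IsAddEdge (G G' : SimpleGraph V) (a b : V) : Prop where
  le : G ≤ G'
  adj : ∀ x y, G'.Adj x y → G.Adj x y ∨ (x = a ∧ y = b) ∨ (x = b ∧ y = a)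

theorem IsAddEdge.agreeOff (h : IsAddEdge G G' a b) : AgreeOff G G' a b := by
  intro x y hxa hxb
  refine ⟨fun h' => h.le h', fun h' => ?_⟩
  rcases h.adj x y h' with h' | ⟨rfl, -⟩ | ⟨rfl, -⟩
  · exact h'
  · exact absurd rfl hxa
  · exact absurd rfl hxb

/-- Induction on the walk. When it crosses ab again, the part between the two crossings is dropped,
so at most one crossing has to be recorded. -/
theorem IsAddEdge.edist_le_length (h : IsAddEdge G G' a b) (p : G'.Walk x y) :
    G.edist x y ≤ p.length ∨ G.edist x a + 1 + G.edist b y ≤ p.length ∨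
      G.edist x b + 1 + G.edist a y ≤ p.length := by
  induction p with
  | nil => left; simp
  | @cons x z y hxz q ih =>
    rw [SimpleGraph.Walk.length_cons]
    push_cast
    rcases h.adj x z hxz with hxz | ⟨rfl, rfl⟩ | ⟨rfl, rfl⟩
    · have htri : ∀ w, G.edist x w ≤ G.edist z w + 1 := fun w => by
        have h1 : G.edist x w ≤ G.edist x z + G.edist z w := SimpleGraph.edist_triangle
        rwa [SimpleGraph.edist_eq_one_iff_adj.2 hxz, add_comm] at h1
      rcases ih with ih | ih | ih
      · exact Or.inl ((htri y).trans (add_le_add_left ih 1))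
      · refine Or.inr (Or.inl ?_)
        calc _ ≤ G.edist z a + 1 + 1 + G.edist b y := by gcongr; exact htri a
          _ = (G.edist z a + 1 + G.edist b y) + 1 := by ring
          _ ≤ _ := add_le_add_left ih 1
      · refine Or.inr (Or.inr ?_)
        calc _ ≤ G.edist z b + 1 + 1 + G.edist a y := by gcongr; exact htri b
          _ = (G.edist z b + 1 + G.edist a y) + 1 := by ring
          _ ≤ _ := add_le_add_left ih 1
    · rcases ih with ih | ih | ih
      · refine Or.inr (Or.inl ?_)
        rw [SimpleGraph.edist_self, zero_add, add_comm]
        exact add_le_add_left ih 1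
      · refine Or.inr (Or.inl ?_)
        rw [SimpleGraph.edist_self, zero_add, add_comm]
        exact add_le_add_left ((self_le_add_left _ _).trans ih) 1
      · exact Or.inl (((self_le_add_left _ _).trans ih).trans (self_le_add_right _ _))
    · rcases ih with ih | ih | ih
      · refine Or.inr (Or.inr ?_)
        rw [SimpleGraph.edist_self, zero_add, add_comm]
        exact add_le_add_left ih 1
      · exact Or.inl (((self_le_add_left _ _).trans ih).trans (self_le_add_right _ _))
      · refine Or.inr (Or.inr ?_)
        rw [SimpleGraph.edist_self, zero_add, add_comm]
        exact add_le_add_left ((self_le_add_left _ _).trans ih) 1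

/-- A distance of at most `k` that is shortened by the new edge passes through the edge. -/
theorem IsAddEdge.edist_eq_or (h : IsAddEdge G G' a b) (hxy : G.edist x y ≤ k) :
    G'.edist x y = G.edist x y ∨ G.edist x a + G.edist b y ≤ k ∨
      G.edist x b + G.edist a y ≤ k := by
  have hle : G'.edist x y ≤ G.edist x y := SimpleGraph.edist_anti h.le
  obtain ⟨p, hp⟩ := SimpleGraph.exists_walk_of_edist_ne_top
    (ne_top_of_le_ne_top (ENat.natCast_ne_top k) (hle.trans hxy))
  have hpk : (p.length : ℕ∞) ≤ k := hp ▸ hle.trans hxy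
  rcases h.edist_le_length p with h1 | h1 | h1
  · exact Or.inl (le_antisymm hle (hp ▸ h1))
  · refine Or.inr (Or.inl (le_trans ?_ (h1.trans hpk)))
    gcongr
    exact self_le_add_right _ _
  · refine Or.inr (Or.inr (le_trans ?_ (h1.trans hpk)))
    gcongr
    exact self_le_add_right _ _

end Balls

/-! ### Stability of the local core and of the local estimate -/

section Local

variable {V : Type*} {G G' : SimpleGraph V} {a b v x y : V} {k : ℕ}

theorem localCore_subset_gball : localCore G v k ⊆ gball G v (k - 1) :=
  (isGreatest_localCore G v k).1.1

theorem subset_localCore {A : Set V} (hA : HasLocalCoreProp G v k A) : A ⊆ localCore G v k :=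
  (isGreatest_localCore G v k).2 hA

theorem mem_localPurple (hk : 1 ≤ k) (hx : x ∈ gball G v (k - 1)) :
    x ∈ localPurple G v k ↔ x ∉ localCore G v k ∧ ∃ y ∈ localCore G v k, G.Adj x y := by
  have h : localSapphire G v k \ gsphere G v k = localCore G v k := by
    ext z
    constructor
    · rintro ⟨h1 | h1, h2⟩
      · exact h1
      · exact absurd h1 h2
    · exact fun h => ⟨Or.inl h, notMem_gsphere hk (localCore_subset_gball h)⟩
  rw [localPurple, h]
  exact ⟨fun h => h.1, fun h => ⟨h, notMem_gsphere hk hx⟩⟩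

/-- The sphere belongs to the local core by definition, so only the ball of radius k − 1 remains to
be divided. -/
theorem localPurple_union_localRed (hk : 1 ≤ k) :
    localPurple G v k ∪ localRed G v k = gball G v (k - 1) \ localCore G v k := by
  ext x
  constructor
  · rintro (hx | hx)
    · obtain ⟨⟨h1, y, hy, hxy⟩, h2⟩ := hx
      have hyB : y ∈ gball G v (k - 1) := by
        rcases hy.1 with h | h
        · exact localCore_subset_gball h
        · exact absurd h hy.2
      exact ⟨mem_gball_pred (mem_gball_of_adj hk hyB hxy.symm) h2,
        fun h => h1 ⟨Or.inl h, h2⟩⟩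
    · have hxs : x ∉ gsphere G v k := fun h => hx.2 (Or.inl (Or.inr h))
      exact ⟨mem_gball_pred hx.1 hxs, fun h => hx.2 (Or.inl (Or.inl h))⟩
  · rintro ⟨h1, h2⟩
    by_cases hp : x ∈ localPurple G v k
    · exact Or.inl hp
    · refine Or.inr ⟨gball_mono (Nat.sub_le k 1) h1, ?_⟩
      rintro ((h | h) | h)
      · exact h2 h
      · exact notMem_gsphere hk h1 h
      · exact hp h

theorem localComp_eq (hk : 1 ≤ k) :
    localComp G v k = compIn G (gball G v (k - 1) \ localCore G v k) v := by
  rw [localComp, localPurple_union_localRed hk]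

theorem mem_localSapphire_self (hk : 1 ≤ k) : v ∈ localSapphire G v k ↔ v ∈ localCore G v k := by
  constructor
  · rintro (h | h)
    · exact h
    · exact absurd h (notMem_gsphere hk mem_gball_self)
  · exact Or.inl

theorem localPhi_nonneg : 0 ≤ localPhi G k v := by
  unfold localPhi
  split_ifs <;> positivity

theorem localPhi_le_one [Finite V] : localPhi G k v ≤ 1 := by
  unfold localPhi
  split_ifs
  · exact zero_le_one
  · exact div_le_one_of_le₀ (by exact_mod_cast ucOn_le_ncard) (by positivity)

/-- Truncating the core to the ball of radius k − 1 removes, around a vertex of that ball, only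
neighbours on the sphere, and these count as core vertices in the local condition. -/
theorem sapphire_inter_gball_subset (hk : 1 ≤ k) :
    sapphire G ∩ gball G v (k - 1) ⊆ localCore G v k := by
  refine subset_localCore ⟨Set.inter_subset_right, ?_⟩
  rintro x ⟨hx, hxs⟩
  have hx' : x ∈ gball G v (k - 1) ∧ x ∈ sapphire G ∪ purple G := by
    rcases hx with hx | ⟨hx, y, hy, hxy⟩
    · exact ⟨hx.2, Or.inl hx.1⟩
    · have h1 := mem_gball_pred (mem_gball_of_adj hk hy.2 hxy.symm) hxs
      exact ⟨h1, Or.inr ⟨fun h => hx ⟨h, h1⟩, y, hy.1, hxy⟩⟩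
  refine (four_le_of_mem_sapphire hx'.2).trans (Set.encard_le_encard ?_)
  rintro y ⟨hxy, hy⟩
  refine ⟨hxy, ?_⟩
  by_cases hys : y ∈ gsphere G v k
  · exact Or.inr hys
  · exact Or.inl ⟨hy, mem_gball_pred (mem_gball_of_adj hk hx'.1 hxy) hys⟩

theorem localPhi_eq_zero (hk : 1 ≤ k) (hv : v ∈ sapphire G) : localPhi G k v = 0 :=
  if_pos (Or.inl (sapphire_inter_gball_subset hk ⟨hv, mem_gball_self⟩))

/-- If the component of `v` is small, then it is seen by the local exploration. -/
theorem localPhi_eq_phi [Finite V] (hk : 2 ≤ k) (hc : (outerComp G v).ncard + 1 ≤ k) :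
    localPhi G k v = phi G v := by
  by_cases hv : v ∈ sapphire G
  · rw [localPhi_eq_zero (by omega) hv, phi, if_pos hv]
  have hk1 : 1 ≤ k := by omega
  set C := outerComp G v with hC
  have hCball : C ⊆ gball G v (k - 2) := compIn_subset_gball (by rw [← outerComp, ← hC]; omega)
  have hCball1 : C ⊆ gball G v (k - 1) := hCball.trans (gball_mono (by omega))
  have hnext : ∀ x ∈ C, ∀ y, G.Adj x y → y ∈ gball G v (k - 1) := fun x hx y hxy => by
    have := mem_gball_succ_of_adj (hCball hx) hxy
    rwa [show k - 2 + 1 = k - 1 by omega] at this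
  have hdisj : ∀ x ∈ C, x ∉ localCore G v k := by
    -- C and its neighbours lie within distance k − 1, so the sphere gives no help to vertices of C.
    -- The part of the local core inside C could therefore be added to the true core.
    have hA : HasStrongCoreProp G (sapphire G ∪ (localCore G v k ∩ C)) := by
      intro x hx
      by_cases hxS : x ∈ sapphire G ∪ purple G
      · exact (four_le_of_mem_sapphire hxS).trans (Set.encard_le_encard
          (Set.inter_subset_inter_right _ Set.subset_union_left))
      have hnS : x ∉ sapphire G := fun h' => hxS (Or.inl h')
      have hnP : ∀ y, G.Adj x y → y ∉ sapphire G :=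
        fun y hxy hy => hxS (Or.inr ⟨hnS, y, hy, hxy⟩)
      have hxC : x ∈ C ∧ x ∈ localCore G v k ∪ extNbr G (localCore G v k) := by
        rcases hx with (hx | hx) | ⟨hx, y, hy | hy, hxy⟩
        · exact absurd hx hnS
        · exact ⟨hx.2, Or.inl hx.1⟩
        · exact absurd hy (hnP y hxy)
        · have hxC : x ∈ C := compIn_step hy.2 hnS hxy.symm
          refine ⟨hxC, ?_⟩
          by_cases hx' : x ∈ localCore G v k
          · exact Or.inl hx'
          · exact Or.inr ⟨hx', y, hy.1, hxy⟩
      refine ((isGreatest_localCore G v k).1.2 x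
        ⟨hxC.2, notMem_gsphere hk1 (hCball1 hxC.1)⟩).trans (Set.encard_le_encard ?_)
      rintro y ⟨hxy, hy | hy⟩
      · exact ⟨hxy, Or.inr ⟨hy, compIn_step hxC.1 (hnP y hxy) hxy⟩⟩
      · exact absurd hy (notMem_gsphere hk1 (hnext x hxC.1 y hxy))
    intro x hx hx'
    exact compIn_subset hx (subset_sapphire hA (Or.inr ⟨hx', hx⟩))
  have hvC : v ∈ C := mem_compIn_self hv
  have hcomp : localComp G v k = C := by
    rw [localComp_eq hk1]
    apply Set.Subset.antisymm
    · refine compIn_subset_of_closed (fun _ => hvC) fun x _ hx y hy hxy => ?_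
      exact compIn_step hx (fun hyS => hy.2 (sapphire_inter_gball_subset hk1 ⟨hyS, hy.1⟩)) hxy
    · refine compIn_subset_of_closed (fun _ => mem_compIn_self ⟨mem_gball_self, hdisj v hvC⟩)
        fun x hxC hx y hy hxy => ?_
      have hyC : y ∈ C := compIn_step hxC hy hxy
      exact compIn_step hx ⟨hCball1 hyC, hdisj y hyC⟩ hxy
  have hpur : C ∩ localPurple G v k = C ∩ purple G := by
    ext x
    simp only [Set.mem_inter_iff, and_congr_right_iff]
    intro hx
    rw [mem_localPurple hk1 (hCball1 hx)]
    constructor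
    · rintro ⟨_, y, hy, hxy⟩
      exact ⟨compIn_subset hx, y, mem_sapphire_of_adj hx hxy (fun h => hdisj y h hy), hxy⟩
    · rintro ⟨_, y, hy, hxy⟩
      exact ⟨hdisj x hx, y, sapphire_inter_gball_subset hk1 ⟨hy, hnext x hx y hxy⟩, hxy⟩
  rw [localPhi, phi, if_neg hv, if_neg fun h => hdisj v hvC ((mem_localSapphire_self hk1).1 h),
    hcomp, ucOn_congr (fun _ _ _ _ => Iff.rfl) hpur]

/-- The set `T` is separated in the same way from the rest of the `k`-balls around `v` in `G` and
in `G'`. -/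
structure IsLocalWindow (G G' : SimpleGraph V) (v : V) (k : ℕ) (T : Set V) : Prop where
  adj : ∀ x ∈ T, ∀ y, G.Adj x y ↔ G'.Adj x y
  subset : T ⊆ gball G v (k - 1)
  subset' : T ⊆ gball G' v (k - 1)
  boundary : ∀ x ∈ T, ∀ y, y ∉ T → G.Adj x y → (y ∈ gsphere G v k ∧ y ∈ gsphere G' v k) ∨
    (y ∈ localCore G v k ∧ y ∈ localCore G' v k)

variable {T : Set V}

theorem IsLocalWindow.symm (h : IsLocalWindow G G' v k T) : IsLocalWindow G' G v k T where
  adj x hx y := (h.adj x hx y).symm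
  subset := h.subset'
  subset' := h.subset
  boundary x hx y hy hxy := (h.boundary x hx y hy ((h.adj x hx y).2 hxy)).imp And.symm And.symm

/-- The local core of G together with the part in T of the local core of G' satisfies the local
condition in G: edges at T agree, and an edge leaving T ends on both spheres or in both local cores.
-/
theorem IsLocalWindow.mem_localCore (hk : 1 ≤ k) (h : IsLocalWindow G G' v k T) (hx : x ∈ T)
    (hx' : x ∈ localCore G' v k) : x ∈ localCore G v k := by
  refine subset_localCore (A := localCore G v k ∪ (localCore G' v k ∩ T))
    ⟨Set.union_subset localCore_subset_gball (Set.inter_subset_right.trans h.subset), ?_⟩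
    (Or.inr ⟨hx', hx⟩)
  rintro x ⟨hx, hxs⟩
  by_cases hxA : x ∈ localCore G v k ∪ extNbr G (localCore G v k)
  · exact ((isGreatest_localCore G v k).1.2 x ⟨hxA, hxs⟩).trans (Set.encard_le_encard
      (Set.inter_subset_inter_right _ (Set.union_subset_union_left _ Set.subset_union_left)))
  have hxn : x ∉ localCore G v k := fun h' => hxA (Or.inl h')
  have hxT : x ∈ T ∧ x ∈ localCore G' v k ∪ extNbr G' (localCore G' v k) := by
    rcases hx with (hx | hx) | ⟨hx, y, hy | hy, hxy⟩
    · exact absurd hx hxn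
    · exact ⟨hx.2, Or.inl hx.1⟩
    · exact absurd (Or.inr ⟨hxn, y, hy, hxy⟩) hxA
    · have hxT : x ∈ T := by
        by_contra hxT
        rcases h.boundary y hy.2 x hxT hxy.symm with h' | h'
        · exact hxs h'.1
        · exact hxn h'.1
      refine ⟨hxT, ?_⟩
      by_cases hx' : x ∈ localCore G' v k
      · exact Or.inl hx'
      · exact Or.inr ⟨hx', y, hy.1, (h.adj x hxT y).1 hxy⟩
  refine ((isGreatest_localCore G' v k).1.2 x
    ⟨hxT.2, notMem_gsphere hk (h.subset' hxT.1)⟩).trans (Set.encard_le_encard ?_)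
  rintro y ⟨hxy, hy⟩
  have hxy' : G.Adj x y := (h.adj x hxT.1 y).2 hxy
  refine ⟨hxy', ?_⟩
  by_cases hyT : y ∈ T
  · rcases hy with hy | hy
    · exact Or.inl (Or.inr ⟨hy, hyT⟩)
    · exact absurd hy (notMem_gsphere hk (h.subset' hyT))
  · exact (h.boundary x hxT.1 y hyT hxy').elim (fun h' => Or.inr h'.1)
      (fun h' => Or.inl (Or.inl h'.1))

theorem IsLocalWindow.mem_localCore_iff (hk : 1 ≤ k) (h : IsLocalWindow G G' v k T) (hx : x ∈ T) :
    x ∈ localCore G v k ↔ x ∈ localCore G' v k :=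
  ⟨h.symm.mem_localCore hk hx, h.mem_localCore hk hx⟩

theorem IsLocalWindow.localComp_subset (hk : 1 ≤ k) (h : IsLocalWindow G G' v k T) (hv : v ∈ T) :
    localComp G v k ⊆ T := by
  rw [localComp_eq hk]
  refine compIn_subset_of_closed (fun _ => hv) fun x _ hx y hy hxy => ?_
  by_contra hyT
  rcases h.boundary x hx y hyT hxy with h' | h'
  · exact notMem_gsphere hk hy.1 h'.1
  · exact hy.2 h'.1

theorem IsLocalWindow.localComp_subset_localComp (hk : 1 ≤ k) (h : IsLocalWindow G G' v k T)
    (hv : v ∈ T) : localComp G v k ⊆ localComp G' v k := by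
  have hT := h.localComp_subset hk hv
  rw [localComp_eq hk] at hT ⊢
  have hmem : ∀ x ∈ compIn G (gball G v (k - 1) \ localCore G v k) v,
      x ∈ gball G' v (k - 1) \ localCore G' v k := fun x hx =>
    ⟨h.subset' (hT hx), fun h' => (compIn_subset hx).2 (h.mem_localCore hk (hT hx) h')⟩
  rw [localComp_eq hk]
  refine compIn_subset_of_closed (fun hv' => mem_compIn_self (hmem v (mem_compIn_self hv')))
    fun x hxC hx y hy hxy => ?_
  exact compIn_step hx (hmem y (compIn_step hxC hy hxy)) ((h.adj x (hT hxC) y).1 hxy)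

theorem IsLocalWindow.localPhi_eq (hk : 1 ≤ k) (h : IsLocalWindow G G' v k T) (hv : v ∈ T) :
    localPhi G k v = localPhi G' k v := by
  have hcomp : localComp G v k = localComp G' v k :=
    (h.localComp_subset_localComp hk hv).antisymm (h.symm.localComp_subset_localComp hk hv)
  have hT := h.localComp_subset hk hv
  have hpur : localComp G v k ∩ localPurple G v k = localComp G v k ∩ localPurple G' v k := by
    ext x
    simp only [Set.mem_inter_iff, and_congr_right_iff]
    intro hx
    rw [mem_localPurple hk (h.subset (hT hx)), mem_localPurple hk (h.subset' (hT hx)),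
      h.mem_localCore_iff hk (hT hx)]
    refine and_congr_right fun _ => exists_congr fun y => ?_
    rw [h.adj x (hT hx) y]
    refine and_congr_left fun hxy => ?_
    by_cases hyT : y ∈ T
    · exact h.mem_localCore_iff hk hyT
    · rcases h.boundary x (hT hx) y hyT ((h.adj x (hT hx) y).2 hxy) with h' | h'
      · exact iff_of_false (fun h2 => notMem_gsphere hk (localCore_subset_gball h2) h'.1)
          (fun h2 => notMem_gsphere hk (localCore_subset_gball h2) h'.2)
      · exact iff_of_true h'.1 h'.2
  have hS : v ∈ localSapphire G v k ↔ v ∈ localSapphire G' v k := by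
    rw [mem_localSapphire_self hk, mem_localSapphire_self hk, h.mem_localCore_iff hk hv]
  rw [localPhi, localPhi, ← hcomp, ucOn_congr (fun x hx y _ => h.adj x (hT hx) y) hpur]
  by_cases hv : v ∈ localSapphire G v k
  · rw [if_pos hv, if_pos (hS.1 hv)]
  · rw [if_neg hv, if_neg fun h' => hv (hS.2 h')]

/-- Adding an edge outside the component of `v` that does not create a short cycle does not change
the local estimate. -/
theorem localPhi_congr_of_far (hk : 1 ≤ k) (h : IsAddEdge G G' a b)
    (hab : ((2 * k : ℕ) : ℕ∞) < G.edist a b)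
    (ha : a ∉ outerComp G v) (hb : b ∉ outerComp G v) (ha' : a ∉ outerComp G' v)
    (hb' : b ∉ outerComp G' v) : localPhi G k v = localPhi G' k v := by
  have heq := outerComp_eq h.agreeOff ha hb ha' hb'
  by_cases hv : v ∈ sapphire G
  · rw [localPhi_eq_zero hk hv, localPhi_eq_zero hk]
    rwa [mem_sapphire_iff_outerComp, ← heq, ← mem_sapphire_iff_outerComp]
  -- If ab shortened the distance from v to y, then v and y would be close to opposite ends of ab.
  -- Joining the ends through v and y would give a walk of length at most 2k in G.
  have hdist : ∀ y, G.edist v y ≤ k → G'.edist v y = G.edist v y := by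
    intro y hy
    have aux : ∀ c d, G.edist v c + G.edist d y ≤ k → G.edist c d ≤ (2 * k : ℕ) := by
      intro c d hcd
      have h1 : G.edist c d ≤ G.edist c y + G.edist y d := SimpleGraph.edist_triangle
      have h2 : G.edist c y ≤ G.edist c v + G.edist v y := SimpleGraph.edist_triangle
      calc G.edist c d ≤ G.edist c v + G.edist v y + G.edist y d := h1.trans (by gcongr)
        _ = G.edist v c + G.edist d y + G.edist v y := by
          rw [SimpleGraph.edist_comm (u := c), SimpleGraph.edist_comm (u := y) (v := d)]; ring
        _ ≤ k + k := add_le_add hcd hy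
        _ = _ := by push_cast; ring
    rcases h.edist_eq_or hy with h' | h' | h'
    · exact h'
    · exact absurd (aux _ _ h') (not_le.2 hab)
    · exact absurd (SimpleGraph.edist_comm (G := G) ▸ aux _ _ h') (not_le.2 hab)
  -- This window is cut out by the true core, not the local one. It lies in the unchanged component
  -- of v, and its neighbours in the ball belong to the true cores, hence to the local cores, of
  -- both graphs.
  set T := compIn G (gball G v (k - 1) \ sapphire G) v
  have hTC : T ⊆ outerComp G v := compIn_subset_of_closed (fun _ => mem_compIn_self hv)
    fun x _ hx y hy hxy => compIn_step hx hy.2 hxy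
  have hw : IsLocalWindow G G' v k T := by
    refine ⟨fun x hx y => h.agreeOff x y (fun e => ha (e ▸ hTC hx)) (fun e => hb (e ▸ hTC hx)),
      fun x hx => (compIn_subset hx).1,
      fun x hx => (SimpleGraph.edist_anti h.le).trans (compIn_subset hx).1, ?_⟩
    intro x hx y hyT hxy
    have hyk : y ∈ gball G v k := mem_gball_of_adj hk (compIn_subset hx).1 hxy
    have hyd := hdist y hyk
    by_cases hys : y ∈ gsphere G v k
    · exact Or.inl ⟨hys, hyd.trans hys⟩
    · have hyB := mem_gball_pred hyk hys
      have hyB' : y ∈ gball G' v (k - 1) := hyd.le.trans hyB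
      have hyS : y ∈ sapphire G := by
        by_contra hyS
        exact hyT (compIn_step hx ⟨hyB, hyS⟩ hxy)
      have hyS' : y ∈ sapphire G' := mem_sapphire_of_adj (heq ▸ hTC hx) (h.le hxy)
        (heq ▸ fun h' => compIn_subset h' hyS)
      exact Or.inr ⟨sapphire_inter_gball_subset hk ⟨hyS, hyB⟩,
        sapphire_inter_gball_subset hk ⟨hyS', hyB'⟩⟩
  exact hw.localPhi_eq hk (mem_compIn_self ⟨mem_gball_self, hv⟩)

/-- Without assuming a and b to be far apart: the ball of radius k − 1 is a window bounded by the
sphere alone, since no distance up to k changes. -/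
theorem localPhi_congr_of_notMem_gball (hk : 1 ≤ k) (h : IsAddEdge G G' a b)
    (ha : a ∉ gball G v k) (hb : b ∉ gball G v k) : localPhi G k v = localPhi G' k v := by
  have hdist : ∀ y, G.edist v y ≤ k → G'.edist v y = G.edist v y := by
    intro y hy
    rcases h.edist_eq_or hy with h' | h' | h'
    · exact h'
    · exact absurd ((self_le_add_right _ _).trans h') ha
    · exact absurd ((self_le_add_right _ _).trans h') hb
  have hsub : gball G v (k - 1) ⊆ gball G v k := gball_mono (Nat.sub_le k 1)
  have hw : IsLocalWindow G G' v k (gball G v (k - 1)) := by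
    refine ⟨fun x hx y => h.agreeOff x y (fun e => ha (e ▸ hsub hx)) (fun e => hb (e ▸ hsub hx)),
      subset_rfl, fun x hx => (SimpleGraph.edist_anti h.le).trans hx, ?_⟩
    intro x hx y hyT hxy
    have hyk := mem_gball_of_adj hk hx hxy
    have hys : y ∈ gsphere G v k := by
      by_contra hys
      exact hyT (mem_gball_pred hyk hys)
    exact Or.inl ⟨hys, (hdist y hyk).trans hys⟩
  exact hw.localPhi_eq hk mem_gball_self

end Local

end StrongCore

/-! ### The effect of one edge on the discrepancy -/

namespace StrongCore

open Finset

section EdgeEffect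

variable {V : Type*} {G G' : SimpleGraph V} {a b v : V} {k : ℕ}

/-- The squared size of the component of `v`, provided that this is at least `k - 1`. -/
noncomputable def largeSq (k : ℕ) (G : SimpleGraph V) (v : V) : ℝ :=
  if k ≤ (outerComp G v).ncard + 1 then ((outerComp G v).ncard : ℝ) ^ 2 else 0

theorem largeSq_nonneg : 0 ≤ largeSq k G v := by
  unfold largeSq
  split_ifs <;> positivity

theorem sq_ncard_le : ((outerComp G v).ncard : ℝ) ^ 2 ≤ largeSq k G v + (k : ℝ) ^ 2 := by
  unfold largeSq
  split_ifs with h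
  · nlinarith [sq_nonneg (k : ℝ)]
  · have : ((outerComp G v).ncard : ℝ) ≤ k := by exact_mod_cast (by omega)
    nlinarith [Nat.cast_nonneg (α := ℝ) (outerComp G v).ncard]

theorem sq_le_largeSq {m : ℕ} (h : m ≤ (outerComp G v).ncard) (hm : k ≤ m + 1) :
    (m : ℝ) ^ 2 ≤ largeSq k G v := by
  unfold largeSq
  rw [if_pos (by omega)]
  have : (m : ℝ) ≤ (outerComp G v).ncard := by exact_mod_cast h
  nlinarith [Nat.cast_nonneg (α := ℝ) m]

/-- The sum of `largeSq` over the endpoints of `ab` and over two graphs. -/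
noncomputable def largeSqSum (k : ℕ) (G G' : SimpleGraph V) (a b : V) : ℝ :=
  largeSq k G a + largeSq k G b + largeSq k G' a + largeSq k G' b

theorem largeSqSum_nonneg : 0 ≤ largeSqSum k G G' a b := by
  have h1 := largeSq_nonneg (k := k) (G := G) (v := a)
  have h2 := largeSq_nonneg (k := k) (G := G) (v := b)
  have h3 := largeSq_nonneg (k := k) (G := G') (v := a)
  have h4 := largeSq_nonneg (k := k) (G := G') (v := b)
  unfold largeSqSum
  positivity

/-- The vertices whose component meets `{a, b}` in one of the two graphs. -/
def touched (G G' : SimpleGraph V) (a b : V) : Set V :=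
  outerComp G a ∪ outerComp G b ∪ outerComp G' a ∪ outerComp G' b

theorem ncard_touched_le : (touched G G' a b).ncard ≤ (outerComp G a).ncard +
    (outerComp G b).ncard + (outerComp G' a).ncard + (outerComp G' b).ncard := by
  have h1 := Set.ncard_union_le (outerComp G a ∪ outerComp G b ∪ outerComp G' a) (outerComp G' b)
  have h2 := Set.ncard_union_le (outerComp G a ∪ outerComp G b) (outerComp G' a)
  have h3 := Set.ncard_union_le (outerComp G a) (outerComp G b)
  unfold touched
  omega

theorem notMem_outerComp_of_notMem_touched (h : v ∉ touched G G' a b) :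
    a ∉ outerComp G v ∧ b ∉ outerComp G v ∧ a ∉ outerComp G' v ∧ b ∉ outerComp G' v := by
  refine ⟨fun h' => h ?_, fun h' => h ?_, fun h' => h ?_, fun h' => h ?_⟩
  · exact Or.inl (Or.inl (Or.inl (compIn_comm.1 h')))
  · exact Or.inl (Or.inl (Or.inr (compIn_comm.1 h')))
  · exact Or.inl (Or.inr (compIn_comm.1 h'))
  · exact Or.inr (compIn_comm.1 h')

variable [Fintype V]

/-- A vertex touched only through G' has a component in G that avoids a and b, and by
`outerComp_subset` this is contained in its component in G'. -/
theorem ncard_outerComp_le_of_mem_touched (h : AgreeOff G G' a b) (hv : v ∈ touched G G' a b) :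
    (outerComp G v).ncard ≤ max (max (outerComp G a).ncard (outerComp G b).ncard)
      (max (outerComp G' a).ncard (outerComp G' b).ncard) := by
  have hG : v ∈ outerComp G a ∪ outerComp G b → (outerComp G v).ncard ≤
      max (outerComp G a).ncard (outerComp G b).ncard := by
    rintro (h' | h')
    · rw [outerComp, compIn_eq_of_mem h']; exact le_max_left _ _
    · rw [outerComp, compIn_eq_of_mem h']; exact le_max_right _ _
  by_cases h1 : v ∈ outerComp G a ∪ outerComp G b
  · exact (hG h1).trans (le_max_left _ _)
  have hsub : outerComp G v ⊆ outerComp G' v := outerComp_subset h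
    (fun h' => h1 (Or.inl (compIn_comm.1 h'))) (fun h' => h1 (Or.inr (compIn_comm.1 h')))
  refine (Set.ncard_le_ncard hsub).trans (le_trans ?_ (le_max_right _ _))
  rcases hv with (h' | h') | h'
  · exact absurd h' h1
  · rw [outerComp, compIn_eq_of_mem h']; exact le_max_left _ _
  · rw [outerComp, compIn_eq_of_mem h']; exact le_max_right _ _

theorem discrepancy_sub (k : ℕ) (G G' : SimpleGraph V) :
    discrepancy k G' - discrepancy k G =
      ∑ v : V, ((localPhi G' k v - localPhi G k v) - (phi G' v - phi G v)) := by
  simp only [discrepancy, Phi_eq_sum, sum_sub_distrib]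
  ring

theorem abs_localPhi_sub_le : |localPhi G' k v - localPhi G k v| ≤ 1 := by
  have h1 := localPhi_le_one (G := G) (k := k) (v := v)
  have h2 := localPhi_le_one (G := G') (k := k) (v := v)
  have h3 := localPhi_nonneg (G := G) (k := k) (v := v)
  have h4 := localPhi_nonneg (G := G') (k := k) (v := v)
  exact abs_sub_le_iff.2 ⟨by linarith, by linarith⟩

theorem abs_phi_sub_le : |phi G' v - phi G v| ≤ 1 :=
  abs_sub_le_iff.2 ⟨by linarith [phi_le_one G' v, phi_nonneg G v],
    by linarith [phi_le_one G v, phi_nonneg G' v]⟩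

open Classical in
theorem sum_le_mul_ncard {f : V → ℝ} {S : Set V} {c : ℝ} (h : ∀ v ∈ S, |f v| ≤ c)
    (h0 : ∀ v ∉ S, f v = 0) : |∑ v, f v| ≤ c * S.ncard := by
  have h1 : ∑ v, f v = ∑ v ∈ univ.filter (· ∈ S), f v := by
    rw [sum_filter]
    exact sum_congr rfl fun v _ => by by_cases hv : v ∈ S <;> simp [hv, h0]
  have hc : (#(univ.filter (· ∈ S))) = S.ncard := by
    rw [← Set.ncard_coe_finset]; congr 1; ext; simp
  rw [h1, ← hc, mul_comm, ← nsmul_eq_mul]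
  exact (abs_sum_le_sum_abs _ _).trans (sum_le_card_nsmul _ _ _ fun v hv => h v (by simpa using hv))

theorem sq_discrepancy_sub_le_card (k : ℕ) (G G' : SimpleGraph V) :
    (discrepancy k G' - discrepancy k G) ^ 2 ≤ 4 * (Fintype.card V : ℝ) ^ 2 := by
  have h := sum_le_mul_ncard (S := Set.univ) (c := 2)
    (f := fun v => (localPhi G' k v - localPhi G k v) - (phi G' v - phi G v))
    (fun v _ => (abs_sub _ _).trans (by
      linarith [abs_localPhi_sub_le (G := G) (G' := G') (k := k) (v := v),
        abs_phi_sub_le (G := G) (G' := G') (v := v)])) (fun v hv => absurd (Set.mem_univ v) hv)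
  rw [← discrepancy_sub, Set.ncard_univ, Nat.card_eq_fintype_card] at h
  have := sq_le_sq' (by linarith [abs_le.1 h]) (abs_le.1 h).2
  linarith

/-- Only touched vertices contribute, there are at most 4M of them, and each contributes at most 2;
this gives (8M)² = 64M². -/
theorem sq_discrepancy_sub_le_of_far (hk : 2 ≤ k) (h : IsAddEdge G G' a b)
    (hab : ((2 * k : ℕ) : ℕ∞) < G.edist a b) :
    (discrepancy k G' - discrepancy k G) ^ 2 ≤ 64 * largeSqSum k G G' a b := by
  have hnn := largeSqSum_nonneg (k := k) (G := G) (G' := G') (a := a) (b := b)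
  set M := max (max (outerComp G a).ncard (outerComp G b).ncard)
      (max (outerComp G' a).ncard (outerComp G' b).ncard) with hM
  have hout : ∀ v ∉ touched G G' a b,
      (localPhi G' k v - localPhi G k v) - (phi G' v - phi G v) = 0 := by
    intro v hv
    obtain ⟨h1, h2, h3, h4⟩ := notMem_outerComp_of_notMem_touched hv
    rw [localPhi_congr_of_far (by omega) h hab h1 h2 h3 h4, phi_congr h.agreeOff h1 h2 h3 h4]
    ring
  have hM1 : ∀ v ∈ touched G G' a b, (outerComp G v).ncard ≤ M := fun v hv =>
    ncard_outerComp_le_of_mem_touched h.agreeOff hv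
  have hM2 : ∀ v ∈ touched G G' a b, (outerComp G' v).ncard ≤ M := fun v hv => by
    rw [hM, max_comm]
    refine ncard_outerComp_le_of_mem_touched h.agreeOff.symm ?_
    rcases hv with ((hv | hv) | hv) | hv
    · exact Or.inl (Or.inr hv)
    · exact Or.inr hv
    · exact Or.inl (Or.inl (Or.inl hv))
    · exact Or.inl (Or.inl (Or.inr hv))
  -- If M + 1 < k, all components of touched vertices are small enough to be seen by the local
  -- exploration, so the two estimates agree in both graphs.
  by_cases hbig : k ≤ M + 1
  · have hd := sum_le_mul_ncard (S := touched G G' a b) (c := 2)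
      (f := fun v => (localPhi G' k v - localPhi G k v) - (phi G' v - phi G v))
      (fun v _ => (abs_sub _ _).trans (by
        linarith [abs_localPhi_sub_le (G := G) (G' := G') (k := k) (v := v),
          abs_phi_sub_le (G := G) (G' := G') (v := v)])) hout
    rw [← discrepancy_sub] at hd
    have hU : ((touched G G' a b).ncard : ℝ) ≤ 4 * M := by
      have := ncard_touched_le (G := G) (G' := G') (a := a) (b := b)
      exact_mod_cast (by omega : (touched G G' a b).ncard ≤ 4 * M)
    have hd' : |discrepancy k G' - discrepancy k G| ≤ 8 * M := hd.trans (by linarith)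
    have hsq : (discrepancy k G' - discrepancy k G) ^ 2 ≤ 64 * (M : ℝ) ^ 2 := by
      have := sq_le_sq' (by linarith [abs_le.1 hd']) (abs_le.1 hd').2
      linarith
    have hMs : (M : ℝ) ^ 2 ≤ largeSqSum k G G' a b := by
      have h1 := largeSq_nonneg (k := k) (G := G) (v := a)
      have h2 := largeSq_nonneg (k := k) (G := G) (v := b)
      have h3 := largeSq_nonneg (k := k) (G := G') (v := a)
      have h4 := largeSq_nonneg (k := k) (G := G') (v := b)
      have hcase : M ≤ (outerComp G a).ncard ∨ M ≤ (outerComp G b).ncard ∨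
          M ≤ (outerComp G' a).ncard ∨ M ≤ (outerComp G' b).ncard := by omega
      unfold largeSqSum
      rcases hcase with h' | h' | h' | h' <;> linarith [sq_le_largeSq h' hbig]
    linarith
  · have hzero : discrepancy k G' - discrepancy k G = 0 := by
      rw [discrepancy_sub]
      refine sum_eq_zero fun v _ => ?_
      by_cases hv : v ∈ touched G G' a b
      · have h1 := hM1 v hv
        have h2 := hM2 v hv
        rw [localPhi_eq_phi (G := G) hk (by omega), localPhi_eq_phi (G := G') hk (by omega)]
        ring
      · exact hout v hv
    rw [hzero, zero_pow two_ne_zero]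
    exact mul_nonneg (by norm_num) hnn

-- For close endpoints the two estimates are treated separately: φ changes only on touched vertices,
-- the local estimate only on the k-balls around a and b. Components smaller than the threshold cost
-- at most k² each, hence the additive term.
open Classical in
theorem sq_discrepancy_sub_le (hk : 2 ≤ k) (h : IsAddEdge G G' a b) {N : ℕ}
    (ha : (gball G a k).ncard ≤ N) (hb : (gball G b k).ncard ≤ N) :
    (discrepancy k G' - discrepancy k G) ^ 2 ≤ 64 * largeSqSum k G G' a b +
      if b ∈ gball G a (2 * k) then 32 * (k : ℝ) ^ 2 + 8 * (N : ℝ) ^ 2 else 0 := by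
  by_cases hab : b ∈ gball G a (2 * k)
  swap
  · rw [if_neg hab, add_zero]
    exact sq_discrepancy_sub_le_of_far hk h (not_le.1 hab)
  rw [if_pos hab]
  have h1 := sum_le_mul_ncard (S := touched G G' a b) (c := 1)
    (f := fun v => phi G' v - phi G v) (fun v _ => abs_phi_sub_le) (fun v hv => by
      obtain ⟨h1, h2, h3, h4⟩ := notMem_outerComp_of_notMem_touched hv
      rw [phi_congr h.agreeOff h1 h2 h3 h4, sub_self])
  have h2 := sum_le_mul_ncard (S := gball G a k ∪ gball G b k) (c := 1)
    (f := fun v => localPhi G' k v - localPhi G k v) (fun v _ => abs_localPhi_sub_le)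
    (fun v hv => by
      rw [localPhi_congr_of_notMem_gball (by omega) h, sub_self]
      · intro h'
        refine hv (Or.inl ?_)
        simpa only [gball, Set.mem_ofPred_eq, SimpleGraph.edist_comm] using h'
      · intro h'
        refine hv (Or.inr ?_)
        simpa only [gball, Set.mem_ofPred_eq, SimpleGraph.edist_comm] using h')
  have h3 : discrepancy k G' - discrepancy k G =
      (∑ v, (localPhi G' k v - localPhi G k v)) - ∑ v, (phi G' v - phi G v) := by
    rw [discrepancy_sub, sum_sub_distrib]
  have h4 : ((gball G a k ∪ gball G b k).ncard : ℝ) ≤ 2 * N := by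
    have := Set.ncard_union_le (gball G a k) (gball G b k)
    exact_mod_cast (by omega : (gball G a k ∪ gball G b k).ncard ≤ 2 * N)
  set Ca := ((outerComp G a).ncard : ℝ)
  set Cb := ((outerComp G b).ncard : ℝ)
  set Ca' := ((outerComp G' a).ncard : ℝ)
  set Cb' := ((outerComp G' b).ncard : ℝ)
  have h5 : ((touched G G' a b).ncard : ℝ) ≤ Ca + Cb + Ca' + Cb' := by
    simp only [Ca, Cb, Ca', Cb']
    exact_mod_cast ncard_touched_le (G := G) (G' := G') (a := a) (b := b)
  have h6 : |discrepancy k G' - discrepancy k G| ≤ (Ca + Cb + Ca' + Cb') + 2 * N := by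
    rw [h3]
    exact (abs_sub _ _).trans (by linarith)
  have h7 := sq_le_sq' (by linarith [abs_le.1 h6]) (abs_le.1 h6).2
  have e1 : Ca ^ 2 ≤ _ := sq_ncard_le (k := k) (G := G) (v := a)
  have e2 : Cb ^ 2 ≤ _ := sq_ncard_le (k := k) (G := G) (v := b)
  have e3 : Ca' ^ 2 ≤ _ := sq_ncard_le (k := k) (G := G') (v := a)
  have e4 : Cb' ^ 2 ≤ _ := sq_ncard_le (k := k) (G := G') (v := b)
  have e5 : (Ca + Cb + Ca' + Cb') ^ 2 ≤ 4 * (Ca ^ 2 + Cb ^ 2 + Ca' ^ 2 + Cb' ^ 2) := by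
    nlinarith [sq_nonneg (Ca - Cb), sq_nonneg (Ca - Ca'), sq_nonneg (Ca - Cb'),
      sq_nonneg (Cb - Ca'), sq_nonneg (Cb - Cb'), sq_nonneg (Ca' - Cb')]
  have e6 : ((Ca + Cb + Ca' + Cb') + 2 * N) ^ 2 ≤
      2 * (Ca + Cb + Ca' + Cb') ^ 2 + 8 * (N : ℝ) ^ 2 := by
    nlinarith [sq_nonneg ((Ca + Cb + Ca' + Cb') - 2 * N)]
  have hnn := largeSqSum_nonneg (k := k) (G := G) (G' := G') (a := a) (b := b)
  unfold largeSqSum at hnn ⊢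
  linarith

end EdgeEffect

/-! ### Ball sizes in graphs of bounded degree -/

section BallSize

variable {V : Type*} [Fintype V] {G : SimpleGraph V}

theorem ncard_gball_le {D : ℕ} (hD : ∀ x, (G.neighborSet x).ncard ≤ D) (v : V) (j : ℕ) :
    (gball G v j).ncard ≤ (D + 1) ^ j := by
  classical
  induction j with
  | zero =>
    have : gball G v 0 = {v} := by
      ext x; simp [gball, eq_comm (a := v)]
    simp [this]
  | succ j ih =>
    have hsub : gball G v (j + 1) ⊆ ⋃ x ∈ (gball G v j).toFinset, insert x (G.neighborSet x) := by
      intro y hy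
      simp only [Set.mem_iUnion, Set.mem_toFinset]
      by_cases hyj : y ∈ gball G v j
      · exact ⟨y, hyj, Set.mem_insert _ _⟩
      obtain ⟨p, hp⟩ := SimpleGraph.exists_walk_of_edist_ne_top
        (ne_top_of_le_ne_top (ENat.natCast_ne_top (j + 1)) hy)
      have hlen : p.length ≤ j + 1 := by
        have : (p.length : ℕ∞) ≤ (j + 1 : ℕ) := hp ▸ hy
        exact_mod_cast this
      have hp' : p.reverse.length ≤ j + 1 := by rwa [SimpleGraph.Walk.length_reverse]
      cases hpr : p.reverse with
      | nil => exact absurd mem_gball_self hyj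
      | @cons _ x _ hyx q =>
        rw [hpr, SimpleGraph.Walk.length_cons] at hp'
        refine ⟨x, ?_, Or.inr hyx.symm⟩
        refine (SimpleGraph.edist_le q.reverse).trans ?_
        rw [SimpleGraph.Walk.length_reverse]
        exact_mod_cast (by omega : q.length ≤ j)
    calc (gball G v (j + 1)).ncard
        ≤ (⋃ x ∈ (gball G v j).toFinset, insert x (G.neighborSet x)).ncard :=
          Set.ncard_le_ncard hsub
      _ ≤ ∑ x ∈ (gball G v j).toFinset, (insert x (G.neighborSet x)).ncard :=
          Finset.set_ncard_biUnion_le _ _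
      _ ≤ ∑ x ∈ (gball G v j).toFinset, (D + 1) :=
          sum_le_sum fun x _ => (Set.ncard_insert_le _ _).trans (by have := hD x; omega)
      _ = (gball G v j).ncard * (D + 1) := by
          rw [sum_const, smul_eq_mul, Set.ncard_eq_toFinset_card']
      _ ≤ _ := by rw [pow_succ]; exact Nat.mul_le_mul_right _ ih

theorem ncard_gball_mono {G G' : SimpleGraph V} (h : G ≤ G') (v : V) (j : ℕ) :
    (gball G v j).ncard ≤ (gball G' v j).ncard :=
  Set.ncard_le_ncard fun _ hx => (SimpleGraph.edist_anti h).trans hx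

end BallSize

end StrongCore

/-! ### Probability estimates for components and for the peeling process -/

namespace StrongCore

open Finset BernoulliSubset

/-- A union bound in which each witness i prescribes the edges A i to be present and the edges B i
to be absent. -/
theorem bexp_le_sum {α ι : Type*} [DecidableEq α] {p : ℝ} (hp0 : 0 ≤ p) (hp1 : p ≤ 1)
    {E : Finset α} {f : Finset α → ℝ} (I : Finset ι) (A B : ι → Finset α)
    (hA : ∀ i ∈ I, A i ⊆ E) (hB : ∀ i ∈ I, B i ⊆ E) (hAB : ∀ i ∈ I, Disjoint (A i) (B i))
    (hf : ∀ s ⊆ E, f s ≤ 1)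
    (h : ∀ s ⊆ E, 0 < f s → ∃ i ∈ I, A i ⊆ s ∧ Disjoint (B i) s) :
    bexp p E f ≤ ∑ i ∈ I, p ^ #(A i) * (1 - p) ^ #(B i) := by
  rw [← sum_congr rfl fun i hi => bexp_subset_disjoint p (hA i hi) (hB i hi) (hAB i hi),
    ← bexp_sum]
  refine bexp_mono hp0 hp1 fun s hs => ?_
  have hnn : ∀ i ∈ I, (0 : ℝ) ≤ if A i ⊆ s ∧ Disjoint (B i) s then 1 else 0 := fun i _ => by
    split_ifs <;> norm_num
  rcases le_or_gt (f s) 0 with h0 | h0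
  · exact h0.trans (sum_nonneg hnn)
  · obtain ⟨i, hi, hi'⟩ := h s hs h0
    refine (hf s hs).trans (le_trans ?_ (single_le_sum hnn hi))
    rw [if_pos hi']

section Peeled

variable {V : Type*} [Fintype V] [DecidableEq V] {a b : V} {p t : ℝ} {C Q : Finset V}

/-- A random graph whose edges other than `ab` are those of the random set. -/
structure IsEdgeModel (H : Finset (Sym2 V) → SimpleGraph V) (a b : V) : Prop where
  mem_of_adj : ∀ s ⊆ allEdges V, ∀ x y, x ≠ a → x ≠ b → (H s).Adj x y → s(x, y) ∈ s
  adj_of_mem : ∀ s ⊆ allEdges V, ∀ x y, s(x, y) ∈ s → s(x, y) ≠ s(a, b) → (H s).Adj x y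

theorem ne_of_mem_of_subset {s : Finset (Sym2 V)} (hs : s ⊆ allEdges V) {x y : V}
    (h : s(x, y) ∈ s) : x ≠ y := fun e => mem_allEdges.1 (hs h) (by simpa using e)

theorem isEdgeModel_insert (a b : V) :
    IsEdgeModel (fun s => ofEdges (insert s(a, b) s)) a b where
  mem_of_adj _ _ _ _ hxa hxb h := by
    rcases mem_insert.1 (ofEdges_adj.1 h).1 with h' | h'
    · rcases Sym2.eq_iff.1 h' with ⟨h1, -⟩ | ⟨h1, -⟩
      · exact absurd h1 hxa
      · exact absurd h1 hxb
    · exact h'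
  adj_of_mem _ hs _ _ h _ := ofEdges_adj.2 ⟨mem_insert_of_mem h, ne_of_mem_of_subset hs h⟩

theorem isEdgeModel_erase (a b : V) :
    IsEdgeModel (fun s => ofEdges (s.erase s(a, b))) a b where
  mem_of_adj _ _ _ _ _ _ h := mem_of_mem_erase (ofEdges_adj.1 h).1
  adj_of_mem _ hs _ _ h h' := ofEdges_adj.2 ⟨mem_erase.2 ⟨h', h⟩, ne_of_mem_of_subset hs h⟩

/-- The pairs between `Q` and the complement of `C`, except for `ab`. -/
def crossEdges (a b : V) (C Q : Finset V) : Finset (Sym2 V) :=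
  ((Q ×ˢ Cᶜ).image fun z => s(z.1, z.2)).erase s(a, b)

theorem mem_crossEdges {e : Sym2 V} :
    e ∈ crossEdges a b C Q ↔ e ≠ s(a, b) ∧ ∃ x ∈ Q, ∃ y ∉ C, s(x, y) = e := by
  simp only [crossEdges, mem_erase, mem_image, mem_product, mem_compl, Prod.exists]
  exact and_congr_right fun _ => ⟨fun ⟨x, y, h, e⟩ => ⟨x, h.1, y, h.2, e⟩,
    fun ⟨x, h, y, h', e⟩ => ⟨x, y, ⟨h, h'⟩, e⟩⟩

theorem crossEdges_subset (hQ : Q ⊆ C) : crossEdges a b C Q ⊆ allEdges V := by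
  intro e he
  obtain ⟨_, x, hx, y, hy, rfl⟩ := mem_crossEdges.1 he
  rw [mem_allEdges, Sym2.mk_isDiag_iff]
  rintro rfl
  exact hy (hQ hx)

theorem card_crossEdges (hQ : Q ⊆ C) :
    #Q * (Fintype.card V - #C) - 1 ≤ #(crossEdges a b C Q) := by
  have h : #((Q ×ˢ Cᶜ).image fun z => s(z.1, z.2)) = #Q * (Fintype.card V - #C) := by
    rw [card_image_of_injOn, card_product, card_compl]
    rintro ⟨x, y⟩ h1 ⟨x', y'⟩ h2 h
    simp only [coe_product, Set.mem_prod, mem_coe, mem_compl] at h1 h2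
    rcases Sym2.eq_iff.1 h with ⟨rfl, rfl⟩ | ⟨rfl, rfl⟩
    · rfl
    · exact absurd (hQ h1.1) h2.2
  rw [← h]
  exact pred_card_le_card_erase

theorem IsPeeled.disjoint_crossEdges {H : Finset (Sym2 V) → SimpleGraph V}
    (hH : IsEdgeModel H a b) {s : Finset (Sym2 V)} (hs : s ⊆ allEdges V)
    (h : IsPeeled (H s) C Q) : Disjoint (crossEdges a b C Q) s := by
  rw [Finset.disjoint_left]
  intro e he hes
  obtain ⟨hne, x, hx, y, hy, rfl⟩ := mem_crossEdges.1 he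
  exact hy (h.closed x hx y (hH.adj_of_mem s hs x y hes hne))

theorem sum_pow_card_powerset {V : Type*} (C : Finset V) (x : ℝ) :
    ∑ Q ∈ C.powerset, x ^ #Q = (1 + x) ^ #C := by
  have := Finset.sum_pow_mul_eq_add_pow x 1 C
  simpa [add_comm] using this

/-- The total weight of the trigger sets `Q` of a set `C`. -/
theorem sum_trigger_le {V : Type*} {n : ℕ} (hp : p ≤ 1 / 2) (ht0 : 0 ≤ t) (ht1 : t ≤ 1)
    (C : Finset V) (ht : 3 * (1 - p) ^ (n - #C) ≤ t ^ 4) :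
    ∑ Q ∈ C.powerset with #C ≤ 4 * #Q, (1 - p) ^ (#Q * (n - #C) - 1) ≤
      2 * (4 / 3 * t) ^ #C := by
  have hq : 1 / 2 ≤ 1 - p := by linarith
  -- Half of the idea is a Chernoff weight: a factor x^#Q is kept to sum over Q, and the rest is
  -- bounded using #C ≤ 4 · #Q. The resulting base is proportional to (1 + x)/x^{1/4}, which is
  -- minimal at x = 1/3. The factor 2 pays for the pair ab, since 1 − p ≥ 1/2.
  have hterm : ∀ Q ∈ C.powerset.filter (fun Q => #C ≤ 4 * #Q),
      (1 - p) ^ (#Q * (n - #C) - 1) ≤ 2 * t ^ #C * (1 / 3) ^ #Q := by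
    intro Q hQ
    have hQ' := (mem_filter.1 hQ).2
    have h1 : (1 - p) ^ (#Q * (n - #C) - 1) ≤ 2 * (1 - p) ^ (#Q * (n - #C)) := by
      rcases Nat.eq_zero_or_pos (#Q * (n - #C)) with h0 | h0
      · rw [h0]; norm_num
      · obtain ⟨j, hj⟩ := Nat.exists_eq_succ_of_ne_zero h0.ne'
        rw [hj, Nat.succ_sub_one, pow_succ]
        have : 0 ≤ (1 - p) ^ j := by positivity
        nlinarith
    have h2 : (1 - p) ^ (#Q * (n - #C)) ≤ (1 / 3) ^ #Q * t ^ #C := by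
      calc (1 - p) ^ (#Q * (n - #C)) = ((1 - p) ^ (n - #C)) ^ #Q := by
            rw [mul_comm, pow_mul]
        _ ≤ (1 / 3 * t ^ 4) ^ #Q := by
            apply pow_le_pow_left₀ (by positivity)
            linarith
        _ = (1 / 3) ^ #Q * t ^ (4 * #Q) := by rw [mul_pow, ← pow_mul]
        _ ≤ _ := mul_le_mul_of_nonneg_left (pow_le_pow_of_le_one ht0 ht1 hQ') (by positivity)
    calc _ ≤ _ := h1
      _ ≤ 2 * ((1 / 3) ^ #Q * t ^ #C) := by linarith
      _ = _ := by ring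
  calc _ ≤ ∑ Q ∈ C.powerset with #C ≤ 4 * #Q, 2 * t ^ #C * (1 / 3 : ℝ) ^ #Q := sum_le_sum hterm
    _ ≤ ∑ Q ∈ C.powerset, 2 * t ^ #C * (1 / 3 : ℝ) ^ #Q :=
        sum_le_sum_of_subset_of_nonneg (filter_subset _ _) fun _ _ _ => by positivity
    _ = 2 * (4 / 3 * t) ^ #C := by
        rw [← mul_sum, sum_pow_card_powerset, mul_pow]; norm_num; ring

open Classical in
/-- The probability that the peeling process produces a set of size close to `M`. -/
theorem bexp_exists_isPeeled_le {H : Finset (Sym2 V) → SimpleGraph V} (hH : IsEdgeModel H a b)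
    (hp0 : 0 ≤ p) (hp : p ≤ 1 / 2) (ht0 : 0 ≤ t) (ht1 : 20 * (4 / 3 * t) ≤ 1) {M : ℕ}
    (ht : 3 * (1 - p) ^ (Fintype.card V - M) ≤ t ^ 4) :
    bexp p (allEdges V) (fun s => if ∃ T Q, IsPeeled (H s) T Q ∧ M ≤ #T + 3 ∧ #T ≤ M
      then 1 else 0) ≤
      2 * ((20 * (4 / 3 * t)) ^ (M - 3) * (1 + 1 / 20) ^ Fintype.card V) := by
  have hq0 : 0 ≤ 1 - p := by linarith
  set 𝒯 : Finset (Finset V) := univ.filter fun T => M ≤ #T + 3 ∧ #T ≤ M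
  have h1 := bexp_le_sum hp0 (by linarith) (E := allEdges V)
    (f := fun s => if ∃ T Q, IsPeeled (H s) T Q ∧ M ≤ #T + 3 ∧ #T ≤ M then 1 else 0)
    (𝒯.sigma fun T => T.powerset.filter fun Q => #T ≤ 4 * #Q) (fun _ => ∅)
    (fun i => crossEdges a b i.1 i.2) (by simp)
    (fun i hi => crossEdges_subset (mem_powerset.1 (mem_filter.1 (mem_sigma.1 hi).2).1))
    (by simp) (fun s _ => by split_ifs <;> norm_num) (by
      intro s hs hpos
      have hex : ∃ T Q, IsPeeled (H s) T Q ∧ M ≤ #T + 3 ∧ #T ≤ M := by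
        by_contra hcon
        rw [if_neg hcon] at hpos
        exact lt_irrefl _ hpos
      obtain ⟨T, Q, hTQ, hM⟩ := hex
      refine ⟨⟨T, Q⟩, ?_, empty_subset _, hTQ.disjoint_crossEdges hH hs⟩
      simp only [mem_sigma, mem_filter, mem_powerset, 𝒯, mem_univ, true_and]
      exact ⟨hM, hTQ.subset, hTQ.card_le⟩)
  refine h1.trans ?_
  rw [sum_sigma]
  -- The weight (1/20)^#T is split off to control the number of sets T: summed over all subsets it
  -- gives (1 + 1/20)^n.
  have h2 : ∀ T ∈ 𝒯, ∑ Q ∈ T.powerset with #T ≤ 4 * #Q,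
      p ^ #(∅ : Finset (Sym2 V)) * (1 - p) ^ #(crossEdges a b T Q) ≤
        2 * (20 * (4 / 3 * t)) ^ (M - 3) * (1 / 20) ^ #T := by
    intro T hT
    obtain ⟨hT1, hT2⟩ := (mem_filter.1 hT).2
    have hQ : ∀ Q ∈ T.powerset.filter (fun Q => #T ≤ 4 * #Q),
        p ^ #(∅ : Finset (Sym2 V)) * (1 - p) ^ #(crossEdges a b T Q) ≤
          (1 - p) ^ (#Q * (Fintype.card V - #T) - 1) := by
      intro Q hQ
      rw [card_empty, pow_zero, one_mul]
      exact pow_le_pow_of_le_one hq0 (by linarith)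
        (card_crossEdges (mem_powerset.1 (mem_filter.1 hQ).1))
    refine (sum_le_sum hQ).trans ((sum_trigger_le hp ht0 (by linarith) T ?_).trans ?_)
    · refine le_trans ?_ ht
      exact mul_le_mul_of_nonneg_left (pow_le_pow_of_le_one hq0 (by linarith) (by omega))
        (by norm_num)
    · calc 2 * (4 / 3 * t) ^ #T = 2 * (20 * (4 / 3 * t)) ^ #T * (1 / 20) ^ #T := by
            rw [mul_assoc, ← mul_pow]; congr 2; ring
        _ ≤ _ := by
            gcongr 2 * ?_ * _
            exact pow_le_pow_of_le_one (by positivity) ht1 (by omega)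
  refine (sum_le_sum h2).trans ?_
  calc ∑ T ∈ 𝒯, 2 * (20 * (4 / 3 * t)) ^ (M - 3) * (1 / 20) ^ #T
      ≤ ∑ T ∈ (univ : Finset V).powerset, 2 * (20 * (4 / 3 * t)) ^ (M - 3) * (1 / 20) ^ #T :=
        sum_le_sum_of_subset_of_nonneg (by rw [powerset_univ]; exact filter_subset _ _)
          fun _ _ _ => by positivity
    _ = _ := by rw [← mul_sum, sum_pow_card_powerset, card_univ]; ring

end Peeled

/-! ### Union bound for the component of a given vertex -/

section Component

variable {V : Type*} [Fintype V] [DecidableEq V] {a b : V} {p t : ℝ} {C Q : Finset V}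

/-- The vertices of `C` other than `a` and `b`. -/
def nonRoots (a b : V) (C : Finset V) : Finset V := (C.erase a).erase b

theorem mem_nonRoots {V : Type*} [DecidableEq V] {a b : V} {C : Finset V} {x : V} :
    x ∈ nonRoots a b C ↔ x ≠ b ∧ x ≠ a ∧ x ∈ C := by
  simp [nonRoots]

/-- The edges from the vertices other than `a` and `b` to their parents. -/
def parentEdges (a b : V) (C : Finset V) (f : V → V) : Finset (Sym2 V) :=
  (nonRoots a b C).image fun x => s(x, f x)

/-- Parent functions on `C`. -/
def parentFunctions (a b : V) (C : Finset V) : Finset (V → V) :=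
  (Fintype.piFinset fun x => if x ∈ nonRoots a b C then C else {x}).filter fun f =>
    (∀ x ∈ nonRoots a b C, f x ≠ x) ∧ Set.InjOn (fun x => s(x, f x)) (nonRoots a b C)

theorem card_parentFunctions_le : #(parentFunctions a b C) ≤ #C ^ #(nonRoots a b C) := by
  refine (card_filter_le _ _).trans (le_of_eq ?_)
  rw [Fintype.card_piFinset]
  have : ∀ x : V, #(if x ∈ nonRoots a b C then C else {x}) =
      if x ∈ nonRoots a b C then #C else 1 := fun x => by split_ifs <;> simp
  simp only [this]
  rw [prod_ite_mem, univ_inter, prod_const]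

theorem parentFunctions_maps {f : V → V} (hf : f ∈ parentFunctions a b C) {x : V}
    (hx : x ∈ nonRoots a b C) : f x ∈ C := by
  have := Fintype.mem_piFinset.1 (mem_filter.1 hf).1 x
  rwa [if_pos hx] at this

theorem parentEdges_subset {f : V → V} (hf : f ∈ parentFunctions a b C) :
    parentEdges a b C f ⊆ allEdges V := by
  intro e he
  obtain ⟨x, hx, rfl⟩ := mem_image.1 he
  rw [mem_allEdges, Sym2.mk_isDiag_iff]
  exact fun h => (mem_filter.1 hf).2.1 x hx h.symm

theorem card_parentEdges {f : V → V} (hf : f ∈ parentFunctions a b C) :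
    #(parentEdges a b C f) = #(nonRoots a b C) :=
  card_image_of_injOn (mem_filter.1 hf).2.2

theorem disjoint_parentEdges_crossEdges {f : V → V} (hf : f ∈ parentFunctions a b C) :
    Disjoint (parentEdges a b C f) (crossEdges a b C Q) := by
  rw [Finset.disjoint_left]
  intro e he he'
  obtain ⟨x, hx, rfl⟩ := mem_image.1 he
  obtain ⟨_, u, _, w, hw, huw⟩ := mem_crossEdges.1 he'
  rcases Sym2.eq_iff.1 huw with ⟨rfl, rfl⟩ | ⟨rfl, rfl⟩
  · exact hw (parentFunctions_maps hf hx)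
  · exact hw (mem_nonRoots.1 hx).2.2

/-- Take a neighbour closer to a as parent. Depth decreases strictly, so no edge is used from both
ends. The roots a and b get no parent edge, so the pair ab, whose status is not random, is never
used. -/
theorem exists_parentFunction {H : Finset (Sym2 V) → SimpleGraph V} (hH : IsEdgeModel H a b)
    {s : Finset (Sym2 V)} (hs : s ⊆ allEdges V) (hC : outerComp (H s) a = C) :
    ∃ f ∈ parentFunctions a b C, parentEdges a b C f ⊆ s := by
  obtain ⟨d, hd⟩ := exists_depth (H s) (sapphire (H s))ᶜ a
  have hmem : ∀ x, x ∈ compIn (H s) (sapphire (H s))ᶜ a ↔ x ∈ C := fun x => by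
    rw [← mem_coe, ← hC]; rfl
  simp only [hmem] at hd
  have hd' : ∀ x, ∃ y, (x ∈ nonRoots a b C → y ∈ C ∧ (H s).Adj x y ∧ d y < d x) ∧
      (x ∉ nonRoots a b C → y = x) := by
    intro x
    by_cases hx : x ∈ nonRoots a b C
    · obtain ⟨y, hy⟩ := hd x (mem_nonRoots.1 hx).2.2 (mem_nonRoots.1 hx).2.1
      exact ⟨y, fun _ => hy, fun h => absurd hx h⟩
    · exact ⟨x, fun h => absurd h hx, fun _ => rfl⟩
  choose f hf hf' using hd'
  refine ⟨f, mem_filter.2 ⟨Fintype.mem_piFinset.2 fun x => ?_,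
    fun x hx => (hf x hx).2.1.ne', ?_⟩, ?_⟩
  · split_ifs with hx
    · exact (hf x hx).1
    · rw [hf' x hx]; exact mem_singleton_self _
  · intro x hx y hy hxy
    rcases Sym2.eq_iff.1 hxy with ⟨h, -⟩ | ⟨h1, h2⟩
    · exact h
    · have e1 := (hf x hx).2.2
      have e2 := (hf y hy).2.2
      rw [h2] at e1
      rw [← h1] at e2
      exact absurd e1 (lt_asymm e2)
  · intro e he
    obtain ⟨x, hx, rfl⟩ := mem_image.1 he
    exact hH.mem_of_adj s hs x (f x) (mem_nonRoots.1 hx).2.1 (mem_nonRoots.1 hx).1 (hf x hx).2.1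

open Classical in
/-- The probability that `C` is the component of `a`. -/
theorem bexp_outerComp_eq_le {H : Finset (Sym2 V) → SimpleGraph V} (hH : IsEdgeModel H a b)
    (hp0 : 0 ≤ p) (hp : p ≤ 1 / 2) (ht0 : 0 ≤ t) (ht1 : t ≤ 1)
    (ht : 3 * (1 - p) ^ (Fintype.card V - #C) ≤ t ^ 4) :
    bexp p (allEdges V) (fun s => if outerComp (H s) a = C then 1 else 0) ≤
      (#C * p) ^ #(nonRoots a b C) * (2 * (4 / 3 * t) ^ #C) := by
  have hq0 : 0 ≤ 1 - p := by linarith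
  have h1 := bexp_le_sum hp0 (by linarith) (E := allEdges V)
    (f := fun s => if outerComp (H s) a = C then 1 else 0)
    ((C.powerset.filter fun Q => #C ≤ 4 * #Q) ×ˢ parentFunctions a b C)
    (fun i => parentEdges a b C i.2) (fun i => crossEdges a b C i.1)
    (fun i hi => parentEdges_subset (mem_product.1 hi).2)
    (fun i hi => crossEdges_subset (mem_powerset.1 (mem_filter.1 (mem_product.1 hi).1).1))
    (fun i hi => disjoint_parentEdges_crossEdges (mem_product.1 hi).2)
    (fun s _ => by split_ifs <;> norm_num) (by
      intro s hs hpos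
      have hC : outerComp (H s) a = C := by
        by_contra hcon
        rw [if_neg hcon] at hpos
        exact lt_irrefl _ hpos
      obtain ⟨Q, hQ⟩ := exists_isPeeled_outerComp hC.symm
      obtain ⟨f, hf, hfs⟩ := exists_parentFunction hH hs hC
      exact ⟨⟨Q, f⟩, mem_product.2 ⟨mem_filter.2 ⟨mem_powerset.2 hQ.subset, hQ.card_le⟩, hf⟩,
        hfs, hQ.disjoint_crossEdges hH hs⟩)
  refine h1.trans ?_
  rw [sum_product]
  have h2 : ∀ Q ∈ C.powerset.filter (fun Q => #C ≤ 4 * #Q), ∑ f ∈ parentFunctions a b C,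
      p ^ #(parentEdges a b C f) * (1 - p) ^ #(crossEdges a b C Q) ≤
        (#C * p) ^ #(nonRoots a b C) * (1 - p) ^ (#Q * (Fintype.card V - #C) - 1) := by
    intro Q hQ
    have hQC := mem_powerset.1 (mem_filter.1 hQ).1
    have h3 : ∀ f ∈ parentFunctions a b C,
        p ^ #(parentEdges a b C f) * (1 - p) ^ #(crossEdges a b C Q) ≤
          p ^ #(nonRoots a b C) * (1 - p) ^ (#Q * (Fintype.card V - #C) - 1) := by
      intro f hf
      rw [card_parentEdges hf]
      exact mul_le_mul_of_nonneg_left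
        (pow_le_pow_of_le_one hq0 (by linarith) (card_crossEdges hQC)) (by positivity)
    refine (sum_le_card_nsmul _ _ _ h3).trans ?_
    rw [nsmul_eq_mul, mul_pow, mul_assoc]
    refine mul_le_mul_of_nonneg_right ?_ (by positivity)
    exact_mod_cast card_parentFunctions_le
  refine (sum_le_sum h2).trans ?_
  rw [← mul_sum]
  exact mul_le_mul_of_nonneg_left (sum_trigger_le hp ht0 ht1 C ht) (by positivity)

theorem pow_div_factorial_le (m j : ℕ) : (m : ℝ) ^ j / (j.factorial : ℝ) ≤ Real.exp m :=
  Real.pow_div_factorial_le_exp _ (by positivity) j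

theorem card_le_of_injOn_powersetCard {V : Type*} [Fintype V] {𝒞 : Finset (Finset V)}
    {g : Finset V → Finset V} {j : ℕ}
    (hg : ∀ C ∈ 𝒞, #(g C) = j) (hinj : Set.InjOn g 𝒞) :
    (#𝒞 : ℝ) ≤ (Fintype.card V : ℝ) ^ j / (j.factorial : ℝ) := by
  have h : #𝒞 ≤ (Fintype.card V).choose j := by
    rw [← card_univ, ← card_powersetCard]
    exact card_le_card_of_injOn g (fun C hC => by simp [mem_powersetCard, hg C hC]) hinj
  exact (by exact_mod_cast h : (#𝒞 : ℝ) ≤ ((Fintype.card V).choose j : ℝ)).trans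
    (Nat.choose_le_pow_div j _)

/-- The total weight of the possible components of size `m`. -/
theorem sum_nonRoots_le (hab : a ≠ b) {c : ℝ} (hc : 1 ≤ c) (hV : 0 < Fintype.card V)
    (hp : p = c / Fintype.card V) (m : ℕ) :
    ∑ C : Finset V with a ∈ C ∧ #C = m, ((#C : ℝ) * p) ^ #(nonRoots a b C) ≤
      2 * Real.exp m * c ^ (m - 1) := by
  have hn : (0 : ℝ) < Fintype.card V := by exact_mod_cast hV
  -- With j non-root vertices there are at most n^j / j! choices; n^j cancels against p^j, and m^j /
  -- j! ≤ e^m. Sets with and without b have m − 2 and m − 1 non-roots and are treated separately,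
  -- whence the factor 2.
  have hbound : ∀ j : ℕ, j ≤ m - 1 → (Fintype.card V : ℝ) ^ j / (j.factorial : ℝ) * (m * p) ^ j ≤
      Real.exp m * c ^ (m - 1) := by
    intro j hj
    have : (Fintype.card V : ℝ) ^ j / (j.factorial : ℝ) * (m * p) ^ j =
        (m : ℝ) ^ j / (j.factorial : ℝ) * c ^ j := by
      rw [hp, mul_pow, div_pow]; field_simp
    rw [this]
    exact mul_le_mul (pow_div_factorial_le m j) (pow_le_pow_right₀ hc hj) (by positivity)
      (by positivity)
  set 𝒞 := univ.filter fun C : Finset V => a ∈ C ∧ #C = m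
  rw [← sum_filter_add_sum_filter_not 𝒞 (fun C => b ∈ C)]
  have h1 : ∑ C ∈ 𝒞 with b ∈ C, ((#C : ℝ) * p) ^ #(nonRoots a b C) ≤
      Real.exp m * c ^ (m - 1) := by
    have hcard : ∀ C ∈ 𝒞.filter (fun C => b ∈ C), #(nonRoots a b C) = m - 2 := by
      intro C hC
      simp only [𝒞, mem_filter, mem_univ, true_and] at hC
      rw [nonRoots, card_erase_of_mem (mem_erase.2 ⟨hab.symm, hC.2⟩), card_erase_of_mem hC.1.1,
        hC.1.2]
      omega
    rw [sum_congr rfl fun C hC => by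
      rw [hcard C hC, (mem_filter.1 (mem_filter.1 hC).1).2.2], sum_const, nsmul_eq_mul]
    refine le_trans ?_ (hbound (m - 2) (by omega))
    refine mul_le_mul_of_nonneg_right (card_le_of_injOn_powersetCard hcard ?_)
      (by rw [hp]; positivity)
    intro C hC C' hC' h
    simp only [𝒞, coe_filter, mem_filter, mem_univ, true_and, Set.mem_ofPred_eq] at hC hC'
    simp only [nonRoots] at h
    rw [← insert_erase hC.1.1, ← insert_erase hC'.1.1,
      ← insert_erase (mem_erase.2 ⟨hab.symm, hC.2⟩),
      ← insert_erase (mem_erase.2 ⟨hab.symm, hC'.2⟩), h]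
  have h2 : ∑ C ∈ 𝒞 with b ∉ C, ((#C : ℝ) * p) ^ #(nonRoots a b C) ≤
      Real.exp m * c ^ (m - 1) := by
    have hnr : ∀ C ∈ 𝒞.filter (fun C => b ∉ C), nonRoots a b C = C.erase a := by
      intro C hC
      exact erase_eq_of_notMem fun h => (mem_filter.1 hC).2 (mem_of_mem_erase h)
    have hcard : ∀ C ∈ 𝒞.filter (fun C => b ∉ C), #(nonRoots a b C) = m - 1 := by
      intro C hC
      rw [hnr C hC]
      simp only [𝒞, mem_filter, mem_univ, true_and] at hC
      rw [card_erase_of_mem hC.1.1, hC.1.2]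
    rw [sum_congr rfl fun C hC => by
      rw [hcard C hC, (mem_filter.1 (mem_filter.1 hC).1).2.2], sum_const, nsmul_eq_mul]
    refine le_trans ?_ (hbound (m - 1) le_rfl)
    refine mul_le_mul_of_nonneg_right (card_le_of_injOn_powersetCard hcard ?_)
      (by rw [hp]; positivity)
    intro C hC C' hC' h
    rw [hnr C hC, hnr C' hC'] at h
    simp only [𝒞, coe_filter, mem_filter, mem_univ, true_and, Set.mem_ofPred_eq] at hC hC'
    rw [← insert_erase hC.1.1, ← insert_erase hC'.1.1, h]
  linarith

open Classical in
/-- The probability that the component of `a` has size `m`. -/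
theorem bexp_ncard_outerComp_eq_le {H : Finset (Sym2 V) → SimpleGraph V}
    (hH : IsEdgeModel H a b) (hab : a ≠ b) {c : ℝ} (hc : 1 ≤ c) (hV : 0 < Fintype.card V)
    (hpc : p = c / Fintype.card V) (hp : p ≤ 1 / 2) (ht0 : 0 ≤ t) (ht1 : t ≤ 1) {m : ℕ}
    (hm : 0 < m) (ht : 3 * (1 - p) ^ (Fintype.card V - m) ≤ t ^ 4) :
    bexp p (allEdges V) (fun s => if (outerComp (H s) a).ncard = m then 1 else 0) ≤
      4 / c * (Real.exp 1 * c * (4 / 3 * t)) ^ m := by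
  have hp0 : 0 ≤ p := by rw [hpc]; positivity
  calc bexp p (allEdges V) (fun s => if (outerComp (H s) a).ncard = m then 1 else 0)
      ≤ bexp p (allEdges V) (fun s => ∑ C : Finset V with a ∈ C ∧ #C = m,
          if outerComp (H s) a = C then 1 else 0) := by
        refine bexp_mono hp0 (by linarith) fun s _ => ?_
        have hnn : ∀ C ∈ univ.filter (fun C : Finset V => a ∈ C ∧ #C = m),
            (0 : ℝ) ≤ if outerComp (H s) a = C then 1 else 0 := fun C _ => by
          split_ifs <;> norm_num
        split_ifs with h
        · set C := (outerComp (H s) a).toFinset with hC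
          have hCe : outerComp (H s) a = C := by simp [hC]
          -- The component is empty when a lies in the core, so m > 0 is needed here.
          have ha : a ∈ C := by
            rw [← mem_coe, ← hCe]
            have hne : (outerComp (H s) a).Nonempty := by
              rw [← Set.ncard_pos, h]; exact hm
            obtain ⟨x, hx⟩ := hne
            exact mem_compIn_self (mem_of_mem_compIn hx)
          have hcard : #C = m := by rw [← h, hCe, Set.ncard_coe_finset]
          refine le_trans ?_ (single_le_sum hnn (mem_filter.2 ⟨mem_univ C, ha, hcard⟩))
          rw [if_pos hCe]
        · exact sum_nonneg hnn
    _ ≤ ∑ C : Finset V with a ∈ C ∧ #C = m,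
          ((#C : ℝ) * p) ^ #(nonRoots a b C) * (2 * (4 / 3 * t) ^ m) := by
        rw [bexp_sum]
        refine sum_le_sum fun C hC => ?_
        have hCm : #C = m := (mem_filter.1 hC).2.2
        have := bexp_outerComp_eq_le (C := C) hH hp0 hp ht0 ht1 (by rwa [hCm])
        rwa [hCm] at this ⊢
    _ ≤ 2 * Real.exp m * c ^ (m - 1) * (2 * (4 / 3 * t) ^ m) := by
        rw [← sum_mul]
        exact mul_le_mul_of_nonneg_right (sum_nonRoots_le hab hc hV hpc m) (by positivity)
    _ = _ := by
        obtain ⟨j, rfl⟩ := Nat.exists_eq_succ_of_ne_zero hm.ne'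
        have he : Real.exp 1 ^ (j + 1) = Real.exp ((j + 1 : ℕ) : ℝ) := by
          rw [← Real.exp_nat_mul, mul_one]
        rw [Nat.succ_eq_add_one, Nat.add_sub_cancel, mul_pow (_ * c), mul_pow (Real.exp 1), he,
          pow_succ c j]
        field_simp
        ring

end Component

end StrongCore

/-! ### The variance bound for fixed `n` -/

namespace StrongCore

open Finset BernoulliSubset

/-! ### Numerical decay rates for c ≥ 20 -/

section Rates

/-- The weight per vertex of a trigger set, for sets of size at most `δ n`. -/
noncomputable def triggerRate (c δ : ℝ) : ℝ := 1.317 * Real.exp (-(c * (1 - δ) / 4))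

theorem triggerRate_nonneg (c δ : ℝ) : 0 ≤ triggerRate c δ := by
  unfold triggerRate; positivity

/-- This supplies the hypothesis on t in the weight estimates. The constant 1.317 is slightly above
3^{1/4}. -/
theorem three_mul_pow_le {c δ p : ℝ} {n m : ℕ} (hn : 0 < n) (hc : 0 ≤ c) (hp : p = c / n)
    (hp1 : p ≤ 1) (hm : (m : ℝ) ≤ δ * n) (hmn : m ≤ n) :
    3 * (1 - p) ^ (n - m) ≤ triggerRate c δ ^ 4 := by
  have hn' : (0 : ℝ) < n := by exact_mod_cast hn
  have h1 : (1 - p) ^ (n - m) ≤ Real.exp (-(c * (1 - δ))) := by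
    calc (1 - p) ^ (n - m) ≤ Real.exp (-p) ^ (n - m) :=
          pow_le_pow_left₀ (by linarith) (Real.one_sub_le_exp_neg p) _
      _ = Real.exp (-(p * (n - m))) := by
          rw [← Real.exp_nat_mul, Nat.cast_sub hmn]; congr 1; ring
      _ ≤ _ := by
          apply Real.exp_le_exp.2
          have : c * (1 - δ) ≤ p * (n - m) := by
            rw [hp]
            calc c * (1 - δ) = c / n * (n - δ * n) := by field_simp
              _ ≤ _ := by gcongr
          linarith
  have h2 : triggerRate c δ ^ 4 = 1.317 ^ 4 * Real.exp (-(c * (1 - δ))) := by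
    rw [triggerRate, mul_pow, ← Real.exp_nat_mul]
    congr 2
    push_cast; ring
  rw [h2]
  have h3 := Real.exp_pos (-(c * (1 - δ)))
  nlinarith

/-- The left side decreases in c in this range, so c = 20 is the worst case. -/
theorem mul_exp_le {c δ : ℝ} (hc : 20 ≤ c) (hδ : δ ≤ 1 / 20) :
    c * Real.exp (-(c * (1 - δ) / 4)) ≤ 20 * Real.exp (-(5 * (1 - δ))) := by
  have h1 : c / 20 ≤ Real.exp ((c - 20) * (1 - δ) / 4) := by
    have h2 : (c / 20 - 1) + 1 ≤ Real.exp (c / 20 - 1) := Real.add_one_le_exp _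
    have h3 : Real.exp (c / 20 - 1) ≤ Real.exp ((c - 20) * (1 - δ) / 4) := by
      apply Real.exp_le_exp.2
      nlinarith
    linarith
  have h4 : Real.exp (-(5 * (1 - δ))) =
      Real.exp ((c - 20) * (1 - δ) / 4) * Real.exp (-(c * (1 - δ) / 4)) := by
    rw [← Real.exp_add]; congr 1; ring
  rw [h4]
  have h5 := Real.exp_pos (-(c * (1 - δ) / 4))
  nlinarith

/-- Here 35.12 = 20 · (4/3) · 1.317, and the exponentials at c = 20 combine to exp(−(4 − 5δ)). -/
theorem rate_le {c δ x r : ℝ} (hc : 20 ≤ c) (hδ : δ ≤ 1 / 20) (hx : x ≤ 4 - 5 * δ)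
    (hr : 35.12 ≤ r * Real.exp x) :
    Real.exp 1 * c * (4 / 3 * triggerRate c δ) ≤ r := by
  have h1 := mul_exp_le hc hδ
  have hr0 : 0 ≤ r := by
    by_contra h
    have := Real.exp_pos x
    nlinarith
  have h2 : Real.exp 1 * c * (4 / 3 * triggerRate c δ) ≤ 35.12 * Real.exp (-(4 - 5 * δ)) := by
    have : Real.exp (-(4 - 5 * δ)) = Real.exp 1 * Real.exp (-(5 * (1 - δ))) := by
      rw [← Real.exp_add]; congr 1; ring
    rw [this, triggerRate]
    have := mul_le_mul_of_nonneg_left h1 (Real.exp_pos 1).le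
    nlinarith
  calc _ ≤ _ := h2
    _ ≤ r * Real.exp x * Real.exp (-(4 - 5 * δ)) :=
        mul_le_mul_of_nonneg_right hr (Real.exp_pos _).le
    _ = r * Real.exp (x - (4 - 5 * δ)) := by rw [mul_assoc, ← Real.exp_add]; congr 2
    _ ≤ r * 1 := mul_le_mul_of_nonneg_left (Real.exp_le_one_iff.2 (by linarith)) hr0
    _ = r := mul_one r

theorem rate_small {c : ℝ} (hc : 20 ≤ c) :
    Real.exp 1 * c * (4 / 3 * triggerRate c (1 / 100)) ≤ 0.69 := by
  refine rate_le hc (by norm_num) (x := 3.95) (by norm_num) ?_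
  have h1 : Real.exp 3.95 = Real.exp 1 ^ 4 * Real.exp (-0.05) := by
    rw [← Real.exp_nat_mul, ← Real.exp_add]; norm_num
  have h2 : (0.95 : ℝ) ≤ Real.exp (-0.05) := by
    have := Real.add_one_le_exp (-0.05 : ℝ); linarith
  have h3 : (2.718 : ℝ) ^ 4 ≤ Real.exp 1 ^ 4 :=
    pow_le_pow_left₀ (by norm_num) (by linarith [Real.exp_one_gt_d9]) 4
  rw [h1]
  have h4 := mul_le_mul h3 h2 (by norm_num) (by positivity)
  norm_num at h4 ⊢
  linarith

theorem rate_mid {c : ℝ} (hc : 20 ≤ c) :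
    Real.exp 1 * c * (4 / 3 * triggerRate c (1 / 20)) ≤ 0.83 := by
  refine rate_le hc (by norm_num) (x := 3.75) (by norm_num) ?_
  have h1 : Real.exp 3.75 ^ 4 = Real.exp 1 ^ 15 := by
    rw [← Real.exp_nat_mul, ← Real.exp_nat_mul]; norm_num
  have h3 : (2.718 : ℝ) ^ 15 ≤ Real.exp 1 ^ 15 :=
    pow_le_pow_left₀ (by norm_num) (by linarith [Real.exp_one_gt_d9]) 15
  have h4 : (42.4 : ℝ) ≤ Real.exp 3.75 := by
    refine le_of_pow_le_pow_left₀ (n := 4) (by norm_num) (Real.exp_pos _).le ?_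
    rw [h1]
    refine le_trans ?_ h3
    norm_num
  linarith

theorem triggerRate_le_one {c δ : ℝ} (hc : 20 ≤ c) (hδ : δ ≤ 1 / 20) : triggerRate c δ ≤ 1 := by
  have h1 : (1.317 : ℝ) ≤ Real.exp (c * (1 - δ) / 4) := by
    have := Real.add_one_le_exp (c * (1 - δ) / 4)
    nlinarith
  rw [triggerRate, Real.exp_neg, ← div_eq_mul_inv]
  exact div_le_one_of_le₀ h1 (Real.exp_pos _).le

/-- This is `rate_mid` with c lowered to 20. The factor 1/e is what later cancels the entropy (1 +
1/20)^n ≤ e^{n/20}. -/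
theorem twenty_mul_triggerRate_le {c : ℝ} (hc : 20 ≤ c) :
    20 * (4 / 3 * triggerRate c (1 / 20)) ≤ 0.83 / Real.exp 1 := by
  rw [le_div_iff₀ (Real.exp_pos 1)]
  refine le_trans ?_ (rate_mid hc)
  have h1 := triggerRate_nonneg c (1 / 20)
  have h2 := Real.exp_pos 1
  have h3 := mul_nonneg h1 h2.le
  nlinarith

end Rates

/-! ### Expectations for fixed n and the variance bound -/

section Expectations

variable {V : Type*} [Fintype V] [DecidableEq V] {a b : V} {p c : ℝ} {k : ℕ}

/-- The bound for the expectation of `largeSq` in a random graph on `n` vertices. -/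
noncomputable def largeSqBound (k : ℕ) (c : ℝ) (n : ℕ) : ℝ :=
  4 / c * (∑ m ∈ Ico (k - 1) (n / 20), (m : ℝ) ^ 2 * 0.69 ^ m +
    ∑ m ∈ Ico (n / 100) (n / 20), (m : ℝ) ^ 2 * 0.83 ^ m) +
  (n : ℝ) ^ 2 * (2 * ((0.83 / Real.exp 1) ^ (n / 20 - 3) * (1 + 1 / 20) ^ n))

-- If no peeled set of size about M exists, the whole complement of the core has fewer than M
-- vertices, and so has the component. Otherwise its size is bounded trivially by n.
open Classical in
theorem largeSq_le_sum (G : SimpleGraph V) (v : V) (M : ℕ) :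
    largeSq k G v ≤ ∑ m ∈ Ico (k - 1) M, (m : ℝ) ^ 2 * (if (outerComp G v).ncard = m then 1 else 0)
      + (Fintype.card V : ℝ) ^ 2 *
        (if ∃ T Q, IsPeeled G T Q ∧ M ≤ #T + 3 ∧ #T ≤ M then 1 else 0) := by
  have hnn : ∀ m ∈ Ico (k - 1) M,
      (0 : ℝ) ≤ (m : ℝ) ^ 2 * (if (outerComp G v).ncard = m then 1 else 0) := fun m _ => by
    split_ifs <;> positivity
  have hle : ((outerComp G v).ncard : ℝ) ≤ Fintype.card V := by
    have := Set.ncard_le_ncard (Set.subset_univ (outerComp G v))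
    rw [Set.ncard_univ, Nat.card_eq_fintype_card] at this
    exact_mod_cast this
  unfold largeSq
  rcases exists_isPeeled_or G M with h | h
  · rw [if_pos h, mul_one]
    have hs := sum_nonneg hnn
    split_ifs
    · have : ((outerComp G v).ncard : ℝ) ^ 2 ≤ (Fintype.card V : ℝ) ^ 2 :=
        pow_le_pow_left₀ (by positivity) hle 2
      linarith
    · positivity
  · have h2 : (0 : ℝ) ≤ (Fintype.card V : ℝ) ^ 2 *
        (if ∃ T Q, IsPeeled G T Q ∧ M ≤ #T + 3 ∧ #T ≤ M then 1 else 0) := by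
      split_ifs <;> positivity
    by_cases hk : k ≤ (outerComp G v).ncard + 1
    · rw [if_pos hk]
      have hM : (outerComp G v).ncard < M :=
        (Set.ncard_le_ncard compIn_subset).trans_lt (by omega)
      have := single_le_sum hnn (mem_Ico.2 ⟨by omega, hM⟩ :
        (outerComp G v).ncard ∈ Ico (k - 1) M)
      rw [if_pos rfl, mul_one] at this
      exact this.trans (le_add_of_nonneg_right h2)
    · rw [if_neg hk]
      exact add_nonneg (sum_nonneg hnn) h2

theorem bexp_largeSq_le {H : Finset (Sym2 V) → SimpleGraph V} (hH : IsEdgeModel H a b)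
    (hab : a ≠ b) (hk : 2 ≤ k) (hc : 20 ≤ c) (hV : 0 < Fintype.card V)
    (hpc : p = c / Fintype.card V) (hp : p ≤ 1 / 2) :
    bexp p (allEdges V) (fun s => largeSq k (H s) a) ≤ largeSqBound k c (Fintype.card V) := by
  classical
  have hp0 : 0 ≤ p := by rw [hpc]; positivity
  have hc0 : 0 < c := by linarith
  set n := Fintype.card V with hn
  have hM : ((n / 20 : ℕ) : ℝ) ≤ 1 / 20 * n := by
    have : ((n / 20 : ℕ) : ℝ) ≤ (n : ℝ) / (20 : ℕ) := Nat.cast_div_le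
    push_cast at this
    linarith
  refine (bexp_mono hp0 (by linarith) fun s _ => largeSq_le_sum (H s) a (n / 20)).trans ?_
  rw [bexp_add, bexp_sum, bexp_const_mul]
  refine add_le_add ?_ (mul_le_mul_of_nonneg_left ?_ (by positivity))
  · simp only [bexp_const_mul]
    -- The sharp rate 0.69 needs 1 − m/n close to 1 and is used for m ≤ n/100. For larger m the rate
    -- 0.83 suffices, since only a vanishing tail is summed.
    have hterm : ∀ m ∈ Ico (k - 1) (n / 20), (m : ℝ) ^ 2 * bexp p (allEdges V)
        (fun s => if (outerComp (H s) a).ncard = m then 1 else 0) ≤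
        4 / c * ((m : ℝ) ^ 2 * 0.69 ^ m + if n / 100 ≤ m then (m : ℝ) ^ 2 * 0.83 ^ m else 0) := by
      intro m hm
      obtain ⟨hm1, hm2⟩ := mem_Ico.1 hm
      have key : ∀ δ r : ℝ, δ ≤ 1 / 20 → (m : ℝ) ≤ δ * n →
          Real.exp 1 * c * (4 / 3 * triggerRate c δ) ≤ r →
          bexp p (allEdges V) (fun s => if (outerComp (H s) a).ncard = m then 1 else 0) ≤
            4 / c * r ^ m := by
        intro δ r hδ hmδ hr
        refine (bexp_ncard_outerComp_eq_le hH hab (by linarith) hV hpc hp (triggerRate_nonneg c δ)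
          (triggerRate_le_one hc hδ) (by omega)
          (three_mul_pow_le hV hc0.le hpc (by linarith) hmδ (by omega))).trans ?_
        have := triggerRate_nonneg c δ
        gcongr
      by_cases h100 : 100 * m ≤ n
      · have h1 := key (1 / 100) 0.69 (by norm_num) (by
          have : (100 * m : ℝ) ≤ n := by exact_mod_cast h100
          linarith) (rate_small hc)
        have h2 : (0 : ℝ) ≤ if n / 100 ≤ m then (m : ℝ) ^ 2 * 0.83 ^ m else 0 := by
          split_ifs <;> positivity
        calc _ ≤ (m : ℝ) ^ 2 * (4 / c * 0.69 ^ m) := by gcongr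
          _ = 4 / c * ((m : ℝ) ^ 2 * 0.69 ^ m + 0) := by ring
          _ ≤ _ := by gcongr
      · rw [if_pos (by omega)]
        have h1 := key (1 / 20) 0.83 le_rfl (by
          have : (m : ℝ) ≤ (n / 20 : ℕ) := by exact_mod_cast hm2.le
          linarith) (rate_mid hc)
        have h2 : (0 : ℝ) ≤ (m : ℝ) ^ 2 * 0.69 ^ m := by positivity
        calc _ ≤ (m : ℝ) ^ 2 * (4 / c * 0.83 ^ m) := by gcongr
          _ = 4 / c * (0 + (m : ℝ) ^ 2 * 0.83 ^ m) := by ring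
          _ ≤ _ := by gcongr
    refine (sum_le_sum hterm).trans ?_
    rw [← mul_sum, sum_add_distrib]
    gcongr
    rw [← sum_filter]
    refine sum_le_sum_of_subset_of_nonneg (fun m hm => ?_) fun _ _ _ => by positivity
    rw [mem_filter, mem_Ico] at hm
    exact mem_Ico.2 ⟨hm.2, hm.1.2⟩
  · have h20 := twenty_mul_triggerRate_le hc
    have ht := triggerRate_nonneg c (1 / 20)
    have hexp : (0.83 : ℝ) / Real.exp 1 ≤ 1 :=
      div_le_one_of_le₀ (by linarith [Real.exp_one_gt_d9]) (Real.exp_pos 1).le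
    refine (bexp_exists_isPeeled_le hH hp0 hp ht (h20.trans hexp)
      (three_mul_pow_le hV hc0.le hpc (by linarith) hM (by omega))).trans ?_
    gcongr

open Classical in
/-- The probability that some degree exceeds `D`. -/
theorem bexp_exists_degree_le (hc : 0 ≤ c) (hV : 0 < Fintype.card V)
    (hpc : p = c / Fintype.card V) (hp : p ≤ 1) (D : ℕ) :
    bexp p (allEdges V) (fun s => if ∀ x, ((ofEdges s).neighborSet x).ncard ≤ D then 0 else 1) ≤
      Fintype.card V * (c ^ (D + 1) / ((D + 1).factorial : ℝ)) := by
  have hp0 : 0 ≤ p := by rw [hpc]; positivity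
  have hn : (0 : ℝ) < Fintype.card V := by exact_mod_cast hV
  have hinj : ∀ (x : V) (W : Finset V), Set.InjOn (fun y => s(x, y)) (W : Set V) := by
    intro x W y _ z _ h
    rcases Sym2.eq_iff.1 h with ⟨_, h⟩ | ⟨h1, h2⟩
    · exact h
    · exact h2.trans h1
  set I : Finset (V × Finset V) :=
    (univ ×ˢ powersetCard (D + 1) univ).filter fun z => z.1 ∉ z.2
  have hI : ∀ z ∈ I, z.1 ∉ z.2 ∧ #z.2 = D + 1 := fun z hz =>
    ⟨(mem_filter.1 hz).2, (mem_powersetCard.1 (mem_product.1 (mem_filter.1 hz).1).2).2⟩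
  have h1 := bexp_le_sum hp0 hp (E := allEdges V)
    (f := fun s => if ∀ x, ((ofEdges s).neighborSet x).ncard ≤ D then 0 else 1) I
    (fun z => z.2.image fun y => s(z.1, y)) (fun _ => ∅) (by
      intro z hz e he
      obtain ⟨y, hy, rfl⟩ := mem_image.1 he
      rw [mem_allEdges, Sym2.mk_isDiag_iff]
      intro h
      exact (hI z hz).1 (h ▸ hy)) (by simp) (by simp)
    (fun s _ => by split_ifs <;> norm_num) (by
      intro s hs hpos
      have hex : ∃ x, D < ((ofEdges s).neighborSet x).ncard := by
        by_contra! hcon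
        rw [if_pos hcon] at hpos
        exact lt_irrefl _ hpos
      obtain ⟨x, hx⟩ := hex
      obtain ⟨W, hWs, hW⟩ := Set.exists_subset_card_eq (show D + 1 ≤ _ from hx)
      refine ⟨(x, W.toFinset), ?_, ?_, by simp⟩
      · simp only [I, mem_filter, mem_product, mem_univ, true_and, mem_powersetCard, subset_univ,
          Set.mem_toFinset]
        exact ⟨by rw [← Set.ncard_eq_toFinset_card', hW],
          fun h => (ofEdges s).loopless.irrefl x (hWs h)⟩
      · intro e he
        obtain ⟨y, hy, rfl⟩ := mem_image.1 he
        exact (ofEdges_adj.1 (hWs (Set.mem_toFinset.1 hy))).1)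
  refine h1.trans ?_
  have h2 : ∀ z ∈ I, p ^ #(z.2.image fun y => s(z.1, y)) * (1 - p) ^ #(∅ : Finset (Sym2 V)) =
      p ^ (D + 1) := by
    intro z hz
    rw [card_image_of_injOn (hinj _ _), (hI z hz).2, card_empty, pow_zero, mul_one]
  rw [sum_congr rfl h2, sum_const, nsmul_eq_mul]
  have h3 : (#I : ℝ) ≤ Fintype.card V * ((Fintype.card V : ℝ) ^ (D + 1) / (D + 1).factorial) := by
    have h4 : #I ≤ Fintype.card V * (Fintype.card V).choose (D + 1) := by
      refine (card_filter_le _ _).trans (le_of_eq ?_)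
      rw [card_product, card_powersetCard, card_univ]
    refine (by exact_mod_cast h4 : (#I : ℝ) ≤
      Fintype.card V * ((Fintype.card V).choose (D + 1) : ℝ)).trans ?_
    gcongr
    exact Nat.choose_le_pow_div _ _
  calc _ ≤ Fintype.card V * ((Fintype.card V : ℝ) ^ (D + 1) / (D + 1).factorial) * p ^ (D + 1) := by
        gcongr
    _ = _ := by rw [hpc, div_pow]; field_simp

theorem isAddEdge_ofEdges {V : Type*} [DecidableEq V] (a b : V) (s : Finset (Sym2 V)) :
    IsAddEdge (ofEdges (s.erase s(a, b))) (ofEdges (insert s(a, b) s)) a b where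
  le x y h := ofEdges_adj.2
    ⟨mem_insert_of_mem (mem_of_mem_erase (ofEdges_adj.1 h).1), (ofEdges_adj.1 h).2⟩
  adj x y h := by
    by_cases he : s(x, y) = s(a, b)
    · exact Or.inr (Sym2.eq_iff.1 he)
    · refine Or.inl (ofEdges_adj.2 ⟨mem_erase.2 ⟨he, ?_⟩, (ofEdges_adj.1 h).2⟩)
      exact (mem_insert.1 (ofEdges_adj.1 h).1).resolve_left he

/-- The endpoints of `e` have distance at most `2 k`. -/
def NearEnds (k : ℕ) (G : SimpleGraph V) (e : Sym2 V) : Prop :=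
  ∃ x y, e = s(x, y) ∧ y ∈ gball G x (2 * k)

open Classical in
theorem sum_nearEnds_le {G : SimpleGraph V} {D : ℕ} (hD : ∀ x, (G.neighborSet x).ncard ≤ D)
    (E : Finset (Sym2 V)) :
    ∑ e ∈ E, (if NearEnds k G e then (1 : ℝ) else 0) ≤
      Fintype.card V * ((D : ℝ) + 1) ^ (2 * k) := by
  rw [sum_boole]
  have hsub : E.filter (NearEnds k G) ⊆
      (univ : Finset V).biUnion fun x => (gball G x (2 * k)).toFinset.image fun y => s(x, y) := by
    intro e he
    obtain ⟨x, y, rfl, hy⟩ := (mem_filter.1 he).2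
    exact mem_biUnion.2 ⟨x, mem_univ x, mem_image_of_mem _ (Set.mem_toFinset.2 hy)⟩
  have hcard : #(E.filter (NearEnds k G)) ≤ Fintype.card V * (D + 1) ^ (2 * k) := by
    refine (card_le_card hsub).trans (card_biUnion_le_card_mul _ _ _ fun x _ => ?_)
    refine card_image_le.trans ?_
    rw [← Set.ncard_eq_toFinset_card']
    exact ncard_gball_le hD x (2 * k)
  exact_mod_cast hcard

-- Degrees and nearness are measured in the graph of s itself, not after the change at ab; this only
-- weakens the condition and lets all near pairs be counted in a single graph. If some degree
-- exceeds D, the trivial bound is used.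
open Classical in
theorem sq_discrepancy_edge_le (hk : 2 ≤ k) (a b : V) (s : Finset (Sym2 V)) (D : ℕ) :
    (discrepancy k (ofEdges (insert s(a, b) s)) - discrepancy k (ofEdges (s.erase s(a, b)))) ^ 2 ≤
      64 * largeSqSum k (ofEdges (s.erase s(a, b))) (ofEdges (insert s(a, b) s)) a b +
      (32 * (k : ℝ) ^ 2 + 8 * ((D : ℝ) + 1) ^ (2 * k)) *
        (if (∀ x, ((ofEdges s).neighborSet x).ncard ≤ D) ∧ NearEnds k (ofEdges s) s(a, b)
          then 1 else 0) +
      4 * (Fintype.card V : ℝ) ^ 2 *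
        (if ∀ x, ((ofEdges s).neighborSet x).ncard ≤ D then 0 else 1) := by
  have hnn := largeSqSum_nonneg (k := k) (G := ofEdges (s.erase s(a, b)))
    (G' := ofEdges (insert s(a, b) s)) (a := a) (b := b)
  by_cases hD : ∀ x, ((ofEdges s).neighborSet x).ncard ≤ D
  · have hle : ofEdges (s.erase s(a, b)) ≤ ofEdges s := fun x y h =>
      ofEdges_adj.2 ⟨mem_of_mem_erase (ofEdges_adj.1 h).1, (ofEdges_adj.1 h).2⟩
    have h := sq_discrepancy_sub_le hk (isAddEdge_ofEdges a b s) (N := (D + 1) ^ k)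
      ((ncard_gball_mono hle a k).trans (ncard_gball_le hD a k))
      ((ncard_gball_mono hle b k).trans (ncard_gball_le hD b k))
    have hpow : (((D + 1) ^ k : ℕ) : ℝ) ^ 2 = ((D : ℝ) + 1) ^ (2 * k) := by
      push_cast; rw [← pow_mul, mul_comm]
    rw [hpow] at h
    simp only [hD, implies_true, true_and, if_true, mul_zero, add_zero]
    refine h.trans ?_
    gcongr
    by_cases hb : b ∈ gball (ofEdges (s.erase s(a, b))) a (2 * k)
    · rw [if_pos hb, if_pos ⟨a, b, rfl, (SimpleGraph.edist_anti hle).trans hb⟩, mul_one]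
    · rw [if_neg hb]
      split_ifs <;> positivity
  · rw [if_neg fun h => hD h.1, if_neg hD]
    have := sq_discrepancy_sub_le_card k (ofEdges (s.erase s(a, b))) (ofEdges (insert s(a, b) s))
    linarith

theorem bexp_largeSqSum_le (hab : a ≠ b) (hk : 2 ≤ k) (hc : 20 ≤ c) (hV : 0 < Fintype.card V)
    (hpc : p = c / Fintype.card V) (hp : p ≤ 1 / 2) :
    bexp p (allEdges V) (fun s => largeSqSum k (ofEdges (s.erase s(a, b)))
      (ofEdges (insert s(a, b) s)) a b) ≤ 4 * largeSqBound k c (Fintype.card V) := by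
  have h1 := bexp_largeSq_le (isEdgeModel_erase a b) hab hk hc hV hpc hp
  have h2 := bexp_largeSq_le (isEdgeModel_erase b a) hab.symm hk hc hV hpc hp
  have h3 := bexp_largeSq_le (isEdgeModel_insert a b) hab hk hc hV hpc hp
  have h4 := bexp_largeSq_le (isEdgeModel_insert b a) hab.symm hk hc hV hpc hp
  rw [Sym2.eq_swap] at h2 h4
  simp only [largeSqSum, bexp_add]
  linarith

/-- There are at most n²/2 pairs, and pre-factor p/n = c/n² leaves c/2 times the bound per pair: 256
becomes 128c, and 4n² times the degree probability becomes the second term. Near pairs number at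
most n(D + 1)^{2k}, which leaves a factor 1/n. -/
theorem variance_le (hk : 2 ≤ k) (hc : 20 ≤ c) (hV : 0 < Fintype.card V) (p : unitInterval)
    (hpc : (p : ℝ) = c / Fintype.card V) (hp : (p : ℝ) ≤ 1 / 2) (D : ℕ) :
    variance (fun G : SimpleGraph V => Xtilde p G - XtildeLocal k p G)
      (SimpleGraph.binomialRandom V p) ≤
      128 * c * largeSqBound k c (Fintype.card V) +
      2 * c * (Fintype.card V : ℝ) ^ 3 * (c ^ (D + 1) / ((D + 1).factorial : ℝ)) +
      c * (32 * (k : ℝ) ^ 2 + 8 * ((D : ℝ) + 1) ^ (2 * k)) * ((D : ℝ) + 1) ^ (2 * k) /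
        Fintype.card V := by
  classical
  have hn : (0 : ℝ) < Fintype.card V := by exact_mod_cast hV
  have hp0 : (0 : ℝ) ≤ p := p.2.1
  have hp1 : (p : ℝ) ≤ 1 := p.2.2
  rw [variance_Xtilde_sub]
  set n : ℝ := (Fintype.card V : ℝ)
  set τ := largeSqBound k c (Fintype.card V) with hτ
  set K := 32 * (k : ℝ) ^ 2 + 8 * ((D : ℝ) + 1) ^ (2 * k) with hK
  set Δ := n * (c ^ (D + 1) / ((D + 1).factorial : ℝ)) with hΔ
  have hK0 : 0 ≤ K := by positivity
  have hΔ0 : 0 ≤ Δ := by positivity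
  set good : Finset (Sym2 V) → Prop := fun s => ∀ x, ((ofEdges s).neighborSet x).ncard ≤ D
  have hedge : ∀ e ∈ allEdges V, bexp p (allEdges V) (fun s =>
      (discrepancy k (ofEdges (insert e s)) - discrepancy k (ofEdges (s.erase e))) ^ 2) ≤
      (256 * τ + 4 * n ^ 2 * Δ) + K * bexp p (allEdges V) (fun s =>
        if good s ∧ NearEnds k (ofEdges s) e then 1 else 0) := by
    intro e he
    induction e with
    | _ a b =>
      have hab : a ≠ b := by
        intro h; exact mem_allEdges.1 he (by simpa using h)
      refine (bexp_mono hp0 hp1 fun s _ => sq_discrepancy_edge_le hk a b s D).trans ?_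
      rw [bexp_add, bexp_add, bexp_const_mul, bexp_const_mul, bexp_const_mul]
      have h1 := bexp_largeSqSum_le hab hk hc hV hpc hp
      have h2 := bexp_exists_degree_le (V := V) (by linarith) hV hpc hp1 D
      have h3 := mul_le_mul_of_nonneg_left h2 (by positivity : 0 ≤ 4 * n ^ 2)
      linarith
  have hnear : ∑ e ∈ allEdges V, bexp p (allEdges V) (fun s =>
      if good s ∧ NearEnds k (ofEdges s) e then 1 else 0) ≤ n * ((D : ℝ) + 1) ^ (2 * k) := by
    rw [← bexp_sum, ← bexp_const p (allEdges V) (n * ((D : ℝ) + 1) ^ (2 * k))]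
    refine bexp_mono hp0 hp1 fun s _ => ?_
    by_cases hs : good s
    · simp only [hs, true_and]
      exact sum_nearEnds_le hs _
    · simp only [hs, false_and, if_false, sum_const_zero]
      positivity
  have hτ0 : 0 ≤ τ := by
    rw [hτ, largeSqBound]
    positivity
  have hcard : (#(allEdges V) : ℝ) ≤ n ^ 2 / 2 := by
    rw [card_allEdges]
    exact Nat.choose_le_pow_div 2 (Fintype.card V) |>.trans (by norm_num [n])
  have hvar := variance_binomialRandom_le p (discrepancy (V := V) k)
  have hsum : ∑ e ∈ allEdges V, bexp p (allEdges V) (fun s =>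
      (discrepancy k (ofEdges (insert e s)) - discrepancy k (ofEdges (s.erase e))) ^ 2) ≤
      n ^ 2 / 2 * (256 * τ + 4 * n ^ 2 * Δ) + K * (n * ((D : ℝ) + 1) ^ (2 * k)) := by
    refine (sum_le_sum hedge).trans ?_
    rw [sum_add_distrib, sum_const, nsmul_eq_mul, ← mul_sum]
    gcongr
  have hpq : (p : ℝ) * (1 - p) ≤ c / n := by
    rw [← hpc]; nlinarith
  have hpq0 : 0 ≤ (p : ℝ) * (1 - p) := mul_nonneg hp0 (by linarith)
  calc n⁻¹ * _ ≤ n⁻¹ * (c / n *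
        (n ^ 2 / 2 * (256 * τ + 4 * n ^ 2 * Δ) + K * (n * ((D : ℝ) + 1) ^ (2 * k)))) := by
        gcongr
        refine hvar.trans ((mul_le_mul_of_nonneg_left hsum hpq0).trans ?_)
        gcongr
    _ = _ := by
        rw [hΔ]
        field_simp
        ring

end Expectations

end StrongCore

/-! ### Limits -/

namespace StrongCore

open Finset

/-- From one index to the next m grows by a factor of at most about 1.01, by k ≥ 100, and 0.69 ·
1.01² < 0.704. The geometric series is below 3.4, and 0.69 · 3.4 < 5/2. -/
theorem sum_sq_mul_pow_le {k : ℕ} (hk : 100 ≤ k) (M : ℕ) :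
    ∑ m ∈ Ico (k - 1) M, (m : ℝ) ^ 2 * 0.69 ^ m ≤ 5 / 2 * ((k : ℝ) ^ 2 * (3 / 4) ^ (k - 2)) := by
  obtain ⟨j, rfl⟩ : ∃ j, k = j + 2 := ⟨k - 2, by omega⟩
  have hterm : ∀ i : ℕ, (((j + 2 - 1 + i : ℕ) : ℝ)) ^ 2 * 0.69 ^ (j + 2 - 1 + i) ≤
      ((j + 2 : ℕ) : ℝ) ^ 2 * 0.69 ^ (j + 1) * 0.704 ^ i := by
    intro i
    have hj : (98 : ℝ) ≤ j := by exact_mod_cast (by omega : 98 ≤ j)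
    have h1 : 1 + (i : ℝ) * 0.01 ≤ (1 + 0.01) ^ i := one_add_mul_le_pow (by norm_num) i
    have h2 : (((j + 2 - 1 + i : ℕ) : ℝ)) ≤ ((j + 2 : ℕ) : ℝ) * (1 + 0.01) ^ i := by
      have h3 : ((j + 2 : ℕ) : ℝ) * (1 + (i : ℝ) * 0.01) ≤ ((j + 2 : ℕ) : ℝ) * (1 + 0.01) ^ i :=
        mul_le_mul_of_nonneg_left h1 (by positivity)
      refine le_trans ?_ h3
      rw [show j + 2 - 1 + i = j + 1 + i by omega]
      push_cast
      have : (0 : ℝ) ≤ i := by positivity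
      nlinarith
    calc _ ≤ (((j + 2 : ℕ) : ℝ) * (1 + 0.01) ^ i) ^ 2 * 0.69 ^ (j + 2 - 1 + i) := by gcongr
      _ = ((j + 2 : ℕ) : ℝ) ^ 2 * 0.69 ^ (j + 1) * ((1 + 0.01) ^ 2 * 0.69) ^ i := by
        rw [show j + 2 - 1 + i = j + 1 + i by omega, mul_pow, mul_pow, ← pow_mul, ← pow_mul,
          mul_comm i 2, pow_add]
        ring
      _ ≤ _ := by gcongr; norm_num
  rw [sum_Ico_eq_sum_range]
  have hgeo : ∑ i ∈ range (M - (j + 2 - 1)), (0.704 : ℝ) ^ i ≤ 3.4 := by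
    have h0 : (0 : ℝ) ≤ 0.704 ^ (M - (j + 2 - 1)) := by positivity
    rw [geom_sum_eq (by norm_num), div_le_iff_of_neg (by norm_num)]
    linarith
  have hpow : (0.69 : ℝ) ^ j ≤ (3 / 4) ^ j := pow_le_pow_left₀ (by norm_num) (by norm_num) j
  calc _ ≤ ∑ i ∈ range (M - (j + 2 - 1)),
        ((j + 2 : ℕ) : ℝ) ^ 2 * 0.69 ^ (j + 1) * 0.704 ^ i := sum_le_sum fun i _ => hterm i
    _ ≤ ((j + 2 : ℕ) : ℝ) ^ 2 * 0.69 ^ (j + 1) * 3.4 := by rw [← mul_sum]; gcongr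
    _ = (0.69 * 3.4) * (((j + 2 : ℕ) : ℝ) ^ 2 * 0.69 ^ j) := by rw [pow_succ]; ring
    _ ≤ 5 / 2 * (((j + 2 : ℕ) : ℝ) ^ 2 * (3 / 4) ^ (j + 2 - 2)) := by
        rw [Nat.add_sub_cancel]
        gcongr
        norm_num

theorem tendsto_nat_div_atTop {d : ℕ} (hd : 0 < d) : Tendsto (fun n : ℕ => n / d) atTop atTop :=
  tendsto_atTop_atTop.2 fun b => ⟨b * d, fun _ h => (Nat.le_div_iff_mul_le hd).2 h⟩

theorem tendsto_log_atTop : Tendsto (fun n : ℕ => Nat.log 2 n) atTop atTop :=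
  tendsto_atTop_atTop.2 fun b => ⟨2 ^ b, fun _ h =>
    (Nat.le_log_iff_pow_le (by norm_num) ((by positivity : 0 < 2 ^ b).trans_le h).ne').2 h⟩

theorem tendsto_sum_Ico_zero {f : ℕ → ℝ} (hf : Summable f) (h0 : ∀ m, 0 ≤ f m) {u v : ℕ → ℕ}
    (hu : Tendsto u atTop atTop) : Tendsto (fun n => ∑ m ∈ Ico (u n) (v n), f m) atTop (𝓝 0) := by
  refine squeeze_zero (fun n => sum_nonneg fun m _ => h0 m) (fun n => ?_)
    ((tendsto_sum_nat_add f).comp hu)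
  rw [sum_Ico_eq_sum_range]
  have hs : Summable fun i => f (i + u n) := (summable_nat_add_iff (u n)).2 hf
  refine le_trans (le_of_eq (sum_congr rfl fun i _ => by rw [add_comm])) (hs.sum_le_tsum _ ?_)
  exact fun i _ => h0 _

theorem tendsto_mid_sum :
    Tendsto (fun n : ℕ => ∑ m ∈ Ico (n / 100) (n / 20), (m : ℝ) ^ 2 * 0.83 ^ m) atTop (𝓝 0) := by
  refine tendsto_sum_Ico_zero (f := fun m : ℕ => (m : ℝ) ^ 2 * 0.83 ^ m) ?_
    (fun m => by positivity) (tendsto_nat_div_atTop (by norm_num))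
  exact summable_pow_mul_geometric_of_norm_lt_one 2 (by rw [Real.norm_eq_abs]; norm_num [abs_lt])

theorem tendsto_pow_mul_geometric {r : ℝ} (h0 : 0 ≤ r) (h1 : r < 1) (j i : ℕ) :
    Tendsto (fun n : ℕ => ((n + i : ℕ) : ℝ) ^ j * r ^ n) atTop (𝓝 0) := by
  rcases h0.eq_or_lt with rfl | h0
  · refine tendsto_const_nhds.congr' ?_
    filter_upwards [eventually_gt_atTop 0] with n hn
    rw [zero_pow hn.ne', mul_zero]
  · have h := (((tendsto_pow_const_mul_const_pow_of_lt_one j h0.le h1).comp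
      (tendsto_add_atTop_nat i)).const_mul (r ^ i)⁻¹)
    rw [mul_zero] at h
    refine h.congr fun n => ?_
    simp only [Function.comp_apply]
    rw [pow_add]
    field_simp

/-- With j = n/20 − 3 one has n/20 ≤ j + 4, so (1 + 1/20)^n ≤ e^4 e^j. The powers of e cancel and
0.83^j beats the polynomial factor. -/
theorem tendsto_peeling_term :
    Tendsto (fun n : ℕ => (n : ℝ) ^ 2 * (2 * ((0.83 / Real.exp 1) ^ (n / 20 - 3) *
      (1 + 1 / 20) ^ n))) atTop (𝓝 0) := by
  have hlim : Tendsto (fun n : ℕ => 800 * Real.exp 4 *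
      (((n / 20 - 3 + 4 : ℕ) : ℝ) ^ 2 * 0.83 ^ (n / 20 - 3))) atTop (𝓝 0) := by
    have h := ((tendsto_pow_mul_geometric (r := 0.83) (by norm_num) (by norm_num) 2 4).comp
      ((tendsto_sub_atTop_nat 3).comp (tendsto_nat_div_atTop (d := 20) (by norm_num)))).const_mul
        (800 * Real.exp 4)
    rw [mul_zero] at h
    exact h
  refine squeeze_zero' (Eventually.of_forall fun n => by positivity) ?_ hlim
  filter_upwards [eventually_ge_atTop 60] with n hn
  obtain ⟨j, hj⟩ : ∃ j, n / 20 = j + 3 := ⟨n / 20 - 3, by omega⟩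
  rw [hj, Nat.add_sub_cancel]
  have hn1 : (n : ℝ) ≤ 20 * ((j + 4 : ℕ) : ℝ) := by exact_mod_cast (by omega : n ≤ 20 * (j + 4))
  have h1 : (1 + 1 / 20 : ℝ) ^ n ≤ Real.exp 4 * Real.exp 1 ^ j := by
    calc (1 + 1 / 20 : ℝ) ^ n ≤ Real.exp (1 / 20) ^ n :=
          pow_le_pow_left₀ (by norm_num) (by linarith [Real.add_one_le_exp (1 / 20 : ℝ)]) n
      _ = Real.exp (n / 20) := by rw [← Real.exp_nat_mul]; congr 1; ring
      _ ≤ Real.exp (4 + j) := by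
          apply Real.exp_le_exp.2
          push_cast at hn1
          linarith
      _ = _ := by rw [Real.exp_add, ← Real.exp_nat_mul, mul_one]
  calc _ ≤ (20 * ((j + 4 : ℕ) : ℝ)) ^ 2 *
        (2 * ((0.83 / Real.exp 1) ^ j * (Real.exp 4 * Real.exp 1 ^ j))) := by gcongr
    _ = _ := by
        rw [div_pow]
        have := Real.exp_pos 1
        field_simp
        ring

/-- Since n³ ≤ 8^{log₂ n + 1}, the polynomial factor merges into the power c^{log₂ n + 1}, and the
factorial wins. -/
theorem tendsto_degree_term (c : ℝ) (hc : 0 < c) :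
    Tendsto (fun n : ℕ => 2 * c * (n : ℝ) ^ 3 *
      (c ^ (Nat.log 2 n + 1) / ((Nat.log 2 n + 1).factorial : ℝ))) atTop (𝓝 0) := by
  have hlim : Tendsto (fun n : ℕ => 2 * c *
      ((8 * c) ^ (Nat.log 2 n + 1) / ((Nat.log 2 n + 1).factorial : ℝ))) atTop (𝓝 0) := by
    have h := (((FloorSemiring.tendsto_pow_div_factorial_atTop (8 * c)).comp
      (tendsto_add_atTop_nat 1)).comp tendsto_log_atTop).const_mul (2 * c)
    rw [mul_zero] at h
    exact h
  refine squeeze_zero (fun n => by positivity) (fun n => ?_) hlim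
  have h1 : (n : ℝ) ≤ 2 ^ (Nat.log 2 n + 1) := by
    exact_mod_cast (Nat.lt_pow_succ_log_self (by norm_num) n).le
  have h2 : (n : ℝ) ^ 3 ≤ 8 ^ (Nat.log 2 n + 1) := by
    calc (n : ℝ) ^ 3 ≤ (2 ^ (Nat.log 2 n + 1)) ^ 3 := by gcongr
      _ = _ := by rw [← pow_mul, mul_comm, pow_mul]; norm_num
  calc _ ≤ 2 * c * 8 ^ (Nat.log 2 n + 1) *
        (c ^ (Nat.log 2 n + 1) / ((Nat.log 2 n + 1).factorial : ℝ)) := by gcongr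
    _ = _ := by rw [mul_pow]; ring

/-- A power of log n divided by n ≥ 2^{log₂ n}. -/
theorem tendsto_near_term (c : ℝ) (hc : 0 < c) (k : ℕ) :
    Tendsto (fun n : ℕ => c * (32 * (k : ℝ) ^ 2 + 8 * ((Nat.log 2 n : ℝ) + 1) ^ (2 * k)) *
      ((Nat.log 2 n : ℝ) + 1) ^ (2 * k) / n) atTop (𝓝 0) := by
  have hlim : Tendsto (fun n : ℕ => c * (32 * (k : ℝ) ^ 2 + 8) *
      (((Nat.log 2 n + 1 : ℕ) : ℝ) ^ (4 * k) * (1 / 2) ^ Nat.log 2 n)) atTop (𝓝 0) := by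
    have h := ((tendsto_pow_mul_geometric (r := 1 / 2) (by norm_num) (by norm_num) (4 * k) 1).comp
      tendsto_log_atTop).const_mul (c * (32 * (k : ℝ) ^ 2 + 8))
    rw [mul_zero] at h
    exact h
  refine squeeze_zero' (Eventually.of_forall fun n => by positivity) ?_ hlim
  filter_upwards [eventually_gt_atTop 0] with n hn
  set L : ℝ := (Nat.log 2 n : ℝ) + 1 with hL
  have hL1 : 1 ≤ L ^ (2 * k) := one_le_pow₀ (by
    rw [hL]; linarith [Nat.cast_nonneg (α := ℝ) (Nat.log 2 n)])
  have hn2 : (2 : ℝ) ^ Nat.log 2 n ≤ n := by exact_mod_cast Nat.pow_log_le_self 2 hn.ne'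
  have h1 : 32 * (k : ℝ) ^ 2 + 8 * L ^ (2 * k) ≤ (32 * (k : ℝ) ^ 2 + 8) * L ^ (2 * k) := by
    nlinarith [mul_nonneg (sq_nonneg (k : ℝ)) (sub_nonneg.2 hL1)]
  calc _ ≤ c * ((32 * (k : ℝ) ^ 2 + 8) * L ^ (2 * k)) * L ^ (2 * k) / 2 ^ Nat.log 2 n := by gcongr
    _ = _ := by
        rw [show 4 * k = 2 * k + 2 * k by ring, pow_add, one_div, inv_pow, Nat.cast_add,
          Nat.cast_one, ← hL]
        ring

end StrongCore

theorem lemma5p2 (k : ℕ) (hk : 100 ≤ k) (c : ℝ) (hc : 20 ≤ c) :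
    ∃ ε : ℕ → ℝ, Tendsto ε atTop (𝓝 0) ∧
      ∀ n : ℕ, 0 < n → ∀ p : unitInterval, (p : ℝ) = c / (n : ℝ) →
        variance (fun G : SimpleGraph (Fin n) =>
            StrongCore.Xtilde p G - StrongCore.XtildeLocal k p G)
          (SimpleGraph.binomialRandom (Fin n) p) ≤
        64 * c * (k : ℝ) ^ 2 * (3 / 4 : ℝ) ^ (k - 2) + ε n := by
  classical
  have hc0 : 0 < c := by linarith
  set S : ℕ → ℝ := fun n => ∑ m ∈ Finset.Ico (n / 100) (n / 20), (m : ℝ) ^ 2 * 0.83 ^ m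
  set T : ℕ → ℝ := fun n => (n : ℝ) ^ 2 * (2 * ((0.83 / Real.exp 1) ^ (n / 20 - 3) *
      (1 + 1 / 20) ^ n))
  set A : ℕ → ℝ := fun n => 2 * c * (n : ℝ) ^ 3 *
      (c ^ (Nat.log 2 n + 1) / ((Nat.log 2 n + 1).factorial : ℝ))
  set B : ℕ → ℝ := fun n => c * (32 * (k : ℝ) ^ 2 + 8 * ((Nat.log 2 n : ℝ) + 1) ^ (2 * k)) *
      ((Nat.log 2 n : ℝ) + 1) ^ (2 * k) / n
  -- For the finitely many n < 2c the bound p ≤ 1/2 fails; there the error term simply contains the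
  -- variance itself. The inner condition is needed because c/n may exceed 1.
  set W : ℕ → ℝ := fun n => if (n : ℝ) < 2 * c then
    (if h : c / (n : ℝ) ∈ unitInterval then
      variance (fun G : SimpleGraph (Fin n) =>
        StrongCore.Xtilde ⟨c / n, h⟩ G - StrongCore.XtildeLocal k ⟨c / n, h⟩ G)
        (SimpleGraph.binomialRandom (Fin n) ⟨c / n, h⟩) else 0) else 0
  refine ⟨fun n => 512 * S n + 128 * c * T n + A n + B n + W n, ?_, ?_⟩
  · have hW : Tendsto W atTop (𝓝 0) := by
      refine tendsto_const_nhds.congr' ?_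
      filter_upwards [eventually_ge_atTop ⌈2 * c⌉₊] with n hn
      exact (if_neg (not_lt.2 (Nat.ceil_le.1 hn))).symm
    have h := ((((StrongCore.tendsto_mid_sum.const_mul 512).add
      (StrongCore.tendsto_peeling_term.const_mul (128 * c))).add
      (StrongCore.tendsto_degree_term c hc0)).add (StrongCore.tendsto_near_term c hc0 k)).add hW
    simpa only [mul_zero, add_zero] using h
  · intro n hn p hp
    have hn' : (0 : ℝ) < n := by exact_mod_cast hn
    have hS : 0 ≤ S n := Finset.sum_nonneg fun m _ => by positivity
    have hT : 0 ≤ T n := by positivity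
    have hA : 0 ≤ A n := by positivity
    have hB : 0 ≤ B n := by positivity
    by_cases hsmall : (n : ℝ) < 2 * c
    · have hW : W n = variance (fun G : SimpleGraph (Fin n) =>
          StrongCore.Xtilde p G - StrongCore.XtildeLocal k p G)
          (SimpleGraph.binomialRandom (Fin n) p) := by
        have hmem : c / (n : ℝ) ∈ unitInterval := hp ▸ p.2
        have hpe : p = ⟨c / n, hmem⟩ := Subtype.ext hp
        simp only [W, if_pos hsmall, dif_pos hmem, hpe]
      rw [← hW]
      have hmain : 0 ≤ 64 * c * (k : ℝ) ^ 2 * (3 / 4 : ℝ) ^ (k - 2) := by positivity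
      have : 0 ≤ 128 * c * T n := by positivity
      linarith
    · have hW : W n = 0 := if_neg hsmall
      have hV : 0 < Fintype.card (Fin n) := by rwa [Fintype.card_fin]
      -- The degree cutoff log₂ n is large enough for the degree term and small enough for the
      -- near-pair term to vanish.
      have h := StrongCore.variance_le (V := Fin n) (k := k) (by omega) hc hV p
        (by rwa [Fintype.card_fin])
        (by rw [hp, div_le_iff₀ hn']; linarith [not_lt.1 hsmall]) (Nat.log 2 n)
      rw [Fintype.card_fin] at h
      refine h.trans ?_
      have hsum := StrongCore.sum_sq_mul_pow_le hk (n / 20)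
      have hbound : 128 * c * StrongCore.largeSqBound k c n =
          512 * ∑ m ∈ Finset.Ico (k - 1) (n / 20), (m : ℝ) ^ 2 * 0.69 ^ m +
            512 * S n + 128 * c * T n := by
        rw [StrongCore.largeSqBound]
        field_simp
        ring
      have hk2 : 0 ≤ (k : ℝ) ^ 2 * (3 / 4 : ℝ) ^ (k - 2) := by positivity
      -- This is where c ≥ 20 enters exactly: 512 · 5/2 = 1280 = 64 · 20.
      have hfin : 512 * (5 / 2 * ((k : ℝ) ^ 2 * (3 / 4 : ℝ) ^ (k - 2))) ≤
          64 * c * (k : ℝ) ^ 2 * (3 / 4 : ℝ) ^ (k - 2) := by nlinarith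
      change _ + A n + B n ≤ _ + (512 * S n + 128 * c * T n + A n + B n + W n)
      rw [hW, hbound]
      linarith
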